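/- All topological spaces are compactly generated (weak Hausdorff $k$-spaces), and products and subspaces are taken in this category. A \emph{flow} $X$ consists of a space $\mathbb{P}X$ (the path space), a discrete space $X^0$ (the $0$-skeleton), continuous maps $s,t:\mathbb{P}X\to X^0$, and a continuous associative map $*:\{(x,y)\in\mathbb{P}X\times\mathbb{P}X : t(x)=s(y)\}\to\mathbb{P}X$ with $s(x*y)=s(x)$ and $t(x*y)=t(y)$. A morphism of flows $f:X\to Y$ is a set map $f^0:X^0\to Y^0$ together with a continuous map $\mathbb{P}f:\mathbb{P}X\to\mathbb{P}Y$ compatible with $s$, $t$ and $*$. For a space $Z$, $\mathrm{Glob}(Z)$ is the flow with $0$-skeleton $\{0,1\}$, path space $Z$, $s=0$ and $t=1$; a set is regarded as a flow with empty path space. Equip the category of flows with its model structure: \begin{itemize} \item the weak equivalences are the morphisms $f$ such that $f^0$ is a bijection and $\mathbb{P}f$ is a weak homotopy equivalence; \item the fibrations are the morphisms with the right lifting property with respect to the maps $\mathrm{Glob}(\mathbf{D}^n)\to\mathrm{Glob}([0,1]\times\mathbf{D}^n)$, $n\ge 0$, induced by $x\mapsto(0,x)$; \item the cofibrations are the morphisms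 with the left lifting property with respect to every morphism that has the right lifting property with respect to the inclusions $\mathrm{Glob}(\mathbf{S}^{n-1})\to\mathrm{Glob}(\mathbf{D}^n)$, $n\ge0$ (with $\mathbf{S}^{-1}=\varnothing$), the map $R:\{0,1\}\to\{0\}$ and the map $C:\varnothing\to\{0\}$. \end{itemize} A flow $X$ is cofibrant if $\varnothing\to X$ is a cofibration. Two morphisms $f,g:X\to Y$ are \emph{left homotopic}, $f\sim_l g$, if the codiagonal $X\sqcup X\to X$ factors as a cofibration $X\sqcup X\to I(X)$ followed by a trivial fibration (a fibration that is a weak equivalence) $I(X)\to X$ such that $f\sqcup g:X\sqcup X\to Y$ is the composite of $X\sqcup X\to I(X)$ with some morphism $I(X)\to Y$. They are \emph{S-homotopic}, $f\sim_S g$, if there is a continuous map $H:[0,1]\times(X^0\sqcup\mathbb{P}X)\to Y^0\sqcup\mathbb{P}Y$ such that $H(u,-)$ is a morphism of flows for every $u\in[0,1]$, $H(0,-)=f$ and $H(1,-)=g$. Two flows $X$ and $Y$ are \emph{left homotopy equivalent} (resp. \emph{S-homotopy equivalent}) if there are morphisms $f:X\to Y$ and $g:Y\to X$ with $f\circ g\sim\mathrm{Id}_Y$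 and $g\circ f\sim\mathrm{Id}_X$, where $\sim$ is $\sim_l$ (resp. $\sim_S$). \textbf{Theorem.} Two cofibrant flows are left homotopy equivalent if and only if they are S-homotopy equivalent. -/

import Mathlib

open CategoryTheory HomotopicalAlgebra Topology

universe u

/-- A space is weak Hausdorff if the image of every continuous map from a compact Hausdorff
space is closed. -/
class WeakHausdorffSpace (X : Type u) [TopologicalSpace X] : Prop where
  isClosed_range : ∀ (K : CompHaus.{u}) (f : C(K, X)), IsClosed (Set.range f)

instance (X : Type u) [TopologicalSpace X] [T2Space X] : WeakHausdorffSpace X where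
  isClosed_range _ f := (isCompact_range f.continuous).isClosed

/-- A flow. All spaces are compactly generated, i.e. weak Hausdorff `k`-spaces, so the space of
composable pairs carries the Kelleyfication of the topology induced by the product. -/
structure DirectedFlow : Type (u + 1) where
  /-- the `0`-skeleton -/
  states : Type u
  [topStates : TopologicalSpace states]
  [discreteStates : DiscreteTopology states]
  /-- the path space -/
  paths : Type u
  [topPaths : TopologicalSpace paths]
  [compactlyGeneratedPaths : CompactlyGeneratedSpace paths]
  [weakHausdorffPaths : WeakHausdorffSpace paths]
  /-- the source map -/
  src : paths → states
  /-- the target map -/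
  tgt : paths → states
  continuous_src : Continuous src
  continuous_tgt : Continuous tgt
  /-- the concatenation of composable paths -/
  concat : ∀ x y : paths, tgt x = src y → paths
  continuous_concat :
    Continuous[TopologicalSpace.compactlyGenerated.{u} {p : paths × paths // tgt p.1 = src p.2},
      topPaths] (fun p => concat p.1.1 p.1.2 p.2)
  src_concat : ∀ x y h, src (concat x y h) = src x
  tgt_concat : ∀ x y h, tgt (concat x y h) = tgt y
  concat_assoc : ∀ (x y z : paths) (hxy : tgt x = src y) (hyz : tgt y = src z),
    concat (concat x y hxy) z ((tgt_concat x y hxy).trans hyz) =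
      concat x (concat y z hyz) (hxy.trans (src_concat y z hyz).symm)

namespace DirectedFlow

attribute [instance] topStates discreteStates topPaths compactlyGeneratedPaths weakHausdorffPaths

/-- Morphisms of flows. -/
@[ext]
structure Hom (X Y : DirectedFlow.{u}) : Type u where
  onStates : X.states → Y.states
  onPaths : C(X.paths, Y.paths)
  src_onPaths : ∀ x, Y.src (onPaths x) = onStates (X.src x)
  tgt_onPaths : ∀ x, Y.tgt (onPaths x) = onStates (X.tgt x)
  map_concat : ∀ (x y : X.paths) (h : X.tgt x = X.src y),
    onPaths (X.concat x y h) =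
      Y.concat (onPaths x) (onPaths y)
        ((tgt_onPaths x).trans ((congrArg onStates h).trans (src_onPaths y).symm))

instance : Category.{u} DirectedFlow.{u} where
  Hom := Hom
  id X :=
    { onStates := id
      onPaths := ContinuousMap.id _
      src_onPaths := fun _ => rfl
      tgt_onPaths := fun _ => rfl
      map_concat := fun _ _ _ => rfl }
  comp f g :=
    { onStates := g.onStates ∘ f.onStates
      onPaths := g.onPaths.comp f.onPaths
      src_onPaths := fun x => by simp [g.src_onPaths, f.src_onPaths]
      tgt_onPaths := fun x => by simp [g.tgt_onPaths, f.tgt_onPaths]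
      map_concat := fun x y h => by simp [f.map_concat, g.map_concat] }

@[ext]
theorem hom_ext {X Y : DirectedFlow.{u}} {f g : X ⟶ Y} (h₀ : ∀ x, f.onStates x = g.onStates x)
    (h₁ : ∀ x, f.onPaths x = g.onPaths x) : f = g :=
  Hom.ext (funext h₀) (ContinuousMap.ext h₁)

/-! ### Globes, discrete flows, generating morphisms -/

/-- The globe of a compactly generated space. -/
def glob (Z : Type u) [TopologicalSpace Z] [CompactlyGeneratedSpace Z] [WeakHausdorffSpace Z] :
    DirectedFlow.{u} where
  states := ULift.{u} (Fin 2)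
  paths := Z
  src _ := ⟨0⟩
  tgt _ := ⟨1⟩
  continuous_src := continuous_const
  continuous_tgt := continuous_const
  concat _ _ h := absurd (congrArg ULift.down h) (by decide)
  continuous_concat := by
    have : IsEmpty {_p : Z × Z // (⟨1⟩ : ULift.{u} (Fin 2)) = ⟨0⟩} :=
      ⟨fun p => absurd (congrArg ULift.down p.2) (by decide)⟩
    exact continuous_from_compactlyGenerated _ fun S g =>
      have : IsEmpty S := ⟨fun s => this.false (g s)⟩
      continuous_of_const fun x => (this.false x).elim
  src_concat _ _ h := absurd (congrArg ULift.down h) (by decide)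
  tgt_concat _ _ h := absurd (congrArg ULift.down h) (by decide)
  concat_assoc _ _ _ h := absurd (congrArg ULift.down h) (by decide)

/-- The morphism of globes induced by a continuous map. -/
def globMap {Z W : Type u} [TopologicalSpace Z] [CompactlyGeneratedSpace Z] [WeakHausdorffSpace Z]
    [TopologicalSpace W] [CompactlyGeneratedSpace W] [WeakHausdorffSpace W] (f : C(Z, W)) :
    glob Z ⟶ glob W where
  onStates := id
  onPaths := f
  src_onPaths _ := rfl
  tgt_onPaths _ := rfl
  map_concat _ _ h := absurd (congrArg ULift.down h) (by change ¬ ((1 : Fin 2) = 0); decide)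

/-- The flow with `0`-skeleton `S` and empty path space. -/
def discrete (S : Type u) [TopologicalSpace S] [DiscreteTopology S] : DirectedFlow.{u} where
  states := S
  paths := PEmpty
  src := PEmpty.elim
  tgt := PEmpty.elim
  continuous_src := continuous_of_const fun x => x.elim
  continuous_tgt := continuous_of_const fun x => x.elim
  concat x := x.elim
  continuous_concat := continuous_from_compactlyGenerated _ fun _ g =>
    continuous_of_const fun x => (g x).1.1.elim
  src_concat x := x.elim
  tgt_concat x := x.elim
  concat_assoc x := x.elim

/-- Morphisms out of a flow without paths are maps on the `0`-skeleton. -/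
def discreteDesc {S : Type u} [TopologicalSpace S] [DiscreteTopology S] {X : DirectedFlow.{u}}
    (f : S → X.states) : discrete S ⟶ X where
  onStates := f
  onPaths := ⟨PEmpty.elim, continuous_of_const fun x => x.elim⟩
  src_onPaths x := x.elim
  tgt_onPaths x := x.elim
  map_concat x := x.elim

instance (n : ℕ) : T2Space (TopCat.disk.{u} n) :=
  inferInstanceAs (T2Space (ULift (Metric.closedBall (0 : EuclideanSpace ℝ (Fin n)) 1)))

instance (n : ℕ) : T2Space (TopCat.diskBoundary.{u} n) :=
  inferInstanceAs (T2Space (ULift (Metric.sphere (0 : EuclideanSpace ℝ (Fin n)) 1)))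

/-- `Glob(S^{n-1}) ⟶ Glob(D^n)`, with `S^{-1}` empty. -/
noncomputable def globBoundaryInclusion (n : ℕ) :
    glob (TopCat.diskBoundary.{u} n) ⟶ glob (TopCat.disk.{u} n) :=
  globMap (TopCat.diskBoundaryInclusion.{u} n).hom

/-- `Glob(D^n) ⟶ Glob([0,1] × D^n)`, induced by `x ↦ (0, x)`. -/
noncomputable def globCylinderInclusion (n : ℕ) :
    glob (TopCat.disk.{u} n) ⟶ glob (unitInterval × TopCat.disk.{u} n) :=
  globMap ⟨fun x => (0, x), by fun_prop⟩

/-- `R : {0,1} ⟶ {0}` -/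
def mapR : discrete (ULift.{u} (Fin 2)) ⟶ discrete PUnit.{u + 1} :=
  discreteDesc fun _ => (PUnit.unit : PUnit.{u + 1})

/-- `C : ∅ ⟶ {0}` -/
def mapC : discrete PEmpty.{u + 1} ⟶ discrete PUnit.{u + 1} :=
  discreteDesc PEmpty.elim

/-- The generating cofibrations. -/
def generatingCofibrations : MorphismProperty DirectedFlow.{u} :=
  .ofHoms globBoundaryInclusion.{u} ⊔ .single mapR.{u} ⊔ .single mapC.{u}

/-- The generating trivial cofibrations. -/
def generatingTrivialCofibrations : MorphismProperty DirectedFlow.{u} :=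
  .ofHoms globCylinderInclusion.{u}

/-! ### Weak S-homotopy equivalences -/

/-- The map induced on path components. -/
def mapZerothHomotopy {A B : Type u} [TopologicalSpace A] [TopologicalSpace B] (f : C(A, B)) :
    ZerothHomotopy A → ZerothHomotopy B :=
  Quotient.map f fun _ _ h => h.map f.continuous

/-- The map induced on the `n`-th homotopy group. -/
def mapHomotopyGroup {A B : Type u} [TopologicalSpace A] [TopologicalSpace B] (f : C(A, B))
    (n : ℕ) (a : A) : HomotopyGroup.Pi n A a → HomotopyGroup.Pi n B (f a) :=
  Quotient.map (fun p => ⟨f.comp p.1, fun y hy => congrArg f (p.2 y hy)⟩)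
    fun _ _ h => ContinuousMap.HomotopicRel.comp_continuousMap h f

/-- `f` is a weak homotopy equivalence: it induces a bijection on path components and
isomorphisms on all homotopy groups at all base points. -/
def IsWeakHomotopyEquivalence {A B : Type u} [TopologicalSpace A] [TopologicalSpace B]
    (f : C(A, B)) : Prop :=
  Function.Bijective (mapZerothHomotopy f) ∧
    ∀ n : ℕ, 1 ≤ n → ∀ a : A, Function.Bijective (mapHomotopyGroup f n a)

/-- A morphism of flows is synchronized if it is bijective on `0`-skeletons. -/
def IsSynchronized {X Y : DirectedFlow.{u}} (f : X ⟶ Y) : Prop :=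
  Function.Bijective f.onStates

/-- Weak S-homotopy equivalences. -/
def IsWeakSHomotopyEquivalence {X Y : DirectedFlow.{u}} (f : X ⟶ Y) : Prop :=
  IsSynchronized f ∧ IsWeakHomotopyEquivalence f.onPaths

/-! ### The classes of morphisms of the model structure -/

instance : CategoryWithWeakEquivalences DirectedFlow.{u} where
  weakEquivalences := fun _ _ f => IsWeakSHomotopyEquivalence f

instance : CategoryWithFibrations DirectedFlow.{u} where
  fibrations := generatingTrivialCofibrations.rlp

instance : CategoryWithCofibrations DirectedFlow.{u} where
  cofibrations := generatingCofibrations.rlp.llp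

/-! ### The initial flow and binary coproducts -/

instance : Limits.HasInitial DirectedFlow.{u} :=
  (Limits.IsInitial.ofUniqueHom (X := discrete PEmpty.{u + 1})
    (fun _ => discreteDesc PEmpty.elim)
    (fun _ _ => hom_ext (fun x => x.elim) (fun x => x.elim))).hasInitial

/-- Concatenation in a disjoint union. -/
def sumConcat (X Y : DirectedFlow.{u}) : ∀ x y : X.paths ⊕ Y.paths,
    Sum.map X.tgt Y.tgt x = Sum.map X.src Y.src y → X.paths ⊕ Y.paths
  | .inl x, .inl y, h => .inl (X.concat x y (Sum.inl_injective h))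
  | .inr x, .inr y, h => .inr (Y.concat x y (Sum.inr_injective h))
  | .inl _, .inr _, h => absurd h (by simp)
  | .inr _, .inl _, h => absurd h (by simp)

theorem continuous_concat_comp (X : DirectedFlow.{u}) {K : Type u} [TopologicalSpace K]
    [CompactSpace K] [T2Space K] {a b : K → X.paths} (ha : Continuous a) (hb : Continuous b)
    (h : ∀ k, X.tgt (a k) = X.src (b k)) :
    Continuous fun k => X.concat (a k) (b k) (h k) := by
  let g : C(CompHaus.of K, {p : X.paths × X.paths // X.tgt p.1 = X.src p.2}) :=
    ⟨fun k => ⟨(a k, b k), h k⟩, (ha.prodMk hb).subtype_mk _⟩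
  have h1 := X.continuous_concat
  rw [TopologicalSpace.compactlyGenerated, continuous_coinduced_dom] at h1
  exact (continuous_sigma_iff.1 h1) ⟨CompHaus.of K, g⟩

theorem exists_lift_inl {A B K : Type u} [TopologicalSpace A] [TopologicalSpace B]
    [TopologicalSpace K] {f : K → A ⊕ B} (hf : Continuous f) (h : ∀ k, (f k).isLeft) :
    ∃ g : K → A, Continuous g ∧ ∀ k, f k = Sum.inl (g k) := by
  refine ⟨fun k => (f k).getLeft (h k), ?_, fun k => (Sum.inl_getLeft _ _).symm⟩
  refine (Topology.IsEmbedding.inl (X := A) (Y := B)).continuous_iff.2 ?_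
  exact hf.congr fun k => (Sum.inl_getLeft _ _).symm

theorem exists_lift_inr {A B K : Type u} [TopologicalSpace A] [TopologicalSpace B]
    [TopologicalSpace K] {f : K → A ⊕ B} (hf : Continuous f) (h : ∀ k, (f k).isRight) :
    ∃ g : K → B, Continuous g ∧ ∀ k, f k = Sum.inr (g k) := by
  refine ⟨fun k => (f k).getRight (h k), ?_, fun k => (Sum.inr_getRight _ _).symm⟩
  refine (Topology.IsEmbedding.inr (X := A) (Y := B)).continuous_iff.2 ?_
  exact hf.congr fun k => (Sum.inr_getRight _ _).symm

theorem isClopen_isLeft {A B K : Type u} [TopologicalSpace A] [TopologicalSpace B]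
    [TopologicalSpace K] {f : K → A ⊕ B} (hf : Continuous f) : IsClopen {k | (f k).isLeft} := by
  have h : Continuous fun x : A ⊕ B => x.isLeft :=
    continuous_sum_dom.2 ⟨continuous_const, continuous_const⟩
  exact (isClopen_discrete {true}).preimage (h.comp hf)

theorem isClopen_isRight {A B K : Type u} [TopologicalSpace A] [TopologicalSpace B]
    [TopologicalSpace K] {f : K → A ⊕ B} (hf : Continuous f) : IsClopen {k | (f k).isRight} := by
  have h : Continuous fun x : A ⊕ B => x.isRight :=
    continuous_sum_dom.2 ⟨continuous_const, continuous_const⟩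
  exact (isClopen_discrete {true}).preimage (h.comp hf)

instance (A B : Type u) [TopologicalSpace A] [TopologicalSpace B] [WeakHausdorffSpace A]
    [WeakHausdorffSpace B] : WeakHausdorffSpace (A ⊕ B) where
  isClosed_range K f := by
    refine isClosed_sum_iff.2 ⟨?_, ?_⟩
    · have : CompactSpace {k | (f k).isLeft} :=
        isCompact_iff_compactSpace.1 (isClopen_isLeft f.continuous).isClosed.isCompact
      obtain ⟨g, hg, hfg⟩ := exists_lift_inl (K := {k | (f k).isLeft})
        (f.continuous.comp continuous_subtype_val) (fun k => k.2)
      convert! WeakHausdorffSpace.isClosed_range (CompHaus.of {k | (f k).isLeft}) ⟨g, hg⟩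
      ext x
      refine ⟨fun ⟨k, hk⟩ => ⟨⟨k, by simp [hk]⟩, ?_⟩, fun ⟨k, hk⟩ => ⟨k.1, ?_⟩⟩
      · exact Sum.inl_injective ((hfg _).symm.trans hk)
      · exact (hfg k).trans (congrArg Sum.inl hk)
    · have : CompactSpace {k | (f k).isRight} :=
        isCompact_iff_compactSpace.1 (isClopen_isRight f.continuous).isClosed.isCompact
      obtain ⟨g, hg, hfg⟩ := exists_lift_inr (K := {k | (f k).isRight})
        (f.continuous.comp continuous_subtype_val) (fun k => k.2)
      convert! WeakHausdorffSpace.isClosed_range (CompHaus.of {k | (f k).isRight}) ⟨g, hg⟩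
      ext x
      refine ⟨fun ⟨k, hk⟩ => ⟨⟨k, by simp [hk]⟩, ?_⟩, fun ⟨k, hk⟩ => ⟨k.1, ?_⟩⟩
      · exact Sum.inr_injective ((hfg _).symm.trans hk)
      · exact (hfg k).trans (congrArg Sum.inr hk)

theorem continuous_sumConcat (X Y : DirectedFlow.{u}) {K : Type u} [TopologicalSpace K]
    [CompactSpace K] [T2Space K] {a b : K → X.paths ⊕ Y.paths} (ha : Continuous a)
    (hb : Continuous b) (h : ∀ k, Sum.map X.tgt Y.tgt (a k) = Sum.map X.src Y.src (b k)) :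
    Continuous fun k => sumConcat X Y (a k) (b k) (h k) := by
  rw [continuous_iff_continuousAt]
  intro k₀
  cases ha₀ : a k₀ with
  | inl x₀ =>
    have hU := isClopen_isLeft ha
    have hk : k₀ ∈ {k | (a k).isLeft} := by simp [ha₀]
    have : CompactSpace {k | (a k).isLeft} :=
      isCompact_iff_compactSpace.1 hU.isClosed.isCompact
    obtain ⟨a', ha', haa⟩ := exists_lift_inl (K := {k | (a k).isLeft})
      (ha.comp continuous_subtype_val) (fun k => k.2)
    obtain ⟨b', hb', hbb⟩ := exists_lift_inl (K := {k | (a k).isLeft})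
      (hb.comp continuous_subtype_val) (fun k => by
        have := h k.1
        have h2 := haa k
        simp only [Function.comp_apply] at h2 ⊢
        rw [h2] at this
        cases hb₀ : b k.1 with
        | inl y => rfl
        | inr y => simp [hb₀] at this)
    simp only [Function.comp_apply] at haa hbb
    have hc : ∀ k, X.tgt (a' k) = X.src (b' k) := fun k => by
      have := h k.1
      rw [haa, hbb] at this
      exact Sum.inl_injective this
    have key : ContinuousOn (fun k => sumConcat X Y (a k) (b k) (h k)) {k | (a k).isLeft} := by
      rw [continuousOn_iff_continuous_domRestrict]
      refine (continuous_inl.comp (X.continuous_concat_comp ha' hb' hc)).congr fun k => ?_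
      simp only [Function.comp_apply, Set.domRestrict_apply]
      have e : ∀ (x y) (hx : a k.1 = x) (hy : b k.1 = y)
          (h' : Sum.map X.tgt Y.tgt x = Sum.map X.src Y.src y),
          sumConcat X Y x y h' = sumConcat X Y (a k.1) (b k.1) (h k.1) := by
        rintro x y rfl rfl _; rfl
      exact e _ _ (haa k) (hbb k) (congrArg Sum.inl (hc k))
    exact key.continuousAt (hU.isOpen.mem_nhds hk)
  | inr x₀ =>
    have hU := isClopen_isRight ha
    have hk : k₀ ∈ {k | (a k).isRight} := by simp [ha₀]
    have : CompactSpace {k | (a k).isRight} :=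
      isCompact_iff_compactSpace.1 hU.isClosed.isCompact
    obtain ⟨a', ha', haa⟩ := exists_lift_inr (K := {k | (a k).isRight})
      (ha.comp continuous_subtype_val) (fun k => k.2)
    obtain ⟨b', hb', hbb⟩ := exists_lift_inr (K := {k | (a k).isRight})
      (hb.comp continuous_subtype_val) (fun k => by
        have := h k.1
        have h2 := haa k
        simp only [Function.comp_apply] at h2 ⊢
        rw [h2] at this
        cases hb₀ : b k.1 with
        | inr y => rfl
        | inl y => simp [hb₀] at this)
    simp only [Function.comp_apply] at haa hbb
    have hc : ∀ k, Y.tgt (a' k) = Y.src (b' k) := fun k => by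
      have := h k.1
      rw [haa, hbb] at this
      exact Sum.inr_injective this
    have key : ContinuousOn (fun k => sumConcat X Y (a k) (b k) (h k)) {k | (a k).isRight} := by
      rw [continuousOn_iff_continuous_domRestrict]
      refine (continuous_inr.comp (Y.continuous_concat_comp ha' hb' hc)).congr fun k => ?_
      simp only [Function.comp_apply, Set.domRestrict_apply]
      have e : ∀ (x y) (hx : a k.1 = x) (hy : b k.1 = y)
          (h' : Sum.map X.tgt Y.tgt x = Sum.map X.src Y.src y),
          sumConcat X Y x y h' = sumConcat X Y (a k.1) (b k.1) (h k.1) := by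
        rintro x y rfl rfl _; rfl
      exact e _ _ (haa k) (hbb k) (congrArg Sum.inr (hc k))
    exact key.continuousAt (hU.isOpen.mem_nhds hk)

/-- The disjoint union of two flows. -/
def sum (X Y : DirectedFlow.{u}) : DirectedFlow.{u} where
  states := X.states ⊕ Y.states
  paths := X.paths ⊕ Y.paths
  src := Sum.map X.src Y.src
  tgt := Sum.map X.tgt Y.tgt
  continuous_src := X.continuous_src.sumMap Y.continuous_src
  continuous_tgt := X.continuous_tgt.sumMap Y.continuous_tgt
  concat := sumConcat X Y
  continuous_concat := continuous_from_compactlyGenerated _ fun _ g =>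
    continuous_sumConcat X Y (continuous_fst.comp (continuous_subtype_val.comp g.continuous))
      (continuous_snd.comp (continuous_subtype_val.comp g.continuous)) fun k => (g k).2
  src_concat := by
    rintro (x | x) (y | y) h
    · simp [sumConcat, X.src_concat]
    · simp at h
    · simp at h
    · simp [sumConcat, Y.src_concat]
  tgt_concat := by
    rintro (x | x) (y | y) h
    · simp [sumConcat, X.tgt_concat]
    · simp at h
    · simp at h
    · simp [sumConcat, Y.tgt_concat]
  concat_assoc := by
    rintro (x | x) (y | y) (z | z) h h'
    · exact congrArg Sum.inl (X.concat_assoc x y z _ _)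
    · simp at h'
    · simp at h
    · simp at h
    · simp at h
    · simp at h
    · simp at h'
    · exact congrArg Sum.inr (Y.concat_assoc x y z _ _)

/-- The first inclusion. -/
def sumInl (X Y : DirectedFlow.{u}) : X ⟶ sum X Y where
  onStates := Sum.inl
  onPaths := ⟨Sum.inl, continuous_inl⟩
  src_onPaths _ := rfl
  tgt_onPaths _ := rfl
  map_concat _ _ _ := rfl

/-- The second inclusion. -/
def sumInr (X Y : DirectedFlow.{u}) : Y ⟶ sum X Y where
  onStates := Sum.inr
  onPaths := ⟨Sum.inr, continuous_inr⟩
  src_onPaths _ := rfl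
  tgt_onPaths _ := rfl
  map_concat _ _ _ := rfl

/-- The morphism out of a disjoint union given by two morphisms. -/
def sumDesc {X Y Z : DirectedFlow.{u}} (f : X ⟶ Z) (g : Y ⟶ Z) : sum X Y ⟶ Z where
  onStates := Sum.elim f.onStates g.onStates
  onPaths := ⟨Sum.elim f.onPaths g.onPaths, f.onPaths.continuous.sumElim g.onPaths.continuous⟩
  src_onPaths := by
    rintro (x | x)
    · exact f.src_onPaths x
    · exact g.src_onPaths x
  tgt_onPaths := by
    rintro (x | x)
    · exact f.tgt_onPaths x
    · exact g.tgt_onPaths x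
  map_concat := by
    rintro (x | x) (y | y) h
    · exact f.map_concat x y _
    · exact absurd h (by simp [sum])
    · exact absurd h (by simp [sum])
    · exact g.map_concat x y _

/-- The disjoint union is the coproduct. -/
def sumIsColimit (X Y : DirectedFlow.{u}) :
    Limits.IsColimit (Limits.BinaryCofan.mk (sumInl X Y) (sumInr X Y)) :=
  Limits.BinaryCofan.isColimitMk (fun s => sumDesc s.inl s.inr) (fun _ => rfl) (fun _ => rfl)
    (fun s m h₁ h₂ => by
      refine hom_ext ?_ ?_
      · rintro (x | x)
        · exact congrFun (congrArg Hom.onStates h₁) x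
        · exact congrFun (congrArg Hom.onStates h₂) x
      · rintro (x | x)
        · exact DFunLike.congr_fun (congrArg Hom.onPaths h₁) x
        · exact DFunLike.congr_fun (congrArg Hom.onPaths h₂) x)

instance : Limits.HasBinaryCoproducts DirectedFlow.{u} :=
  have (X Y : DirectedFlow.{u}) : Limits.HasColimit (Limits.pair X Y) := ⟨_, sumIsColimit X Y⟩
  Limits.hasBinaryCoproducts_of_hasColimit_pair _

/-! ### Left homotopy and S-homotopy -/

/-- `f ∼ₗ g`: the map `(f, g) : X ⨿ X ⟶ Y` extends to some `I`, where `X ⨿ X ⟶ I ⟶ X` is a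
factorization of the codiagonal as a cofibration followed by a trivial fibration. -/
def LeftHomotopic {X Y : DirectedFlow.{u}} (f g : X ⟶ Y) : Prop :=
  ∃ P : Cylinder X, P.IsVeryGood ∧ Nonempty (P.LeftHomotopy f g)

/-- Left homotopy equivalent flows. -/
def LeftHomotopyEquivalent (X Y : DirectedFlow.{u}) : Prop :=
  ∃ (f : X ⟶ Y) (g : Y ⟶ X), LeftHomotopic (g ≫ f) (𝟙 Y) ∧ LeftHomotopic (f ≫ g) (𝟙 X)

/-- The underlying space of a flow. -/
abbrev Space (X : DirectedFlow.{u}) : Type u := X.states ⊕ X.paths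

/-- The underlying map of a morphism of flows. -/
def toMap {X Y : DirectedFlow.{u}} (f : X ⟶ Y) : X.Space → Y.Space := Sum.map f.onStates f.onPaths

/-- `f` and `g` are S-homotopic: there is a continuous `H : [0,1] × X → Y` such that every
`H(u, -)` is a morphism of flows, `H(0, -) = f` and `H(1, -) = g`. As `[0,1]` is compact
Hausdorff, the product topology is already compactly generated. -/
def SHomotopic {X Y : DirectedFlow.{u}} (f g : X ⟶ Y) : Prop :=
  ∃ H : C(unitInterval × X.Space, Y.Space),
    (∀ t : unitInterval, ∃ h : X ⟶ Y, ∀ x, H (t, x) = toMap h x) ∧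
      (∀ x, H (0, x) = toMap f x) ∧ ∀ x, H (1, x) = toMap g x

/-- S-homotopy equivalent flows. -/
def SHomotopyEquivalent (X Y : DirectedFlow.{u}) : Prop :=
  ∃ (f : X ⟶ Y) (g : Y ⟶ X), SHomotopic (g ≫ f) (𝟙 Y) ∧ SHomotopic (f ≫ g) (𝟙 X)

end DirectedFlow

/-! ### Lifting properties of continuous maps -/

/-! Everything is reduced to one concrete notion (`IsTrivialFibration`): a morphism that is
bijective on states and whose map of path spaces solves every sphere-disk lifting problem. A
fibration that is a weak equivalence is of this kind
(`isTrivialFibration_of_bijective_of_fibration`). The topological input is the classical fact that a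
Serre fibration which is a weak homotopy equivalence lifts spheres in disks
(`IsWeakHomotopyEquivalence.diskLifts`).

From left homotopy to S-homotopy: the two legs of a very good cylinder on `X` are sections of a
trivial fibration `π`. The paths that stay inside the fibres of `π` form a flow, and taking
endpoints maps it to the fibre square of `π` by another trivial fibration
(`isTrivialFibration_fiberEndpoints`). Since `X` is cofibrant, the pair of legs lifts to this flow,
which says that the legs are S-homotopic; composing with the left homotopy gives an S-homotopy
between the two given morphisms.

From S-homotopy to left homotopy: an S-homotopy into `Y` is a morphism to the path flow of `Y`, and
evaluation at `0` is a trivial fibration (`isTrivialFibration_pathEval`). Given a factorization `X ⨿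
X ⟶ E ⟶ X` of the codiagonal, lift against this evaluation, with the constant homotopy on one end
and the given one on the other. The lift `E ⟶ pathFlow Y`, evaluated at `1`, is a left homotopy.

The factorization is produced by the small object argument. Two copies of `X` are glued along their
states, and then all possible globes are attached, countably many times. The flows needed are
presented by generators and relations: words are identified when they agree in every model, and
carry the initial topology, followed by Kelleyfication. The compactness argument requires each stage
to embed in the next as a closed subspace. This is obtained without computing the glued path space:
the inclusion of `E` in its cone is a closed embedding, it extends over the attached cells because
the cone is trivially fibred over a codiscrete flow, and the first factor of a closed embedding is a
closed embedding (`isClosedEmbedding_of_comp`). -/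

/-- Continuous maps `A ⟶ K` and `E ⟶ B` such that every commutative square from the first to the
second has a continuous diagonal filler. -/
def Lifts {A K E B : Type*} [TopologicalSpace A] [TopologicalSpace K] [TopologicalSpace E]
    [TopologicalSpace B] (i : A → K) (p : E → B) : Prop :=
  ∀ (f : A → E) (g : K → B), Continuous f → Continuous g → (∀ a, p (f a) = g (i a)) →
    ∃ l : K → E, Continuous l ∧ (∀ a, l (i a) = f a) ∧ ∀ k, p (l k) = g k

/-- Lifting properties pass to retracts. This single principle is what moves them between disks,
cylinders, cubes and boxes. -/
theorem Lifts.of_retract {A K A' K' E B : Type*} [TopologicalSpace A] [TopologicalSpace K]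
    [TopologicalSpace A'] [TopologicalSpace K'] [TopologicalSpace E] [TopologicalSpace B]
    {i : A → K} {i' : A' → K'} {p : E → B} (h : Lifts i' p)
    {s₀ : A → A'} {s : K → K'} {r₀ : A' → A} {r : K' → K} (hs : Continuous s)
    (hr₀ : Continuous r₀) (hr : Continuous r)
    (his : ∀ a, i' (s₀ a) = s (i a)) (hir : ∀ a, i (r₀ a) = r (i' a))
    (hrs₀ : ∀ a, r₀ (s₀ a) = a) (hrs : ∀ k, r (s k) = k) : Lifts i p := by
  intro f g hf hg hfg
  obtain ⟨l, hl, hl₁, hl₂⟩ := h (f ∘ r₀) (g ∘ r) (hf.comp hr₀) (hg.comp hr)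
    (fun a => by simp [hfg, hir])
  refine ⟨l ∘ s, hl.comp hs, fun a => ?_, fun k => ?_⟩
  · simp [← his, hl₁, hrs₀]
  · simp [hl₂, hrs]

theorem Lifts.of_subset_retract {K K' E B : Type*} [TopologicalSpace K]
    [TopologicalSpace K'] [TopologicalSpace E] [TopologicalSpace B]
    {A : Set K} {A' : Set K'} {p : E → B} (h : Lifts (Subtype.val : A' → K') p)
    {s : K → K'} {r : K' → K} (hs : Continuous s) (hr : Continuous r)
    (hsA : ∀ a ∈ A, s a ∈ A') (hrA : ∀ a ∈ A', r a ∈ A) (hrs : ∀ k, r (s k) = k) :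
    Lifts (Subtype.val : A → K) p :=
  h.of_retract (s₀ := fun a => ⟨s a, hsA a a.2⟩) (r₀ := fun a => ⟨r a, hrA a a.2⟩) hs
    ((hr.comp continuous_subtype_val).subtype_mk _) hr (fun _ => rfl) (fun _ => rfl)
    (fun a => Subtype.ext (hrs a)) hrs

theorem exists_continuous_glue {X Y : Type*} [TopologicalSpace X] [TopologicalSpace Y]
    {A B : Set X} (hA : IsClosed A) (hB : IsClosed B) (hAB : ∀ x, x ∈ A ∨ x ∈ B)
    {f : A → Y} {g : B → Y} (hf : Continuous f) (hg : Continuous g)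
    (h : ∀ x (ha : x ∈ A) (hb : x ∈ B), f ⟨x, ha⟩ = g ⟨x, hb⟩) :
    ∃ k : X → Y, Continuous k ∧ (∀ a : A, k a = f a) ∧ ∀ b : B, k b = g b := by
  classical
  let k : X → Y := fun x =>
    if ha : x ∈ A then f ⟨x, ha⟩ else g ⟨x, (hAB x).resolve_left ha⟩
  have h₁ : ∀ a : A, k a = f a := fun a => by simp [k]
  have h₂ : ∀ b : B, k b = g b := fun b => by
    by_cases hb : (b : X) ∈ A
    · simp [k, hb, h b hb b.2]
    · simp [k, hb]
  refine ⟨k, ?_, h₁, h₂⟩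
  rw [← continuousOn_univ, ← Set.eq_univ_of_forall hAB]
  refine ContinuousOn.union_of_isClosed ?_ ?_ hA hB
  · rw [continuousOn_iff_continuous_domRestrict]
    exact hf.congr fun a => (h₁ a).symm
  · rw [continuousOn_iff_continuous_domRestrict]
    exact hg.congr fun b => (h₂ b).symm

/-! ### Disks -/

/-- The closed unit ball of a normed space. -/
abbrev Disk (V : Type*) [NormedAddCommGroup V] : Type _ := Metric.closedBall (0 : V) 1

namespace Disk

/-- The boundary of the closed unit ball. -/
def bdry (V : Type*) [NormedAddCommGroup V] : Set (Disk V) := {x | ‖(x : V)‖ = 1}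

/-- The boundary of `[0,1] × D`. -/
def cylBdry (V : Type*) [NormedAddCommGroup V] : Set (unitInterval × Disk V) :=
  {x | x.1 = 0 ∨ x.1 = 1 ∨ x.2 ∈ bdry V}

/-- The subspace `{0} × D ∪ [0,1] × ∂D` of `[0,1] × D`. -/
def box (V : Type*) [NormedAddCommGroup V] : Set (unitInterval × Disk V) :=
  {x | x.1 = 0 ∨ x.2 ∈ bdry V}

variable {V : Type*} [NormedAddCommGroup V]

theorem norm_le (x : Disk V) : ‖(x : V)‖ ≤ 1 := mem_closedBall_zero_iff.1 x.2

theorem isClosed_bdry : IsClosed (bdry V) :=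
  isClosed_eq (continuous_norm.comp continuous_subtype_val) continuous_const

variable [NormedSpace ℝ V]

/-- A linear isomorphism carries the unit ball of `V` to a bounded convex set with interior, which a
homeomorphism of `W` turns into the unit ball. So the norm is immaterial in lifting problems: sup
norms give cylinders and cubes, Hilbert norms give round disks. -/
theorem exists_homeomorph (V W : Type*) [NormedAddCommGroup V] [NormedSpace ℝ V]
    [FiniteDimensional ℝ V] [NormedAddCommGroup W] [NormedSpace ℝ W] [FiniteDimensional ℝ W]
    (h : Module.finrank ℝ V = Module.finrank ℝ W) :
    ∃ e : Disk V ≃ₜ Disk W, ∀ x, e x ∈ bdry W ↔ x ∈ bdry V := by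
  let e := (ContinuousLinearEquiv.ofFinrankEq h : V ≃L[ℝ] W)
  have hopen : IsOpen (e '' Metric.ball (0 : V) 1) :=
    e.toHomeomorph.isOpenMap _ Metric.isOpen_ball
  obtain ⟨k, -, hk₁, hk₂⟩ := exists_homeomorph_image_interior_closure_frontier_eq_unitBall
    (s := e '' Metric.ball (0 : V) 1)
    ((convex_ball (0 : V) 1).linear_image (e : V →ₗ[ℝ] W))
    (by rw [hopen.interior_eq]; exact ⟨0, 0, by simp, by simp⟩)
    (e.toContinuousLinearMap.lipschitz.isBounded_image Metric.isBounded_ball)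
  have h₁ : closure (e '' Metric.ball (0 : V) 1) = e '' Metric.closedBall 0 1 := by
    rw [← closure_ball (0 : V) one_ne_zero]
    exact (e.toHomeomorph.image_closure _).symm
  have h₂ : frontier (e '' Metric.ball (0 : V) 1) = e '' Metric.sphere 0 1 := by
    rw [← frontier_ball (0 : V) one_ne_zero]
    exact (e.toHomeomorph.image_frontier _).symm
  rw [h₁, Set.image_image] at hk₁
  rw [h₂, Set.image_image] at hk₂
  let m : V ≃ₜ W := e.toHomeomorph.trans k
  have hm₁ : ∀ x, x ∈ Metric.closedBall (0 : V) 1 ↔ m x ∈ Metric.closedBall (0 : W) 1 := by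
    intro x
    rw [← hk₁]
    exact (m.injective.mem_set_image (s := Metric.closedBall (0 : V) 1)).symm
  have hm₂ : ∀ x, m x ∈ Metric.sphere (0 : W) 1 ↔ x ∈ Metric.sphere (0 : V) 1 := by
    intro x
    rw [← hk₂]
    exact m.injective.mem_set_image (s := Metric.sphere (0 : V) 1)
  refine ⟨m.subtype hm₁, fun x => ?_⟩
  simpa [bdry] using hm₂ x

/-- `y ↦ y / max ‖y‖ (1/2)`, the radial expansion by `2`, truncated to the disk. -/
noncomputable def expand (y : Disk V) : Disk V :=
  ⟨(max ‖(y : V)‖ (1 / 2))⁻¹ • (y : V), by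
    have h : 0 < max ‖(y : V)‖ (1 / 2) := lt_max_of_lt_right (by norm_num)
    rw [mem_closedBall_zero_iff, norm_smul, norm_inv, Real.norm_of_nonneg h.le,
      inv_mul_le_iff₀ h, mul_one]
    exact le_max_left _ _⟩

theorem continuous_expand : Continuous (expand (V := V)) := by
  refine Continuous.subtype_mk (Continuous.smul (Continuous.inv₀ (by fun_prop) fun y => ?_)
    continuous_subtype_val) _
  exact (lt_max_of_lt_right (by norm_num)).ne'

theorem expand_of_le {y : Disk V} (h : ‖(y : V)‖ ≤ 1 / 2) :
    (expand y : V) = (2 : ℝ) • (y : V) := by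
  simp only [expand]
  rw [max_eq_right h]
  norm_num

theorem expand_of_ge {y : Disk V} (h : 1 / 2 ≤ ‖(y : V)‖) :
    (expand y : V) = ‖(y : V)‖⁻¹ • (y : V) := by
  simp only [expand]
  rw [max_eq_left h]

theorem expand_of_bdry {y : Disk V} (h : y ∈ bdry V) : expand y = y := by
  have h' : ‖(y : V)‖ = 1 := h
  refine Subtype.ext ?_
  rw [expand_of_ge (by rw [h']; norm_num), h', inv_one, one_smul]

theorem norm_expand_of_ge {y : Disk V} (h : 1 / 2 ≤ ‖(y : V)‖) : expand y ∈ bdry V := by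
  have : ‖(y : V)‖ ≠ 0 := by linarith
  change ‖(expand y : V)‖ = 1
  rw [expand_of_ge h, norm_smul, norm_inv, norm_norm, inv_mul_cancel₀ this]

/-- Scalar multiplication of a disk by `[0,1]`. -/
noncomputable def scale (t : unitInterval) (y : Disk V) : Disk V :=
  ⟨(t : ℝ) • (y : V), by
    rw [mem_closedBall_zero_iff, norm_smul, Real.norm_of_nonneg t.2.1]
    exact mul_le_one₀ t.2.2 (norm_nonneg _) (norm_le y)⟩

theorem continuous_scale : Continuous fun x : unitInterval × Disk V => scale x.1 x.2 :=
  Continuous.subtype_mk (by fun_prop) _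

theorem scale_one (y : Disk V) : scale 1 y = y := Subtype.ext (by simp [scale])

theorem scale_zero (y : Disk V) : scale 0 y = ⟨0, by simp⟩ := Subtype.ext (by simp [scale])

end Disk

/-! ### Sphere-disk lifting and Serre lifting -/

section

variable {E B : Type*} [TopologicalSpace E] [TopologicalSpace B]

/-- The right lifting property with respect to the inclusions of spheres in disks. -/
def DiskLifts (p : E → B) : Prop :=
  ∀ n : ℕ, Lifts (Subtype.val : Disk.bdry (EuclideanSpace ℝ (Fin n)) → _) p

/-- The right lifting property with respect to the inclusions of disks in cylinders. -/
def SerreLifts (p : E → B) : Prop :=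
  ∀ n : ℕ, Lifts (fun x : Disk (EuclideanSpace ℝ (Fin n)) => ((0 : unitInterval), x)) p

namespace Disk

/-- The affine map from `[-1,1] × D` to `[0,1] × D`. -/
noncomputable def toCyl {V : Type*} [NormedAddCommGroup V] (x : Disk (ℝ × V)) :
    unitInterval × Disk V :=
  have h := norm_prod_le_iff.1 (norm_le x)
  (⟨(x.1.1 + 1) / 2, by
    have := abs_le.1 h.1
    constructor <;> linarith [this.1, this.2]⟩, ⟨x.1.2, mem_closedBall_zero_iff.2 h.2⟩)

/-- The affine map from `[0,1] × D` to `[-1,1] × D`. -/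
noncomputable def ofCyl {V : Type*} [NormedAddCommGroup V] (x : unitInterval × Disk V) :
    Disk (ℝ × V) :=
  ⟨(2 * x.1 - 1, x.2), mem_closedBall_zero_iff.2 (norm_prod_le_iff.2
    ⟨abs_le.2 ⟨by linarith [x.1.2.1], by linarith [x.1.2.2]⟩, norm_le x.2⟩)⟩

variable {V : Type*} [NormedAddCommGroup V]

theorem continuous_toCyl : Continuous (toCyl (V := V)) :=
  Continuous.prodMk (Continuous.subtype_mk (by fun_prop) _) (Continuous.subtype_mk (by fun_prop) _)

theorem continuous_ofCyl : Continuous (ofCyl (V := V)) :=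
  Continuous.subtype_mk (by fun_prop) _

theorem toCyl_ofCyl (x : unitInterval × Disk V) : toCyl (ofCyl x) = x := by
  refine Prod.ext (Subtype.ext ?_) rfl
  simp only [toCyl, ofCyl]
  ring

/-- The norm of `ℝ × V` is a maximum, so on the boundary either the real coordinate is `±1`, an end
of the cylinder, or the other coordinate lies on the sphere. -/
theorem toCyl_mem {x : Disk (ℝ × V)} (h : x ∈ bdry (ℝ × V)) : toCyl x ∈ cylBdry V := by
  have h₁ : max |x.1.1| ‖x.1.2‖ = 1 := h
  rcases max_choice |x.1.1| ‖x.1.2‖ with h₂ | h₂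
  · rw [h₁] at h₂
    rcases eq_or_eq_neg_of_abs_eq h₂.symm with h₃ | h₃
    · exact Or.inr (Or.inl (Subtype.ext (by simp [toCyl, h₃])))
    · exact Or.inl (Subtype.ext (by simp [toCyl, h₃]))
  · exact Or.inr (Or.inr (h₂.symm.trans h₁))

theorem ofCyl_mem {x : unitInterval × Disk V} (h : x ∈ cylBdry V) : ofCyl x ∈ bdry (ℝ × V) := by
  refine le_antisymm (norm_le _) ?_
  change 1 ≤ max |2 * (x.1 : ℝ) - 1| ‖(x.2 : V)‖
  rcases h with h | h | h
  · refine le_max_of_le_left ?_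
    rw [h]; norm_num
  · refine le_max_of_le_left ?_
    rw [h]; norm_num
  · exact le_max_of_le_right (le_of_eq (Eq.symm h))

end Disk

variable {V : Type*} [NormedAddCommGroup V] {p : E → B}

theorem DiskLifts.disk (hp : DiskLifts p) (V : Type*) [NormedAddCommGroup V] [NormedSpace ℝ V]
    [FiniteDimensional ℝ V] : Lifts (Subtype.val : Disk.bdry V → _) p := by
  obtain ⟨e, he⟩ := Disk.exists_homeomorph V (EuclideanSpace ℝ (Fin (Module.finrank ℝ V)))
    (by simp)
  refine (hp _).of_subset_retract e.continuous e.symm.continuous (fun a ha => (he a).2 ha)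
    (fun a ha => ?_) e.symm_apply_apply
  rw [← he, e.apply_symm_apply]
  exact ha

theorem SerreLifts.disk (hp : SerreLifts p) (V : Type*) [NormedAddCommGroup V] [NormedSpace ℝ V]
    [FiniteDimensional ℝ V] : Lifts (fun x : Disk V => ((0 : unitInterval), x)) p := by
  obtain ⟨e, -⟩ := Disk.exists_homeomorph V (EuclideanSpace ℝ (Fin (Module.finrank ℝ V)))
    (by simp)
  exact (hp _).of_retract (s₀ := e) (s := Prod.map id e) (r₀ := e.symm) (r := Prod.map id e.symm)
    (continuous_id.prodMap e.continuous) e.symm.continuous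
    (continuous_id.prodMap e.symm.continuous) (fun _ => rfl) (fun _ => rfl)
    e.symm_apply_apply (fun k => Prod.ext rfl (e.symm_apply_apply k.2))

theorem DiskLifts.cyl (hp : DiskLifts p) (V : Type*) [NormedAddCommGroup V] [NormedSpace ℝ V]
    [FiniteDimensional ℝ V] : Lifts (Subtype.val : Disk.cylBdry V → _) p :=
  (hp.disk (ℝ × V)).of_subset_retract Disk.continuous_ofCyl Disk.continuous_toCyl
    (fun _ => Disk.ofCyl_mem) (fun _ => Disk.toCyl_mem) Disk.toCyl_ofCyl

theorem SerreLifts.cyl (hp : SerreLifts p) (V : Type*) [NormedAddCommGroup V] [NormedSpace ℝ V]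
    [FiniteDimensional ℝ V] :
    Lifts (fun x : unitInterval × Disk V => ((0 : unitInterval), x)) p :=
  (hp.disk (ℝ × V)).of_retract (s₀ := Disk.ofCyl) (s := Prod.map id Disk.ofCyl)
    (r₀ := Disk.toCyl) (r := Prod.map id Disk.toCyl)
    (continuous_id.prodMap Disk.continuous_ofCyl) Disk.continuous_toCyl
    (continuous_id.prodMap Disk.continuous_toCyl) (fun _ => rfl) (fun _ => rfl)
    Disk.toCyl_ofCyl (fun k => Prod.ext rfl (Disk.toCyl_ofCyl k.2))

/-! ### Bottom-and-sides and top-and-sides of a cylinder -/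

namespace Disk

/-- The distance travelled by a point of `[0,1] × D` retracted to the box. -/
noncomputable def boxHeight (x : unitInterval × Disk V) : unitInterval :=
  ⟨min ((x.1 : ℝ) / 2) (1 - ‖(x.2 : V)‖), le_min (by linarith [x.1.2.1]) (by linarith [norm_le x.2]),
    (min_le_left _ _).trans (by linarith [x.1.2.2])⟩

theorem continuous_boxHeight : Continuous (boxHeight (V := V)) :=
  Continuous.subtype_mk (by fun_prop) _

theorem boxHeight_of_mem {x : unitInterval × Disk V} (h : x ∈ box V) : boxHeight x = 0 := by
  refine Subtype.ext ?_
  simp only [boxHeight]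
  rcases h with h | h
  · rw [h]
    simpa using norm_le x.2
  · have h' : ‖(x.2 : V)‖ = 1 := h
    rw [h']
    have := x.1.2.1
    rw [sub_self, min_eq_right (by linarith)]
    rfl

/-- The part of the travelled distance that exceeds `v`. -/
noncomputable def boxShift (v : unitInterval) (x : unitInterval × Disk V) : ℝ :=
  boxHeight x - min (v : ℝ) (boxHeight x)

theorem boxShift_nonneg (v : unitInterval) (x : unitInterval × Disk V) : 0 ≤ boxShift v x :=
  sub_nonneg.2 (min_le_right _ _)

theorem boxShift_le (v : unitInterval) (x : unitInterval × Disk V) :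
    boxShift v x ≤ boxHeight x :=
  sub_le_self _ (le_min v.2.1 (boxHeight x).2.1)

variable [NormedSpace ℝ V]

/-- The homeomorphism from the disk to `{1} × D ∪ [0,1] × ∂D`. -/
noncomputable def cap (y : Disk V) : unitInterval × Disk V :=
  (Set.projIcc 0 1 zero_le_one (2 - 2 * ‖(y : V)‖), expand y)

/-- The inverse of `Disk.cap`. -/
noncomputable def capInv (x : unitInterval × Disk V) : Disk V :=
  scale ⟨1 - x.1 / 2, by linarith [x.1.2.2], by linarith [x.1.2.1]⟩ x.2

theorem continuous_cap : Continuous (cap (V := V)) :=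
  Continuous.prodMk (continuous_projIcc.comp (by fun_prop)) continuous_expand

theorem continuous_capInv : Continuous (capInv (V := V)) :=
  continuous_scale.comp (Continuous.prodMk (Continuous.subtype_mk (by fun_prop) _) continuous_snd)

theorem cap_of_bdry {y : Disk V} (h : y ∈ bdry V) : cap y = (0, y) := by
  refine Prod.ext ?_ (expand_of_bdry h)
  have h' : ‖(y : V)‖ = 1 := h
  simp only [cap, h']
  norm_num

theorem capInv_zero (y : Disk V) : capInv (0, y) = y :=
  Subtype.ext (by simp [capInv, scale])

/-- `capInv` shrinks the top to the disk of radius `1/2` and puts the side point of height `t` at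
radius `1 - t/2`. On these two zones `expand` doubles, respectively normalizes. -/
theorem cap_capInv {x : unitInterval × Disk V} (h : x.1 = 1 ∨ x.2 ∈ bdry V) :
    cap (capInv x) = x := by
  obtain ⟨t, z⟩ := x
  have ht₀ := t.2.1
  have ht₁ := t.2.2
  have hn : ‖(capInv (t, z) : V)‖ = (1 - (t : ℝ) / 2) * ‖(z : V)‖ := by
    simp only [capInv, scale, norm_smul]
    rw [Real.norm_of_nonneg (by linarith)]
  rcases h with h | h
  · simp only at h
    subst h
    have hz := norm_le z
    have hn' : ‖(capInv (1, z) : V)‖ ≤ 1 / 2 := by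
      rw [hn, Set.Icc.coe_one]
      linarith
    refine Prod.ext ?_ (Subtype.ext ?_)
    · simp only [cap]
      rw [Set.projIcc_of_right_le _ (by linarith)]
      rfl
    · simp only [cap]
      rw [expand_of_le hn']
      simp only [capInv, scale, smul_smul]
      norm_num
  · have h' : ‖(z : V)‖ = 1 := h
    rw [h', mul_one] at hn
    refine Prod.ext ?_ (Subtype.ext ?_)
    · simp only [cap, hn]
      refine Subtype.ext ?_
      rw [Set.projIcc_of_mem _ (by constructor <;> linarith)]
      ring
    · simp only [cap]
      rw [expand_of_ge (by rw [hn]; linarith), hn]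
      simp only [capInv, scale, smul_smul]
      rw [inv_mul_cancel₀ (by linarith), one_smul]

end Disk

/-- The top and the sides of the cylinder form a disk whose boundary is the rim of the bottom, so
the lift can first be extended there. Then it is prescribed on the whole boundary of the cylinder,
which is itself a disk. -/
theorem DiskLifts.serreLifts (hp : DiskLifts p) : SerreLifts p := by
  intro n f g hf hg hfg
  set V := EuclideanSpace ℝ (Fin n)
  obtain ⟨l, hl, hl₁, hl₂⟩ := hp n (fun y => f y) (g ∘ Disk.cap)
    (hf.comp continuous_subtype_val) (hg.comp Disk.continuous_cap)
    (fun a => by simp [hfg, Disk.cap_of_bdry a.2])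
  let P : Set (Disk.cylBdry V) := {x | x.1.1 = 0}
  let Q : Set (Disk.cylBdry V) := {x | x.1.1 = 1 ∨ x.1.2 ∈ Disk.bdry V}
  have hP : IsClosed P := isClosed_eq (by fun_prop) continuous_const
  have hQ : IsClosed Q := (isClosed_eq (by fun_prop) continuous_const).union
    (Disk.isClosed_bdry.preimage (by fun_prop))
  obtain ⟨F, hF, hF₁, hF₂⟩ := exists_continuous_glue hP hQ (fun x => x.2)
    (f := fun x => f x.1.1.2) (g := fun x => l (Disk.capInv x.1.1)) (by fun_prop)
    (hl.comp (Disk.continuous_capInv.comp (by fun_prop)))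
    (fun x hx hx' => by
      obtain ⟨⟨t, y⟩, hty⟩ := x
      obtain rfl : t = 0 := hx
      have hy : y ∈ Disk.bdry V := hx'.resolve_left (by simp)
      simp only [Disk.capInv_zero]
      exact (hl₁ ⟨y, hy⟩).symm)
  obtain ⟨L, hL, hL₁, hL₂⟩ := hp.cyl V F g hF hg (fun x => by
    rcases x.2 with h | h
    · rw [hF₁ ⟨x, h⟩, hfg]
      exact congrArg g (Prod.ext h.symm rfl)
    · rw [hF₂ ⟨x, h⟩, hl₂]
      exact congrArg g (Disk.cap_capInv h))
  refine ⟨L, hL, fun a => ?_, hL₂⟩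
  have h0 : ((0 : unitInterval), a) ∈ Disk.cylBdry V := Or.inl rfl
  exact (hL₁ ⟨_, h0⟩).trans (hF₁ ⟨⟨_, h0⟩, rfl⟩)

namespace Disk

variable [NormedSpace ℝ V]

theorem norm_add_shift (d : ℝ) (hd : 0 ≤ d) (y : Disk V) :
    ‖(y : V) + d • (expand y : V)‖ = ‖(y : V)‖ * (1 + d * (max ‖(y : V)‖ (1 / 2))⁻¹) := by
  have h : (y : V) + d • (expand y : V) = (1 + d * (max ‖(y : V)‖ (1 / 2))⁻¹) • (y : V) := by
    simp only [expand, add_smul, one_smul, mul_smul]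
  have : 0 ≤ (max ‖(y : V)‖ (1 / 2))⁻¹ := inv_nonneg.2 (le_max_of_le_left (norm_nonneg _))
  rw [h, norm_smul, Real.norm_of_nonneg (by positivity), mul_comm]

/-- The flow of `[0,1] × D` to the box, stopped at distance `v`. -/
noncomputable def boxFlow (v : unitInterval) (x : unitInterval × Disk V) : unitInterval × Disk V :=
  (⟨x.1 - 2 * boxShift v x, by
      have h₁ := boxShift_nonneg v x
      have h₂ := boxShift_le v x
      have h₃ : (boxHeight x : ℝ) ≤ x.1 / 2 := min_le_left _ _
      constructor <;> linarith [x.1.2.1, x.1.2.2]⟩,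
    ⟨(x.2 : V) + boxShift v x • (expand x.2 : V), by
      have h₁ := boxShift_nonneg v x
      have h₂ := boxShift_le v x
      have h₃ : (boxHeight x : ℝ) ≤ 1 - ‖(x.2 : V)‖ := min_le_right _ _
      rw [mem_closedBall_zero_iff, norm_add_shift _ h₁]
      rcases le_total ‖(x.2 : V)‖ (1 / 2) with h | h
      · rw [max_eq_right h]
        nlinarith [norm_nonneg (x.2 : V)]
      · rw [max_eq_left h]
        have : ‖(x.2 : V)‖ ≠ 0 := by linarith
        field_simp
        linarith⟩)

theorem continuous_boxFlow :
    Continuous fun a : unitInterval × (unitInterval × Disk V) => boxFlow a.1 a.2 := by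
  have h : Continuous fun a : unitInterval × (unitInterval × Disk V) => boxShift a.1 a.2 := by
    have := continuous_boxHeight (V := V)
    unfold boxShift
    fun_prop
  have h' := continuous_expand (V := V)
  exact Continuous.prodMk (Continuous.subtype_mk (by fun_prop) _)
    (Continuous.subtype_mk ((continuous_subtype_val.comp (by fun_prop)).add
      (h.smul (continuous_subtype_val.comp (h'.comp (by fun_prop))))) _)

theorem boxFlow_height (x : unitInterval × Disk V) : boxFlow (boxHeight x) x = x := by
  have h : boxShift (boxHeight x) x = 0 := by simp [boxShift]
  refine Prod.ext (Subtype.ext ?_) (Subtype.ext ?_) <;> simp [boxFlow, h]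

theorem boxFlow_zero_mem (x : unitInterval × Disk V) : boxFlow 0 x ∈ box V := by
  have hs : boxShift 0 x = boxHeight x := by
    simp only [boxShift]
    rw [Set.Icc.coe_zero, min_eq_left (boxHeight x).2.1, sub_zero]
  rcases le_total ((x.1 : ℝ) / 2) (1 - ‖(x.2 : V)‖) with h | h
  · left
    refine Subtype.ext ?_
    simp only [boxFlow, hs]
    simp only [boxHeight, min_eq_left h, Set.Icc.coe_zero]
    ring
  · right
    change ‖(x.2 : V) + boxShift 0 x • (expand x.2 : V)‖ = 1
    rw [norm_add_shift _ (boxShift_nonneg _ _), hs]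
    simp only [boxHeight, min_eq_right h]
    -- Leaving through the side means `1 - ‖y‖ ≤ t/2 ≤ 1/2`, so the point lies where `expand` is a
    -- unit vector and the radius grows at unit speed. The vertical speed `2` is chosen for this.
    have h₁ : 1 / 2 ≤ ‖(x.2 : V)‖ := by linarith [x.1.2.2]
    rw [max_eq_left h₁]
    have : ‖(x.2 : V)‖ ≠ 0 := by linarith
    field_simp
    ring

theorem boxFlow_zero_of_mem {x : unitInterval × Disk V} (h : x ∈ box V) : boxFlow 0 x = x := by
  rw [← boxHeight_of_mem h, boxFlow_height]

end Disk

/-- The box is a retract of the bottom of a cylinder on the whole of `[0,1] × D`. The section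
records the distance to the box as an extra coordinate `v`; the retraction flows towards the box
until the remaining distance is at most `v`. -/
theorem SerreLifts.box (hp : SerreLifts p) (V : Type*) [NormedAddCommGroup V] [NormedSpace ℝ V]
    [FiniteDimensional ℝ V] : Lifts (Subtype.val : Disk.box V → _) p :=
  (hp.cyl V).of_retract (s₀ := fun a => a.1) (s := fun k => (Disk.boxHeight k, k))
    (r₀ := fun k => ⟨Disk.boxFlow 0 k, Disk.boxFlow_zero_mem k⟩)
    (r := fun a => Disk.boxFlow a.1 a.2)
    (Disk.continuous_boxHeight.prodMk continuous_id)
    ((Disk.continuous_boxFlow.comp (Continuous.prodMk continuous_const continuous_id)).subtype_mk _)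
    Disk.continuous_boxFlow (fun a => by simp [Disk.boxHeight_of_mem a.2]) (fun _ => rfl)
    (fun a => Subtype.ext (Disk.boxFlow_zero_of_mem a.2)) Disk.boxFlow_height

end

/-! ### Trivial Serre fibrations -/

namespace Disk

section Cube

variable {N : Type*} [Fintype N]

/-- The affine map from `[-1,1]^N` to `[0,1]^N`. -/
noncomputable def toCube (x : Disk (N → ℝ)) : N → unitInterval := fun i =>
  ⟨(x.1 i + 1) / 2, by
    have := abs_le.1 ((norm_le_pi_norm x.1 i).trans (norm_le x))
    constructor <;> linarith [this.1, this.2]⟩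

/-- The affine map from `[0,1]^N` to `[-1,1]^N`. -/
noncomputable def ofCube (y : N → unitInterval) : Disk (N → ℝ) :=
  ⟨fun i => 2 * y i - 1, mem_closedBall_zero_iff.2 ((pi_norm_le_iff_of_nonneg zero_le_one).2
    fun i => abs_le.2 ⟨by linarith [(y i).2.1], by linarith [(y i).2.2]⟩)⟩

/-- The cube is homeomorphic to a disk. -/
noncomputable def cubeHomeomorph (N : Type*) [Fintype N] :
    Disk (N → ℝ) ≃ₜ (N → unitInterval) where
  toFun := toCube
  invFun := ofCube
  left_inv x := Subtype.ext (funext fun i => by simp only [toCube, ofCube]; ring)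
  right_inv y := funext fun i => Subtype.ext (by simp only [toCube, ofCube]; ring)
  continuous_toFun := continuous_pi fun i => Continuous.subtype_mk
    ((((continuous_apply i).comp continuous_subtype_val).add continuous_const).div_const 2) _
  continuous_invFun := Continuous.subtype_mk (by fun_prop) _

theorem toCube_mem_boundary (x : Disk (N → ℝ)) :
    cubeHomeomorph N x ∈ Cube.boundary N ↔ x ∈ bdry (N → ℝ) := by
  constructor
  · rintro ⟨i, hi⟩
    refine le_antisymm (norm_le x) (le_trans ?_ (norm_le_pi_norm x.1 i))
    rw [Real.norm_eq_abs]
    rcases hi with hi | hi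
    · have h : (x.1 i + 1) / 2 = 0 := congrArg Subtype.val hi
      have : x.1 i = -1 := by linarith
      simp [this]
    · have h : (x.1 i + 1) / 2 = 1 := congrArg Subtype.val hi
      have : x.1 i = 1 := by linarith
      simp [this]
  · intro hx
    by_contra hc
    have h : ‖x.1‖ < 1 := by
      refine (pi_norm_lt_iff zero_lt_one).2 fun i => ?_
      refine lt_of_le_of_ne ((norm_le_pi_norm x.1 i).trans (norm_le x)) fun hi => hc ⟨i, ?_⟩
      rcases eq_or_eq_neg_of_abs_eq hi with h | h
      · exact Or.inr (Subtype.ext (show (x.1 i + 1) / 2 = (1 : ℝ) by rw [h]; norm_num))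
      · exact Or.inl (Subtype.ext (show (x.1 i + 1) / 2 = (0 : ℝ) by rw [h]; norm_num))
    exact h.ne hx

theorem exists_homeomorph_cube (V : Type*) [NormedAddCommGroup V] [NormedSpace ℝ V]
    [FiniteDimensional ℝ V] (m : ℕ) (h : Module.finrank ℝ V = m) :
    ∃ e : Disk V ≃ₜ (Fin m → unitInterval), ∀ x, e x ∈ Cube.boundary (Fin m) ↔ x ∈ bdry V := by
  obtain ⟨e, he⟩ := exists_homeomorph V (Fin m → ℝ) (by simp [h])
  exact ⟨e.trans (cubeHomeomorph (Fin m)), fun x => (toCube_mem_boundary _).trans (he x)⟩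

end Cube

end Disk

/-! ### Lifting cubes and homotopies of cubes -/

section

variable {E B : Type*} [TopologicalSpace E] [TopologicalSpace B] {p : E → B}

theorem DiskLifts.cube (hp : DiskLifts p) (N : Type*) [Fintype N] :
    Lifts (Subtype.val : Cube.boundary N → _) p :=
  (hp.disk (N → ℝ)).of_subset_retract (Disk.cubeHomeomorph N).symm.continuous
    (Disk.cubeHomeomorph N).continuous
    (fun a ha => by
      rw [← Disk.toCube_mem_boundary, Homeomorph.apply_symm_apply]
      exact ha)
    (fun a ha => (Disk.toCube_mem_boundary a).2 ha) (Homeomorph.apply_symm_apply _)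

theorem Cube.isClosed_boundary (N : Type*) [Finite N] : IsClosed (Cube.boundary N) := by
  have : Cube.boundary N = ⋃ i, {y : N → unitInterval | y i = 0 ∨ y i = 1} := by
    ext y; simp [Cube.boundary]
  rw [this]
  exact isClosed_iUnion_of_finite fun i => (isClosed_eq (by fun_prop) continuous_const).union
    (isClosed_eq (by fun_prop) continuous_const)

/-- With both ends and the sides prescribed upstairs, this is a sphere-disk problem one dimension
higher. It supplies injectivity on path components and homotopy groups. -/
theorem DiskLifts.homotopy (hp : DiskLifts p) {N : Type*} [Fintype N]
    {a b : (N → unitInterval) → E} (ha : Continuous a) (hb : Continuous b)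
    {H : unitInterval × (N → unitInterval) → B} (hH : Continuous H)
    (h₀ : ∀ y, H (0, y) = p (a y)) (h₁ : ∀ y, H (1, y) = p (b y))
    (hab : ∀ y ∈ Cube.boundary N, a y = b y) (h : ∀ t, ∀ y ∈ Cube.boundary N, H (t, y) = p (a y)) :
    ∃ L : unitInterval × (N → unitInterval) → E, Continuous L ∧ (∀ y, L (0, y) = a y) ∧
      (∀ y, L (1, y) = b y) ∧ ∀ t, ∀ y ∈ Cube.boundary N, L (t, y) = a y := by
  let T : Set (unitInterval × (N → unitInterval)) :=
    {x | x.1 = 0 ∨ x.1 = 1 ∨ x.2 ∈ Cube.boundary N}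
  let P : Set T := {x | x.1.1 = 0 ∨ x.1.2 ∈ Cube.boundary N}
  let Q : Set T := {x | x.1.1 = 1}
  have key : Lifts (Subtype.val : T → _) p :=
    (hp.cyl (N → ℝ)).of_subset_retract
      (s := Prod.map id (Disk.cubeHomeomorph N).symm) (r := Prod.map id (Disk.cubeHomeomorph N))
      (continuous_id.prodMap (Disk.cubeHomeomorph N).symm.continuous)
      (continuous_id.prodMap (Disk.cubeHomeomorph N).continuous)
      (fun x hx => hx.imp_right fun hx => hx.imp_right fun hx => by
        rw [Prod.map_snd, ← Disk.toCube_mem_boundary, Homeomorph.apply_symm_apply]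
        exact hx)
      (fun x hx => hx.imp_right fun hx => hx.imp_right fun hx =>
        (Disk.toCube_mem_boundary _).2 hx)
      (fun x => Prod.ext rfl (Homeomorph.apply_symm_apply _ _))
  have hP : IsClosed P := (isClosed_eq (by fun_prop) continuous_const).union
    ((Cube.isClosed_boundary N).preimage (by fun_prop))
  have hQ : IsClosed Q := isClosed_eq (by fun_prop) continuous_const
  obtain ⟨F, hF, hF₁, hF₂⟩ := exists_continuous_glue hP hQ
    (fun x => by
      rcases x.2 with h | h | h
      · exact Or.inl (Or.inl h)
      · exact Or.inr h
      · exact Or.inl (Or.inr h))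
    (f := fun x => a x.1.1.2) (g := fun x => b x.1.1.2) (by fun_prop) (by fun_prop)
    (fun x hx hx' => hab _ (hx.resolve_left fun h => by
      have : x.1.1 = 1 := hx'
      rw [h] at this
      exact zero_ne_one this))
  obtain ⟨L, hL, hL₁, -⟩ := key F H hF hH (fun x => by
    rcases x.2 with h' | h' | h'
    · rw [hF₁ ⟨x, Or.inl h'⟩, ← h₀]
      exact congrArg H (Prod.ext h'.symm rfl)
    · rw [hF₂ ⟨x, h'⟩, ← h₁]
      exact congrArg H (Prod.ext h'.symm rfl)
    · rw [hF₁ ⟨x, Or.inr h'⟩, ← h _ _ h'])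
  have hL₂ : ∀ x (hx : x ∈ T), (x.1 = 0 ∨ x.2 ∈ Cube.boundary N) → L x = a x.2 := fun x hx h' =>
    (hL₁ ⟨x, hx⟩).trans (hF₁ ⟨⟨x, hx⟩, h'⟩)
  refine ⟨L, hL, fun y => hL₂ _ (Or.inl rfl) (Or.inl rfl), fun y => ?_, fun t y hy =>
    hL₂ _ (Or.inr (Or.inr hy)) (Or.inr hy)⟩
  exact (hL₁ ⟨(1, y), Or.inr (Or.inl rfl)⟩).trans (hF₂ ⟨⟨(1, y), Or.inr (Or.inl rfl)⟩, rfl⟩)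

end

theorem Cube.notMem_boundary {N : Type*} [IsEmpty N] (y : N → unitInterval) :
    y ∉ Cube.boundary N := fun ⟨i, _⟩ => isEmptyElim i

/-- Surjectivity is the lifting of a cube relative to its boundary, injectivity the lifting of a
homotopy relative to its ends and sides. The `0`-cube has empty boundary and accounts for path
components. -/
theorem DiskLifts.isWeakHomotopyEquivalence {E B : Type u} [TopologicalSpace E]
    [TopologicalSpace B] {p : C(E, B)} (hp : DiskLifts p) :
    DirectedFlow.IsWeakHomotopyEquivalence p := by
  refine ⟨⟨?_, ?_⟩, fun n _ a => ⟨?_, ?_⟩⟩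
  · rintro ⟨x⟩ ⟨y⟩ h
    obtain ⟨γ⟩ : Joined (p x) (p y) := Quotient.exact h
    obtain ⟨L, hL, hL₀, hL₁, -⟩ := hp.homotopy (N := Fin 0) (a := fun _ => x) (b := fun _ => y)
      continuous_const continuous_const (H := fun z => γ z.1) (by fun_prop) (by simp) (by simp)
      (fun y hy => absurd hy (Cube.notMem_boundary y))
      (fun _ y hy => absurd hy (Cube.notMem_boundary y))
    refine Quotient.sound ⟨⟨⟨fun t => L (t, isEmptyElim), by fun_prop⟩, hL₀ _, hL₁ _⟩⟩
  · rintro ⟨b⟩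
    obtain ⟨l, -, -, h⟩ := hp.cube (Fin 0) (fun y => absurd y.2 (Cube.notMem_boundary _))
      (fun _ => b) (continuous_of_const fun y => absurd y.2 (Cube.notMem_boundary _))
      continuous_const (fun y => absurd y.2 (Cube.notMem_boundary _))
    exact ⟨Quotient.mk _ (l isEmptyElim), congrArg (Quotient.mk _) (h isEmptyElim)⟩
  · rintro ⟨x⟩ ⟨y⟩ h
    obtain ⟨H⟩ := Quotient.exact h
    obtain ⟨L, hL, hL₀, hL₁, hL₂⟩ := hp.homotopy (a := x.1) (b := y.1) (map_continuous _)
      (map_continuous _) (H := H) (map_continuous _) (fun z => H.apply_zero z)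
      (fun z => H.apply_one z) (fun z hz => (x.2 z hz).trans (y.2 z hz).symm)
      (fun t z hz => H.eq_fst t hz)
    exact Quotient.sound ⟨⟨⟨⟨L, hL⟩, hL₀, hL₁⟩, fun t z hz => hL₂ t z hz⟩⟩
  · rintro ⟨y⟩
    obtain ⟨l, hl, hl₁, hl₂⟩ := hp.cube (Fin n) (fun _ => a) y.1 continuous_const
      (map_continuous _) (fun z => (y.2 z z.2).symm)
    exact ⟨Quotient.mk _ ⟨⟨l, hl⟩, fun z hz => hl₁ ⟨z, hz⟩⟩,
      congrArg (Quotient.mk _) (Subtype.ext (ContinuousMap.ext hl₂))⟩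

/-! ### Deforming lifting problems along a Serre fibration -/

section

variable {E B : Type*} [TopologicalSpace E] [TopologicalSpace B] {p : E → B}

/-- A lifting problem for a sphere in a disk is solvable if it is homotopic to a solvable one. -/
theorem SerreLifts.lift_of_homotopy (hp : SerreLifts p) {V : Type*} [NormedAddCommGroup V]
    [NormedSpace ℝ V] [FiniteDimensional ℝ V] {F : unitInterval × Disk.bdry V → E}
    {G : unitInterval × Disk V → B} (hF : Continuous F) (hG : Continuous G)
    (hFG : ∀ t y, p (F (t, y)) = G (t, y)) {l : Disk V → E} (hl : Continuous l)
    (hlF : ∀ y : Disk.bdry V, l y = F (0, y)) (hlG : ∀ y, p (l y) = G (0, y)) :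
    ∃ l' : Disk V → E, Continuous l' ∧ (∀ y : Disk.bdry V, l' y = F (1, y)) ∧
      ∀ y, p (l' y) = G (1, y) := by
  let P : Set (Disk.box V) := {x | x.1.1 = 0}
  let Q : Set (Disk.box V) := {x | x.1.2 ∈ Disk.bdry V}
  have hP : IsClosed P := isClosed_eq (by fun_prop) continuous_const
  have hQ : IsClosed Q := Disk.isClosed_bdry.preimage (by fun_prop)
  -- The lift at time `0` and the moving sphere data fit together on the box; lifting from the box
  -- then carries the solution to time `1`.
  obtain ⟨f, hf, hf₁, hf₂⟩ := exists_continuous_glue hP hQ (fun x => x.2)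
    (f := fun x => l x.1.1.2) (g := fun x => F (x.1.1.1, ⟨x.1.1.2, x.2⟩)) (by fun_prop)
    (hF.comp (Continuous.prodMk (by fun_prop) (Continuous.subtype_mk (by fun_prop) _)))
    (fun x hx hx' => by
      obtain ⟨⟨t, y⟩, hty⟩ := x
      obtain rfl : t = 0 := hx
      exact hlF ⟨y, hx'⟩)
  obtain ⟨L, hL, hL₁, hL₂⟩ := hp.box V f G hf hG (fun x => by
    rcases x.2 with h | h
    · rw [hf₁ ⟨x, h⟩, hlG]
      exact congrArg G (Prod.ext h.symm rfl)
    · rw [hf₂ ⟨x, h⟩, hFG])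
  exact ⟨fun y => L (1, y), by fun_prop,
    fun y => (hL₁ ⟨(1, y), Or.inr y.2⟩).trans (hf₂ ⟨⟨(1, y), Or.inr y.2⟩, y.2⟩), fun y => hL₂ _⟩

/-- If the sphere data of a lifting problem extends over the disk, the problem can be deformed to
one with constant sphere data. -/
theorem SerreLifts.lift_of_extension (hp : SerreLifts p) (hpc : Continuous p) {V : Type*}
    [NormedAddCommGroup V] [NormedSpace ℝ V] [FiniteDimensional ℝ V]
    {e : Disk V → E} (he : Continuous e) {g : Disk V → B} (hg : Continuous g)
    (heg : ∀ y ∈ Disk.bdry V, p (e y) = g y)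
    (h : ∀ (e₀ : E) (β : Disk V → B), Continuous β → (∀ y ∈ Disk.bdry V, β y = p e₀) →
      ∃ l : Disk V → E, Continuous l ∧ (∀ y ∈ Disk.bdry V, l y = e₀) ∧ ∀ y, p (l y) = β y) :
    ∃ l : Disk V → E, Continuous l ∧ (∀ y ∈ Disk.bdry V, l y = e y) ∧ ∀ y, p (l y) = g y := by
  -- At time `t` the deformed problem runs `g` on the disk of radius `1 / (2 - t)`, while the collar
  -- outside follows `p ∘ e` along rays, inward from radius `1` to radius `t`. At time `1` only `g`
  -- is left; at time `0` the boundary sits at `p (e 0)`.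
  let P : Set (unitInterval × Disk V) := {x | (2 - x.1 : ℝ) * ‖(x.2 : V)‖ ≤ 1}
  let Q : Set (unitInterval × Disk V) := {x | 1 ≤ (2 - x.1 : ℝ) * ‖(x.2 : V)‖}
  have hP : IsClosed P := isClosed_le (by fun_prop) continuous_const
  have hQ : IsClosed Q := isClosed_le continuous_const (by fun_prop)
  have hκ : ∀ t : unitInterval, (0 : ℝ) ≤ 2 - t := fun t => by linarith [t.2.2]
  let u : P → Disk V := fun x => ⟨(2 - x.1.1 : ℝ) • (x.1.2 : V), by
    rw [mem_closedBall_zero_iff, norm_smul, Real.norm_of_nonneg (hκ _)]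
    exact x.2⟩
  have hu : Continuous u := Continuous.subtype_mk (by fun_prop) _
  let v : Q → unitInterval := fun x => ⟨2 - (2 - x.1.1 : ℝ) * ‖(x.1.2 : V)‖, by
    have h₁ : 1 ≤ (2 - x.1.1 : ℝ) * ‖(x.1.2 : V)‖ := x.2
    have h₂ := Disk.norm_le x.1.2
    have h₃ := x.1.1.2.1
    have h₄ := x.1.1.2.2
    constructor
    · nlinarith [norm_nonneg (x.1.2 : V)]
    · linarith⟩
  have hv : Continuous v := Continuous.subtype_mk (by fun_prop) _
  obtain ⟨G, hG, hG₁, hG₂⟩ := exists_continuous_glue hP hQ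
    (fun x => le_total ((2 - x.1 : ℝ) * ‖(x.2 : V)‖) 1)
    (f := g ∘ u) (g := fun x => p (e (Disk.scale (v x) (Disk.expand x.1.2)))) (hg.comp hu)
    (hpc.comp (he.comp (Disk.continuous_scale.comp
      (hv.prodMk (Disk.continuous_expand.comp (by fun_prop))))))
    (fun x hx hx' => by
      have hx₁ : (2 - x.1 : ℝ) * ‖(x.2 : V)‖ = 1 := le_antisymm hx hx'
      have hx₂ : 1 / 2 ≤ ‖(x.2 : V)‖ := by nlinarith [x.1.2.1, norm_nonneg (x.2 : V)]
      have hv₁ : v ⟨x, hx'⟩ = 1 := Subtype.ext (by simp only [v, hx₁]; norm_num)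
      have hu₁ : u ⟨x, hx⟩ = Disk.expand x.2 := by
        refine Subtype.ext ?_
        rw [Disk.expand_of_ge hx₂]
        simp only [u]
        rw [eq_inv_of_mul_eq_one_left hx₁]
      rw [hv₁, Disk.scale_one, Function.comp_apply, hu₁]
      exact (heg _ (Disk.norm_expand_of_ge hx₂)).symm)
  have hbQ : ∀ t, ∀ y ∈ Disk.bdry V, (t, y) ∈ Q := fun t y hy => by
    have : ‖(y : V)‖ = 1 := hy
    simp only [Q, Set.mem_ofPred_eq, this]
    linarith [t.2.2]
  have hGb : ∀ t, ∀ y ∈ Disk.bdry V, G (t, y) = p (e (Disk.scale t y)) := fun t y hy => by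
    rw [hG₂ ⟨(t, y), hbQ t y hy⟩]
    simp only
    rw [Disk.expand_of_bdry hy]
    congr 3
    refine Subtype.ext ?_
    have : ‖(y : V)‖ = 1 := hy
    simp only [v, this]
    ring
  have hG1 : ∀ y, G (1, y) = g y := fun y => by
    have h1 : ((1 : unitInterval), y) ∈ P := by
      have := Disk.norm_le y
      simp only [P, Set.mem_ofPred_eq, Set.Icc.coe_one]
      linarith
    rw [hG₁ ⟨_, h1⟩]
    refine congrArg g (Subtype.ext ?_)
    simp only [u, Set.Icc.coe_one]
    norm_num
  obtain ⟨l, hl, hl₁, hl₂⟩ := h (e ⟨0, by simp⟩) (fun y => G (0, y)) (by fun_prop)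
    (fun y hy => by rw [hGb 0 y hy, Disk.scale_zero])
  obtain ⟨l', hl', hl₁', hl₂'⟩ := hp.lift_of_homotopy
    (F := fun x => e (Disk.scale x.1 x.2)) (G := G)
    (he.comp (Disk.continuous_scale.comp
      (continuous_fst.prodMk (continuous_subtype_val.comp continuous_snd)))) hG
    (fun t y => (hGb t y y.2).symm) hl
    (fun y => by rw [hl₁ y y.2, Disk.scale_zero]) hl₂
  refine ⟨l', hl', fun y hy => ?_, fun y => (hl₂' y).trans (hG1 y)⟩
  have := hl₁' ⟨y, hy⟩
  simpa only [Disk.scale_one] using this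

end

/-! ### Weak homotopy equivalences in terms of cubes -/

namespace DirectedFlow.IsWeakHomotopyEquivalence

variable {E B : Type u} [TopologicalSpace E] [TopologicalSpace B] {p : C(E, B)}

/-- This is injectivity on the `m`-th homotopy group at `e`. For `m = 0` the boundary is empty and
injectivity on path components takes its place. -/
theorem exists_nullhomotopy (hp : IsWeakHomotopyEquivalence p) {m : ℕ}
    {α : (Fin m → unitInterval) → E} (hα : Continuous α) {e : E}
    (hαe : ∀ y ∈ Cube.boundary (Fin m), α y = e) {H : unitInterval × (Fin m → unitInterval) → B}
    (hH : Continuous H) (h₀ : ∀ y, H (0, y) = p (α y)) (h₁ : ∀ y, H (1, y) = p e)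
    (hb : ∀ t, ∀ y ∈ Cube.boundary (Fin m), H (t, y) = p e) :
    ∃ A : unitInterval × (Fin m → unitInterval) → E, Continuous A ∧ (∀ y, A (0, y) = α y) ∧
      (∀ y, A (1, y) = e) ∧ ∀ t, ∀ y ∈ Cube.boundary (Fin m), A (t, y) = e := by
  rcases Nat.eq_zero_or_pos m with rfl | hm
  · have hj : Joined (p (α isEmptyElim)) (p e) :=
      ⟨⟨⟨fun t => H (t, isEmptyElim), by fun_prop⟩, h₀ _, h₁ _⟩⟩
    obtain ⟨γ⟩ : Joined (α isEmptyElim) e := Quotient.exact (hp.1.1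
      (a₁ := Quotient.mk _ (α isEmptyElim)) (a₂ := Quotient.mk _ e) (Quotient.sound hj))
    refine ⟨fun x => γ x.1, by fun_prop, fun y => ?_, fun y => by simp, fun t y hy =>
      absurd hy (Cube.notMem_boundary y)⟩
    simp [Subsingleton.elim y isEmptyElim]
  · let a : GenLoop (Fin m) E e := ⟨⟨α, hα⟩, hαe⟩
    let b : GenLoop (Fin m) E e := ⟨⟨fun _ => e, continuous_const⟩, fun _ _ => rfl⟩
    obtain ⟨K⟩ := Quotient.exact ((hp.2 m hm e).1
      (a₁ := Quotient.mk (GenLoop.Homotopic.setoid (Fin m) e) a)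
      (a₂ := Quotient.mk (GenLoop.Homotopic.setoid (Fin m) e) b)
      (Quotient.sound (s := GenLoop.Homotopic.setoid (Fin m) (p e))
        ⟨⟨⟨⟨H, hH⟩, h₀, h₁⟩, fun t y hy => (hb t y hy).trans (congrArg p (hαe y hy).symm)⟩⟩))
    exact ⟨K, map_continuous _, fun y => K.apply_zero y, fun y => K.apply_one y,
      fun t y hy => (K.eq_fst t hy).trans (hαe y hy)⟩

theorem exists_lift_up_to_homotopy (hp : IsWeakHomotopyEquivalence p) {m : ℕ} (hm : 1 ≤ m)
    {β : (Fin m → unitInterval) → B} (hβ : Continuous β) {e : E}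
    (hβe : ∀ y ∈ Cube.boundary (Fin m), β y = p e) :
    ∃ (α : (Fin m → unitInterval) → E) (H : unitInterval × (Fin m → unitInterval) → B),
      Continuous α ∧ Continuous H ∧ (∀ y ∈ Cube.boundary (Fin m), α y = e) ∧
      (∀ y, H (0, y) = p (α y)) ∧ (∀ y, H (1, y) = β y) ∧
      ∀ t, ∀ y ∈ Cube.boundary (Fin m), H (t, y) = p e := by
  let b : GenLoop (Fin m) B (p e) := ⟨⟨β, hβ⟩, hβe⟩
  obtain ⟨⟨a⟩, ha⟩ := (hp.2 m hm e).2 (Quotient.mk (GenLoop.Homotopic.setoid (Fin m) (p e)) b)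
  obtain ⟨K⟩ := Quotient.exact ha
  exact ⟨a.1, K, map_continuous _, map_continuous _, a.2, fun y => K.apply_zero y,
    fun y => K.apply_one y, fun t y hy => (K.eq_fst t hy).trans (congrArg p (a.2 y hy))⟩

end DirectedFlow.IsWeakHomotopyEquivalence

/-! ### The pinch map from a cylinder to a round disk -/

namespace Disk

section Pinch

variable {W : Type*} [NormedAddCommGroup W]

theorem norm_sq_le (y : Disk W) : ‖(y : W)‖ ^ 2 ≤ 1 := by
  have := norm_le y
  nlinarith [norm_nonneg (y : W)]

variable [NormedSpace ℝ W]

/-- The join of the north pole `(1, 0)` and the point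
`(2 ‖y‖ ^ 2 - 1, 2 √(1 - ‖y‖ ^ 2) y)` of the sphere. -/
noncomputable def pinchFun (x : unitInterval × Disk W) : WithLp 2 (ℝ × W) :=
  WithLp.toLp 2 (1 - 2 * (1 - x.1) * (1 - ‖(x.2 : W)‖ ^ 2),
    (2 * (1 - x.1) * √(1 - ‖(x.2 : W)‖ ^ 2) : ℝ) • (x.2 : W))

/-- The formula shows which points land on the sphere: those with `t = 0`, `t = 1` or `‖y‖ = 1`. -/
theorem norm_pinchFun (x : unitInterval × Disk W) :
    ‖pinchFun x‖ ^ 2 = 1 - 4 * (1 - x.1) * x.1 * (1 - ‖(x.2 : W)‖ ^ 2) := by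
  have h : √(1 - ‖(x.2 : W)‖ ^ 2) ^ 2 = 1 - ‖(x.2 : W)‖ ^ 2 :=
    Real.sq_sqrt (sub_nonneg.2 (norm_sq_le _))
  rw [WithLp.prod_norm_sq_eq_of_L2]
  simp only [pinchFun, WithLp.toLp_fst, WithLp.toLp_snd, norm_smul, Real.norm_eq_abs, mul_pow,
    sq_abs, h]
  ring

/-- The quotient map `[0,1] × D ⟶ D'` that collapses `{1} × D ∪ [0,1] × ∂D`. -/
noncomputable def pinch (x : unitInterval × Disk W) : Disk (WithLp 2 (ℝ × W)) :=
  ⟨pinchFun x, by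
    rw [mem_closedBall_zero_iff, ← sq_le_one_iff₀ (norm_nonneg _), norm_pinchFun]
    have h₁ := norm_sq_le x.2
    have h₂ := x.1.2.1
    have h₃ := x.1.2.2
    have : 0 ≤ (1 - (x.1 : ℝ)) * x.1 * (1 - ‖(x.2 : W)‖ ^ 2) :=
      mul_nonneg (mul_nonneg (by linarith) h₂) (by linarith)
    linarith⟩

theorem continuous_pinch : Continuous (pinch (W := W)) := by
  refine Continuous.subtype_mk ((WithLp.prod_continuous_toLp 2 ℝ W).comp
    (Continuous.prodMk (by fun_prop) (Continuous.smul ?_ (by fun_prop)))) _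
  exact (by fun_prop : Continuous fun x : unitInterval × Disk W => 2 * (1 - (x.1 : ℝ))).mul
    (Real.continuous_sqrt.comp (by fun_prop))

theorem pinch_zero_mem (y : Disk W) : pinch (0, y) ∈ bdry (WithLp 2 (ℝ × W)) := by
  change ‖pinchFun (0, y)‖ = 1
  rw [← sq_eq_sq₀ (norm_nonneg _) zero_le_one, norm_pinchFun]
  simp

theorem pinch_of_mem {x : unitInterval × Disk W} (h : x.1 = 1 ∨ x.2 ∈ bdry W) :
    (pinch x : WithLp 2 (ℝ × W)) = WithLp.toLp 2 (1, 0) := by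
  change pinchFun x = _
  rcases h with h | h
  · simp [pinchFun, h]
  · have h' : ‖(x.2 : W)‖ = 1 := h
    simp [pinchFun, h']

/-- The real coordinate determines `(1 - t) (1 - ‖y‖²)`, and the norm of the other one determines
`(1 - t)² (1 - ‖y‖²) ‖y‖²`. If the former is nonzero, division gives `(1 - t) ‖y‖²`; adding the two
yields `t`, and then `y`. -/
theorem eq_or_mem_of_pinch_eq {x x' : unitInterval × Disk W} (h : pinch x = pinch x') :
    x = x' ∨ (x.1 = 1 ∨ x.2 ∈ bdry W) ∧ (x'.1 = 1 ∨ x'.2 ∈ bdry W) := by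
  obtain ⟨t, y⟩ := x
  obtain ⟨t', y'⟩ := x'
  have h' : pinchFun (t, y) = pinchFun (t', y') := congrArg Subtype.val h
  have h₁ : 1 - 2 * (1 - (t : ℝ)) * (1 - ‖(y : W)‖ ^ 2) =
      1 - 2 * (1 - (t' : ℝ)) * (1 - ‖(y' : W)‖ ^ 2) := congrArg WithLp.fst h'
  have h₂ : (2 * (1 - t) * √(1 - ‖(y : W)‖ ^ 2) : ℝ) • (y : W) =
      (2 * (1 - t') * √(1 - ‖(y' : W)‖ ^ 2) : ℝ) • (y' : W) := congrArg WithLp.snd h'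
  have hb : √(1 - ‖(y : W)‖ ^ 2) ^ 2 = 1 - ‖(y : W)‖ ^ 2 :=
    Real.sq_sqrt (sub_nonneg.2 (norm_sq_le _))
  have hb' : √(1 - ‖(y' : W)‖ ^ 2) ^ 2 = 1 - ‖(y' : W)‖ ^ 2 :=
    Real.sq_sqrt (sub_nonneg.2 (norm_sq_le _))
  have h₃ := congrArg (fun w => ‖w‖ ^ 2) h₂
  simp only [norm_smul, Real.norm_eq_abs, mul_pow, sq_abs, hb, hb'] at h₃
  have hJ : ∀ (t : unitInterval) (y : Disk W), (1 - (t : ℝ)) * (1 - ‖(y : W)‖ ^ 2) = 0 →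
      t = 1 ∨ y ∈ bdry W := fun t y h => by
    rcases mul_eq_zero.1 h with h | h
    · exact Or.inl (Subtype.ext (by simpa using (sub_eq_zero.1 h).symm))
    · right
      change ‖(y : W)‖ = 1
      rw [← sq_eq_sq₀ (norm_nonneg _) zero_le_one]
      linarith
  by_cases hk : (1 - (t : ℝ)) * (1 - ‖(y : W)‖ ^ 2) = 0
  · exact Or.inr ⟨hJ t y hk, hJ t' y' (by linarith)⟩
  · left
    have hk' : (1 - (t : ℝ)) * ‖(y : W)‖ ^ 2 = (1 - (t' : ℝ)) * ‖(y' : W)‖ ^ 2 := by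
      refine mul_left_cancel₀ hk ?_
      have h₄ : (1 - (t : ℝ)) * (1 - ‖(y : W)‖ ^ 2) = (1 - (t' : ℝ)) * (1 - ‖(y' : W)‖ ^ 2) := by
        linarith
      calc _ = (1 - (t : ℝ)) ^ 2 * (1 - ‖(y : W)‖ ^ 2) * ‖(y : W)‖ ^ 2 := by ring
        _ = (1 - (t' : ℝ)) ^ 2 * (1 - ‖(y' : W)‖ ^ 2) * ‖(y' : W)‖ ^ 2 := by linarith
        _ = ((1 - (t' : ℝ)) * (1 - ‖(y' : W)‖ ^ 2)) * ((1 - (t' : ℝ)) * ‖(y' : W)‖ ^ 2) := by ring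
        _ = _ := by rw [← h₄]
    have ht : (t : ℝ) = t' := by linarith
    have ht₀ : 1 - (t : ℝ) ≠ 0 := fun h0 => hk (by rw [h0, zero_mul])
    have hy : ‖(y : W)‖ ^ 2 = ‖(y' : W)‖ ^ 2 := by
      rw [← ht] at hk'
      exact mul_left_cancel₀ ht₀ hk'
    rw [← ht, ← hy] at h₂
    have hs : √(1 - ‖(y : W)‖ ^ 2) ≠ 0 := fun h0 => hk (by rw [← hb, h0]; ring)
    have := smul_right_injective W (mul_ne_zero (mul_ne_zero two_ne_zero ht₀) hs) h₂
    exact Prod.ext (Subtype.ext ht) (Subtype.ext this)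

theorem surjective_pinch : Function.Surjective (pinch (W := W)) := by
  intro v
  obtain ⟨⟨⟨s, w⟩⟩, hv⟩ := v
  have hv' : s ^ 2 + ‖w‖ ^ 2 ≤ 1 := by
    have h := mem_closedBall_zero_iff.1 hv
    rw [← sq_le_one_iff₀ (norm_nonneg _), WithLp.prod_norm_sq_eq_of_L2] at h
    simpa using h
  have hs₁ : s ≤ 1 := by nlinarith [sq_nonneg ‖w‖]
  rcases hs₁.eq_or_lt with rfl | hs
  · refine ⟨(1, ⟨0, by simp⟩), Subtype.ext ?_⟩
    have hw : w = 0 := by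
      rw [← norm_eq_zero, ← sq_eq_zero_iff]
      nlinarith [sq_nonneg ‖w‖]
    subst hw
    rw [pinch_of_mem (Or.inl rfl)]
  · have hs' : 0 < 1 - s := by linarith
    -- Here `c` and `b` stand for `1 - t` and `√(1 - ‖y‖²)`. The equations to solve are `1 - s = 2 c
    -- b²` and `w = 2 c b y`; eliminating `b` from the norm of `w` leaves `2 c (1 - s) = (1 - s)² +
    -- ‖w‖²`.
    obtain ⟨c, hc⟩ : ∃ c, c = ((1 - s) ^ 2 + ‖w‖ ^ 2) / (2 * (1 - s)) := ⟨_, rfl⟩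
    have hc₀ : 0 < c := by rw [hc]; positivity
    have hc₁ : c ≤ 1 := by
      rw [hc, div_le_one (by positivity)]
      nlinarith
    have hcs : 2 * c * (1 - s) = (1 - s) ^ 2 + ‖w‖ ^ 2 := by
      rw [hc]; field_simp
    have hb₀ : 0 < (1 - s) / (2 * c) := by positivity
    obtain ⟨b, hb⟩ : ∃ b, b = √((1 - s) / (2 * c)) := ⟨_, rfl⟩
    have hb_pos : 0 < b := by rw [hb]; exact Real.sqrt_pos.2 hb₀
    have hb_sq : b ^ 2 = (1 - s) / (2 * c) := by rw [hb]; exact Real.sq_sqrt hb₀.le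
    have hy : ‖(2 * c * b)⁻¹ • w‖ ^ 2 = 1 - b ^ 2 := by
      rw [norm_smul, norm_inv, Real.norm_of_nonneg (by positivity), mul_pow, inv_pow, mul_pow,
        hb_sq]
      field_simp
      nlinarith
    refine ⟨(⟨1 - c, by linarith, by linarith⟩, ⟨(2 * c * b)⁻¹ • w, ?_⟩), Subtype.ext ?_⟩
    · rw [mem_closedBall_zero_iff, ← sq_le_one_iff₀ (norm_nonneg _), hy]
      nlinarith
    · simp only [pinch, pinchFun, hy]
      have h1 : 1 - 2 * (1 - (1 - c)) * (1 - (1 - b ^ 2)) = s := by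
        rw [sub_sub_cancel, sub_sub_cancel, hb_sq]
        field_simp
        ring
      have h2 : √(1 - (1 - b ^ 2)) = b := by
        rw [sub_sub_cancel, Real.sqrt_sq hb_pos.le]
      rw [h1, h2, sub_sub_cancel, smul_smul, mul_inv_cancel₀ (by positivity), one_smul]

end Pinch

end Disk

/-! ### Serre fibrations that are weak homotopy equivalences -/

namespace DirectedFlow.IsWeakHomotopyEquivalence

variable {E B : Type u} [TopologicalSpace E] [TopologicalSpace B] {p : C(E, B)}

/-- Composed with the pinch map, `f` becomes a cube with constant boundary and `g` a nullhomotopy of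
its image. Injectivity on homotopy groups gives a nullhomotopy upstairs, constant on what the pinch
map collapses, so it descends to the disk. The filling need not lie over `g`. -/
theorem exists_extension (hp : IsWeakHomotopyEquivalence p) {W : Type*} [NormedAddCommGroup W]
    [NormedSpace ℝ W] [FiniteDimensional ℝ W]
    {f : Disk.bdry (WithLp 2 (ℝ × W)) → E} (hf : Continuous f)
    {g : Disk (WithLp 2 (ℝ × W)) → B} (hg : Continuous g) (hfg : ∀ y, p (f y) = g y) :
    ∃ l : Disk (WithLp 2 (ℝ × W)) → E, Continuous l ∧ ∀ y : Disk.bdry _, l y = f y := by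
  obtain ⟨e, he⟩ := Disk.exists_homeomorph_cube W _ rfl
  let N : Disk (WithLp 2 (ℝ × W)) := Disk.pinch (1, ⟨0, by simp⟩)
  have hpN : ∀ {x : unitInterval × Disk W}, x.1 = 1 ∨ x.2 ∈ Disk.bdry W → Disk.pinch x = N :=
    fun h => Subtype.ext ((Disk.pinch_of_mem h).trans (Disk.pinch_of_mem (Or.inl rfl)).symm)
  have hN : N ∈ Disk.bdry (WithLp 2 (ℝ × W)) := by
    change ‖Disk.pinchFun _‖ = 1
    rw [← sq_eq_sq₀ (norm_nonneg _) zero_le_one, Disk.norm_pinchFun]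
    simp
  have hbd : ∀ y ∈ Cube.boundary _, e.symm y ∈ Disk.bdry W := fun y hy => by
    rw [← he, e.apply_symm_apply]; exact hy
  obtain ⟨A, hA, hA₀, hA₁, hA₂⟩ := hp.exists_nullhomotopy
    (α := fun y => f ⟨Disk.pinch (0, e.symm y), Disk.pinch_zero_mem _⟩)
    (hf.comp ((Disk.continuous_pinch.comp (by fun_prop)).subtype_mk _)) (e := f ⟨N, hN⟩)
    (fun y hy => congrArg f (Subtype.ext (hpN (Or.inr (hbd y hy)))))
    (H := fun x => g (Disk.pinch (x.1, e.symm x.2)))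
    (hg.comp (Disk.continuous_pinch.comp (by fun_prop)))
    (fun y => (hfg ⟨Disk.pinch (0, e.symm y), Disk.pinch_zero_mem _⟩).symm) (fun y => by rw [hfg, hpN (Or.inl rfl)])
    (fun t y hy => by rw [hfg, hpN (Or.inr (hbd y hy))])
  have hq : IsQuotientMap (Disk.pinch (W := W)) :=
    (Disk.continuous_pinch.isClosedMap).isQuotientMap Disk.continuous_pinch Disk.surjective_pinch
  let A' : C(unitInterval × Disk W, E) := ⟨fun x => A (x.1, e x.2), by fun_prop⟩
  have hA' : ∀ x : unitInterval × Disk W, x.1 = 1 ∨ x.2 ∈ Disk.bdry W → A' x = f ⟨N, hN⟩ := by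
    rintro ⟨t, y⟩ (h | h)
    · obtain rfl : t = 1 := h
      exact hA₁ _
    · exact hA₂ _ _ ((he y).2 h)
  have hfac : Function.FactorsThrough A' (Disk.pinch (W := W)) := fun x x' h => by
    rcases Disk.eq_or_mem_of_pinch_eq h with rfl | ⟨h₁, h₂⟩
    · rfl
    · rw [hA' x h₁, hA' x' h₂]
  let q : C(unitInterval × Disk W, Disk (WithLp 2 (ℝ × W))) := ⟨_, Disk.continuous_pinch⟩
  have hq' : IsQuotientMap q := hq
  have hl : ∀ x, hq'.lift A' hfac (Disk.pinch x) = A' x := fun x =>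
    DFunLike.congr_fun (hq'.lift_comp A' hfac) x
  refine ⟨hq'.lift A' hfac, map_continuous _, fun v => ?_⟩
  obtain ⟨⟨t, y⟩, hx⟩ := Disk.surjective_pinch v.1
  have hv : ‖Disk.pinchFun (t, y)‖ = 1 := by
    have := v.2
    rw [← hx] at this
    exact this
  rw [← sq_eq_sq₀ (norm_nonneg _) zero_le_one, Disk.norm_pinchFun] at hv
  have hv' : (1 - (t : ℝ)) * t * (1 - ‖(y : W)‖ ^ 2) = 0 := by
    simp only at hv
    linarith
  rw [← hx, hl]
  have hJ : (t = 1 ∨ y ∈ Disk.bdry W) → A' (t, y) = f v := fun h => by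
    rw [hA' _ h]
    exact congrArg f (Subtype.ext ((hpN h).symm.trans hx))
  -- A point of the sphere comes either from `t = 0`, where the nullhomotopy starts at `f`, or from
  -- the collapsed part, where both sides are `f N`.
  rcases mul_eq_zero.1 hv' with h | h
  · rcases mul_eq_zero.1 h with h | h
    · exact hJ (Or.inl (Subtype.ext (by simpa using (sub_eq_zero.1 h).symm)))
    · obtain rfl : t = 0 := Subtype.ext h
      refine (hA₀ _).trans (congrArg f (Subtype.ext ?_))
      simp only [Homeomorph.symm_apply_apply]
      exact hx
  · refine hJ (Or.inr ?_)
    change ‖(y : W)‖ = 1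
    rw [← sq_eq_sq₀ (norm_nonneg _) zero_le_one]
    linarith

/-- A Serre fibration that is a weak homotopy equivalence has the right lifting property with
respect to the inclusions of spheres in disks. -/
theorem diskLifts (hp : IsWeakHomotopyEquivalence p) (hs : SerreLifts p) : DiskLifts p := by
  intro n
  cases n with
  | zero =>
    have hb : IsEmpty (Disk.bdry (EuclideanSpace ℝ (Fin 0))) :=
      ⟨fun y => by
        have h : ‖(y.1 : EuclideanSpace ℝ (Fin 0))‖ = 1 := y.2
        rw [Subsingleton.elim (y.1 : EuclideanSpace ℝ (Fin 0)) 0, norm_zero] at h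
        exact zero_ne_one h⟩
    intro f g hf hg hfg
    -- The sphere is empty and the disk is a point. Some `e` lies over its path component, and the
    -- Serre property moves `e` along a path.
    obtain ⟨⟨e⟩, he⟩ := hp.1.2 (Quotient.mk _ (g ⟨0, by simp⟩))
    obtain ⟨γ⟩ : Joined (p e) (g ⟨0, by simp⟩) := Quotient.exact he
    obtain ⟨l, hl, -, hl₂⟩ := hs.lift_of_homotopy (V := EuclideanSpace ℝ (Fin 0))
      (F := fun x => isEmptyElim x.2) (G := fun x => γ x.1)
      (continuous_of_const fun x => isEmptyElim x.2) (by fun_prop) (fun _ y => isEmptyElim y)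
      (l := fun _ => e) continuous_const (fun y => isEmptyElim y) (fun y => by simp)
    refine ⟨l, hl, fun y => isEmptyElim y, fun y => (hl₂ y).trans ?_⟩
    have : y = ⟨0, by simp⟩ := Subtype.ext (Subsingleton.elim _ _)
    simp [this]
  | succ m =>
    set V := WithLp 2 (ℝ × EuclideanSpace ℝ (Fin m))
    have hV : Module.finrank ℝ V = m + 1 := by
      rw [(WithLp.linearEquiv 2 ℝ (ℝ × EuclideanSpace ℝ (Fin m))).finrank_eq]
      simp [add_comm]
    have key : Lifts (Subtype.val : Disk.bdry V → _) p := by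
      intro f g hf hg hfg
      -- Injectivity on the `m`-th homotopy group fills the sphere upstairs, so the problem can be
      -- deformed to one with constant sphere data.
      obtain ⟨l, hl, hl₁⟩ := hp.exists_extension hf hg hfg
      obtain ⟨e, he⟩ := Disk.exists_homeomorph_cube V _ hV
      obtain ⟨L, hL, hL₁, hL₂⟩ := hs.lift_of_extension p.continuous hl hg
        (fun y hy => by rw [hl₁ ⟨y, hy⟩, hfg]) (fun e₀ β hβ hβe => by
          -- Now `β` represents an element of the homotopy group of degree `m + 1` at `p e₀`.
          -- Surjectivity lifts it up to homotopy relative to the boundary, and the Serre property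
          -- absorbs the homotopy.
          obtain ⟨α, H, hα, hH, hα₁, hH₀, hH₁, hH₂⟩ := hp.exists_lift_up_to_homotopy
            (Nat.le_add_left 1 m) (hβ.comp e.symm.continuous) (e := e₀)
            (fun y hy => hβe _ (by rw [← he, e.apply_symm_apply]; exact hy))
          obtain ⟨l', hl', hl₁', hl₂'⟩ := hs.lift_of_homotopy (V := V) (F := fun _ => e₀)
            (G := fun x => H (x.1, e x.2)) continuous_const (by fun_prop)
            (fun t y => (hH₂ t _ ((he _).2 y.2)).symm) (l := α ∘ e) (hα.comp e.continuous)
            (fun y => hα₁ _ ((he _).2 y.2)) (fun y => (hH₀ _).symm)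
          exact ⟨l', hl', fun y hy => hl₁' ⟨y, hy⟩, fun y => (hl₂' y).trans (by simp [hH₁])⟩)
      exact ⟨L, hL, fun y => (hL₁ y y.2).trans (hl₁ y), hL₂⟩
    obtain ⟨e, he⟩ := Disk.exists_homeomorph (EuclideanSpace ℝ (Fin (m + 1))) V (by simp [hV])
    refine key.of_subset_retract e.continuous e.symm.continuous (fun a ha => (he a).2 ha)
      (fun a ha => ?_) e.symm_apply_apply
    rw [← he, e.apply_symm_apply]
    exact ha

end DirectedFlow.IsWeakHomotopyEquivalence

instance Disk.preconnectedSpace (V : Type*) [NormedAddCommGroup V] [NormedSpace ℝ V] :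
    PreconnectedSpace (Disk V) :=
  Subtype.preconnectedSpace (convex_closedBall (0 : V) 1).isPreconnected

namespace DirectedFlow

/-! ### Fibrations and trivial fibrations of flows -/

/-- Morphisms out of a globe. -/
def globDesc {Z : Type u} [TopologicalSpace Z] [CompactlyGeneratedSpace Z] [WeakHausdorffSpace Z]
    {X : DirectedFlow.{u}} (a b : X.states) (f : C(Z, X.paths)) (ha : ∀ z, X.src (f z) = a)
    (hb : ∀ z, X.tgt (f z) = b) : glob Z ⟶ X where
  onStates i := if i.down = 0 then a else b
  onPaths := f
  src_onPaths z := (ha z).trans (if_pos rfl).symm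
  tgt_onPaths z := (hb z).trans (if_neg (by change ¬ ((1 : Fin 2) = 0); decide)).symm
  map_concat _ _ h := absurd (congrArg ULift.down h) (by change ¬ ((1 : Fin 2) = 0); decide)

@[simp]
theorem comp_onPaths {X Y Z : DirectedFlow.{u}} (f : X ⟶ Y) (g : Y ⟶ Z) (x : X.paths) :
    (f ≫ g).onPaths x = g.onPaths (f.onPaths x) := rfl

theorem onStates_congr {X Y : DirectedFlow.{u}} {f g : X ⟶ Y} (h : f = g) (x : X.states) :
    f.onStates x = g.onStates x := by rw [h]

theorem onPaths_congr {X Y : DirectedFlow.{u}} {f g : X ⟶ Y} (h : f = g) (x : X.paths) :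
    f.onPaths x = g.onPaths x := by rw [h]

theorem glob_hom_ext {Z : Type u} [TopologicalSpace Z] [CompactlyGeneratedSpace Z]
    [WeakHausdorffSpace Z] {X : DirectedFlow.{u}} {f g : glob Z ⟶ X}
    (h₀ : f.onStates ⟨0⟩ = g.onStates ⟨0⟩) (h₁ : f.onStates ⟨1⟩ = g.onStates ⟨1⟩)
    (h : ∀ z : Z, f.onPaths z = g.onPaths z) : f = g := by
  refine hom_ext ?_ h
  rintro ⟨i⟩
  fin_cases i
  · exact h₀
  · exact h₁

theorem src_eq_of_preconnected (X : DirectedFlow.{u}) {Z : Type*} [TopologicalSpace Z]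
    [PreconnectedSpace Z] {f : Z → X.paths} (hf : Continuous f) (z z' : Z) :
    X.src (f z) = X.src (f z') :=
  PreconnectedSpace.constant inferInstance (X.continuous_src.comp hf)

theorem tgt_eq_of_preconnected (X : DirectedFlow.{u}) {Z : Type*} [TopologicalSpace Z]
    [PreconnectedSpace Z] {f : Z → X.paths} (hf : Continuous f) (z z' : Z) :
    X.tgt (f z) = X.tgt (f z') :=
  PreconnectedSpace.constant inferInstance (X.continuous_tgt.comp hf)

variable {E B : DirectedFlow.{u}} {p : E ⟶ B}

/-- Surjectivity on path spaces by lifting disks, and bijectivity on states. -/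
def IsTrivialFibration (p : E ⟶ B) : Prop :=
  Function.Bijective p.onStates ∧ DiskLifts p.onPaths

/-- Injectivity on states solves the problems for `mapR`, surjectivity those for `mapC`. For globes
a lifted disk of paths has the right endpoints, because this can be checked after the injective map
on states. -/
theorem IsTrivialFibration.rlp (hp : IsTrivialFibration p) : generatingCofibrations.rlp p := by
  obtain ⟨⟨hinj, hsurj⟩, hd⟩ := hp
  rintro X Y i ((⟨⟨n⟩⟩ | ⟨⟨⟩⟩) | ⟨⟨⟩⟩)
  · constructor
    intro t b sq
    have hw₁ := onPaths_congr sq.w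
    obtain ⟨l, hl, hl₁, hl₂⟩ := hd n (fun y => t.onPaths (ULift.up ⟨y.1, mem_sphere_zero_iff_norm.2 y.2⟩))
      (fun y => b.onPaths (ULift.up y))
      ((map_continuous t.onPaths).comp (continuous_uliftUp.comp
        (Continuous.subtype_mk (by fun_prop) _)))
      ((map_continuous b.onPaths).comp continuous_uliftUp)
      (fun y => hw₁ (ULift.up ⟨y.1, mem_sphere_zero_iff_norm.2 y.2⟩))
    have h : ∀ y, p.onPaths (l y) = b.onPaths (ULift.up y) := hl₂
    refine ⟨⟨⟨globDesc (t.onStates ⟨0⟩) (t.onStates ⟨1⟩)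
      ⟨fun y => l y.down, hl.comp continuous_uliftDown⟩ (fun z => hinj ?_) (fun z => hinj ?_),
      glob_hom_ext rfl rfl fun z => ?_,
      glob_hom_ext ?_ ?_ fun z => ?_⟩⟩⟩
    · rw [← p.src_onPaths]
      refine (congrArg B.src (h _)).trans ((b.src_onPaths _).trans ?_)
      exact (onStates_congr sq.w ⟨0⟩).symm
    · rw [← p.tgt_onPaths]
      refine (congrArg B.tgt (h _)).trans ((b.tgt_onPaths _).trans ?_)
      exact (onStates_congr sq.w ⟨1⟩).symm
    · exact hl₁ ⟨⟨z.down.1, Metric.sphere_subset_closedBall z.down.2⟩,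
        mem_sphere_zero_iff_norm.1 z.down.2⟩
    · exact onStates_congr sq.w ⟨0⟩
    · exact onStates_congr sq.w ⟨1⟩
    · exact h z.down
  · constructor
    intro t b sq
    have h := onStates_congr sq.w
    refine ⟨⟨⟨discreteDesc fun _ => t.onStates ⟨0⟩, hom_ext (fun i => hinj ?_) fun x => x.elim,
      hom_ext (fun i => ?_) fun x => x.elim⟩⟩⟩
    · exact (h ⟨0⟩).trans (h i).symm
    · exact h ⟨0⟩
  · constructor
    intro t b sq
    obtain ⟨a, ha⟩ := hsurj (b.onStates PUnit.unit)
    exact ⟨⟨⟨discreteDesc fun _ => a, hom_ext (fun x => x.elim) fun x => x.elim,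
      hom_ext (fun i => ha) fun x => x.elim⟩⟩⟩

/-- Disks and cylinders are connected, so a map from one to a path space has constant source and
target and is a morphism out of a globe. Hence the map of path spaces is a Serre fibration, and
`diskLifts` applies. -/
theorem isTrivialFibration_of_bijective_of_fibration (h₀ : Function.Bijective p.onStates)
    (hw : IsWeakHomotopyEquivalence p.onPaths) (hf : generatingTrivialCofibrations.rlp p) :
    IsTrivialFibration p := by
  refine ⟨h₀, hw.diskLifts fun n f g hfc hgc hfg => ?_⟩
  have := hf _ (⟨n⟩)
  let z : Disk (EuclideanSpace ℝ (Fin n)) := ⟨0, by simp⟩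
  let t : glob (TopCat.disk.{u} n) ⟶ E := globDesc (E.src (f z)) (E.tgt (f z))
    ⟨fun y => f y.down, hfc.comp continuous_uliftDown⟩
    (fun y => E.src_eq_of_preconnected hfc _ _) (fun y => E.tgt_eq_of_preconnected hfc _ _)
  let b : glob (unitInterval × TopCat.disk.{u} n) ⟶ B := globDesc (B.src (g (0, z)))
    (B.tgt (g (0, z))) ⟨fun y => g (y.1, y.2.down), hgc.comp (by fun_prop)⟩
    (fun y => B.src_eq_of_preconnected hgc _ _) (fun y => B.tgt_eq_of_preconnected hgc _ _)
  have sq : CommSq t (globCylinderInclusion n) p b := ⟨by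
    refine glob_hom_ext ?_ ?_ fun y => hfg y.down
    · exact (p.src_onPaths _).symm.trans (congrArg B.src (hfg z))
    · exact (p.tgt_onPaths _).symm.trans (congrArg B.tgt (hfg z))⟩
  refine ⟨fun y => sq.lift.onPaths (y.1, ULift.up y.2), (map_continuous sq.lift.onPaths).comp
    (continuous_fst.prodMk (continuous_uliftUp.comp continuous_snd)), fun y => ?_, fun y => ?_⟩
  · exact onPaths_congr sq.fac_left (ULift.up y)
  · exact onPaths_congr sq.fac_right (y.1, ULift.up y.2)

theorem IsTrivialFibration.fibration (hp : IsTrivialFibration p) :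
    generatingTrivialCofibrations.rlp p := by
  have hs := hp.2.serreLifts
  rintro X Y i ⟨n⟩
  constructor
  intro t b sq
  obtain ⟨l, hl, hl₁, hl₂⟩ := hs n (fun y => t.onPaths (ULift.up y))
    (fun y => b.onPaths (y.1, ULift.up y.2))
    ((map_continuous t.onPaths).comp continuous_uliftUp)
    ((map_continuous b.onPaths).comp
      (continuous_fst.prodMk (continuous_uliftUp.comp continuous_snd)))
    (fun y => onPaths_congr sq.w (ULift.up y))
  have h : ∀ y, p.onPaths (l y) = b.onPaths (y.1, ULift.up y.2) := hl₂
  refine ⟨⟨⟨globDesc (t.onStates ⟨0⟩) (t.onStates ⟨1⟩)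
      ⟨fun y => l (y.1, y.2.down), hl.comp (by fun_prop)⟩ (fun z => hp.1.1 ?_)
      (fun z => hp.1.1 ?_), glob_hom_ext rfl rfl fun z => hl₁ _,
      glob_hom_ext ?_ ?_ fun z => h (z.1, z.2.down)⟩⟩⟩
  · rw [← p.src_onPaths]
    refine (congrArg B.src (h _)).trans ((b.src_onPaths _).trans ?_)
    exact (onStates_congr sq.w ⟨0⟩).symm
  · rw [← p.tgt_onPaths]
    refine (congrArg B.tgt (h _)).trans ((b.tgt_onPaths _).trans ?_)
    exact (onStates_congr sq.w ⟨1⟩).symm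
  · exact onStates_congr sq.w ⟨0⟩
  · exact onStates_congr sq.w ⟨1⟩

/-- The morphisms with the right lifting property with respect to the generating cofibrations. -/
theorem isTrivialFibration_of_rlp (hp : generatingCofibrations.rlp p) : IsTrivialFibration p := by
  have hinj : Function.Injective p.onStates := fun a b hab => by
    have := hp mapR (Or.inl (Or.inr ⟨⟨⟩⟩))
    have sq : CommSq (discreteDesc fun i : ULift.{u} (Fin 2) => if i.down = 0 then a else b) mapR p
        (discreteDesc fun _ : PUnit.{u + 1} => p.onStates a) := ⟨by
      refine hom_ext ?_ fun x => x.elim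
      rintro ⟨i⟩
      fin_cases i
      · rfl
      · exact hab.symm⟩
    have h₀ := onStates_congr sq.fac_left ⟨0⟩
    have h₁ := onStates_congr sq.fac_left ⟨1⟩
    exact h₀.symm.trans h₁
  have hsurj : Function.Surjective p.onStates := fun b => by
    have := hp mapC (Or.inr ⟨⟨⟩⟩)
    have sq : CommSq (discreteDesc PEmpty.elim) mapC p
        (discreteDesc fun _ : PUnit.{u + 1} => b) :=
      ⟨hom_ext (fun x => x.elim) fun x => x.elim⟩
    exact ⟨sq.lift.onStates PUnit.unit, onStates_congr sq.fac_right PUnit.unit⟩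
  refine ⟨⟨hinj, hsurj⟩, fun n f g hf hg hfg => ?_⟩
  have := hp (globBoundaryInclusion n) (Or.inl (Or.inl (⟨n⟩)))
  let z : Disk (EuclideanSpace ℝ (Fin n)) := ⟨0, by simp⟩
  -- The sphere may be empty or disconnected, so the endpoints of its globe are read off from the
  -- disk downstairs and lifted through the bijection on states.
  obtain ⟨a, ha⟩ := hsurj (B.src (g z))
  obtain ⟨a', ha'⟩ := hsurj (B.tgt (g z))
  let t : glob (TopCat.diskBoundary.{u} n) ⟶ E := globDesc a a'
    ⟨fun y => f ⟨⟨y.down.1, Metric.sphere_subset_closedBall y.down.2⟩,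
      mem_sphere_zero_iff_norm.1 y.down.2⟩, hf.comp (Continuous.subtype_mk
        (Continuous.subtype_mk (continuous_subtype_val.comp continuous_uliftDown) _) _)⟩
    (fun y => hinj (by
      rw [ha, ← p.src_onPaths]
      exact (congrArg B.src (hfg _)).trans (B.src_eq_of_preconnected hg _ _)))
    (fun y => hinj (by
      rw [ha', ← p.tgt_onPaths]
      exact (congrArg B.tgt (hfg _)).trans (B.tgt_eq_of_preconnected hg _ _)))
  let b : glob (TopCat.disk.{u} n) ⟶ B := globDesc (B.src (g z)) (B.tgt (g z))
    ⟨fun y => g y.down, hg.comp continuous_uliftDown⟩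
    (fun y => B.src_eq_of_preconnected hg _ _) (fun y => B.tgt_eq_of_preconnected hg _ _)
  have sq : CommSq t (globBoundaryInclusion n) p b := ⟨glob_hom_ext ha ha' fun y => hfg _⟩
  refine ⟨fun y => sq.lift.onPaths (ULift.up y), (map_continuous sq.lift.onPaths).comp
    continuous_uliftUp, fun y => ?_, fun y => ?_⟩
  · exact onPaths_congr sq.fac_left (ULift.up ⟨y.1, mem_sphere_zero_iff_norm.2 y.2⟩)
  · exact onPaths_congr sq.fac_right (ULift.up y)

end DirectedFlow

/-! ### Kelleyfication -/

/-- In a `k`-Hausdorff space, the coincidence set of two maps from a compact Hausdorff space is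
closed. -/
def KHausdorff (X : Type u) [TopologicalSpace X] : Prop :=
  ∀ (K : CompHaus.{u}) (f g : C(K, X)), IsClosed {k | f k = g k}

theorem WeakHausdorffSpace.isClosed_singleton {X : Type u} [TopologicalSpace X]
    [WeakHausdorffSpace X] (x : X) : IsClosed {x} := by
  have := WeakHausdorffSpace.isClosed_range (CompHaus.of PUnit.{u + 1})
    (⟨fun _ => x, continuous_const⟩ : C(PUnit.{u + 1}, X))
  convert! this
  ext y
  exact ⟨fun h => ⟨PUnit.unit, h.symm⟩, fun ⟨_, h⟩ => h.symm⟩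

theorem WeakHausdorffSpace.isClosed_image {X : Type u} [TopologicalSpace X]
    [WeakHausdorffSpace X] {K : Type u} [TopologicalSpace K] [CompactSpace K] [T2Space K]
    {f : K → X} (hf : Continuous f) {V : Set K} (hV : IsClosed V) : IsClosed (f '' V) := by
  have : CompactSpace V := isCompact_iff_compactSpace.1 hV.isCompact
  have := WeakHausdorffSpace.isClosed_range (CompHaus.of V)
    (⟨fun v => f v, hf.comp continuous_subtype_val⟩ : C(V, X))
  convert! this
  ext y
  exact ⟨fun ⟨v, hv, h⟩ => ⟨⟨v, hv⟩, h⟩, fun ⟨v, h⟩ => ⟨v.1, v.2, h⟩⟩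

/-- If `f k ≠ g k`, some closed neighbourhood `V` of `k` has `g k ∉ f(V)`, because points are
closed. As `f(V)` is closed, `g` avoids it near `k`, so `f` and `g` differ there. -/
theorem WeakHausdorffSpace.isClosed_eq {X K : Type u} [TopologicalSpace X] [WeakHausdorffSpace X]
    [TopologicalSpace K] [CompactSpace K] [T2Space K] {f g : K → X} (hf : Continuous f)
    (hg : Continuous g) : IsClosed {k | f k = g k} := by
  rw [← isOpen_compl_iff, isOpen_iff_mem_nhds]
  intro k hk
  have hU : f ⁻¹' {g k}ᶜ ∈ 𝓝 k := hf.continuousAt.preimage_mem_nhds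
    ((isClosed_singleton (g k)).isOpen_compl.mem_nhds hk)
  obtain ⟨V, hV, hVc, hVU⟩ := exists_mem_nhds_isClosed_subset hU
  have hW : g ⁻¹' (f '' V)ᶜ ∈ 𝓝 k := hg.continuousAt.preimage_mem_nhds
    ((isClosed_image hf hVc).isOpen_compl.mem_nhds fun ⟨v, hv, h⟩ => hVU hv h)
  filter_upwards [hV, hW] with x hx hx' h
  exact hx' ⟨x, hx, h⟩

/-- In a `k`-space closedness is tested along maps `g : L ⟶ X` from compact Hausdorff spaces. The
preimage in `L` of the range of `f` is the projection of the closed, hence compact, coincidence set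
in `K × L`. -/
theorem KHausdorff.weakHausdorffSpace {X : Type u} [TopologicalSpace X]
    [CompactlyGeneratedSpace X] (h : KHausdorff X) : WeakHausdorffSpace X where
  isClosed_range K f := by
    refine CompactlyGeneratedSpace.isClosed' fun L _ _ _ g hg => ?_
    have hc : IsClosed {x : K × L | f x.1 = g x.2} :=
      h (CompHaus.of (K × L)) ⟨fun x => f x.1, by fun_prop⟩ ⟨fun x => g x.2, by fun_prop⟩
    convert! (hc.isCompact.image continuous_snd).isClosed
    ext l
    exact ⟨fun ⟨k, hk⟩ => ⟨(k, l), hk, rfl⟩, fun ⟨x, hx, hl⟩ => ⟨x.1, hx.trans (congrArg g hl)⟩⟩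

/-- A space with its compactly generated topology. -/
@[ext]
structure Kify (X : Type u) : Type u where
  /-- The identity map to the Kelleyfication. -/
  of ::
  /-- The identity map from the Kelleyfication. -/
  val : X

namespace Kify

variable {X : Type u} [TopologicalSpace X]

instance : TopologicalSpace (Kify X) := (TopologicalSpace.compactlyGenerated.{u} X).induced val

theorem continuous_val : Continuous (val : Kify X → X) := by
  have h : Continuous[TopologicalSpace.compactlyGenerated.{u} X, inferInstance] (id : X → X) :=
    continuous_from_compactlyGenerated _ fun _ g => map_continuous g
  exact @Continuous.comp _ _ _ _ (TopologicalSpace.compactlyGenerated.{u} X) _ _ _ h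
    continuous_induced_dom

theorem continuous_of_comp_of_compHaus (K : CompHaus.{u}) {f : K → X} (hf : Continuous f) :
    Continuous fun k => of (f k) := by
  refine continuous_induced_rng.2 ?_
  have h : Continuous[inferInstance, TopologicalSpace.compactlyGenerated.{u} X]
      (fun x : (Σ (i : (S : CompHaus.{u}) × C(S, X)), i.fst) => x.1.2 x.2) :=
    continuous_coinduced_rng
  have h' := @Continuous.comp _ _ _ _ _ (TopologicalSpace.compactlyGenerated.{u} X) _ _ h
    (continuous_sigmaMk (σ := fun i : (S : CompHaus.{u}) × C(S, X) => i.fst)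
    (i := ⟨K, ⟨f, hf⟩⟩))
  exact h'

theorem continuous_of_comp {Z : Type u} [TopologicalSpace Z] [CompactlyGeneratedSpace Z]
    {f : Z → X} (hf : Continuous f) : Continuous fun z => of (f z) :=
  continuous_from_compactlyGeneratedSpace (fun z => of (f z)) fun K _ _ _ _ hg =>
    continuous_of_comp_of_compHaus (CompHaus.of K) (hf.comp hg)

theorem continuous_of_comp_of_compact {Z : Type} [TopologicalSpace Z] [CompactSpace Z] [T2Space Z]
    {f : Z → X} (hf : Continuous f) : Continuous fun z => of (f z) :=
  (continuous_of_comp_of_compHaus (CompHaus.of (ULift.{u} Z))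
    (hf.comp continuous_uliftDown)).comp continuous_uliftUp

instance : CompactlyGeneratedSpace (Kify X) := by
  refine compactlyGeneratedSpace_of_continuous_maps fun f hf => ?_
  have h : Continuous[TopologicalSpace.compactlyGenerated.{u} X, inferInstance] (f ∘ of) :=
    continuous_from_compactlyGenerated _ fun S g =>
      hf S (fun k => of (g k)) (continuous_of_comp_of_compHaus S (map_continuous g))
  exact @Continuous.comp _ _ _ _ (TopologicalSpace.compactlyGenerated.{u} X) _ _ _ h
    continuous_induced_dom

theorem weakHausdorffSpace (h : KHausdorff X) : WeakHausdorffSpace (Kify X) :=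
  KHausdorff.weakHausdorffSpace fun K f g => by
    have := h K ⟨fun k => (f k).val, continuous_val.comp (map_continuous f)⟩
      ⟨fun k => (g k).val, continuous_val.comp (map_continuous g)⟩
    simp only [Kify.ext_iff]
    exact this

end Kify

namespace DirectedFlow

theorem continuous_concat_of_compactlyGenerated (X : DirectedFlow.{u}) {Z : Type u}
    [TopologicalSpace Z] [CompactlyGeneratedSpace Z] {a b : Z → X.paths} (ha : Continuous a)
    (hb : Continuous b) (h : ∀ z, X.tgt (a z) = X.src (b z)) :
    Continuous fun z => X.concat (a z) (b z) (h z) :=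
  continuous_from_compactlyGeneratedSpace _ fun K _ _ _ g hg =>
    X.continuous_concat_comp (K := K) (ha.comp hg) (hb.comp hg) fun k => h (g k)

theorem continuous_concat_of_compact (X : DirectedFlow.{u}) {Z : Type}
    [TopologicalSpace Z] [CompactSpace Z] [T2Space Z] {a b : Z → X.paths} (ha : Continuous a)
    (hb : Continuous b) (h : ∀ z, X.tgt (a z) = X.src (b z)) :
    Continuous fun z => X.concat (a z) (b z) (h z) :=
  (X.continuous_concat_comp (K := ULift.{u} Z) (ha.comp continuous_uliftDown)
    (hb.comp continuous_uliftDown) fun k => h k.down).comp continuous_uliftUp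

theorem concat_congr (X : DirectedFlow.{u}) {x x' y y' : X.paths} (hx : x = x') (hy : y = y')
    (h : X.tgt x = X.src y) : X.concat x y h = X.concat x' y' (by rw [← hx, ← hy, h]) := by
  subst hx hy; rfl

/-- A flow whose path space need not be compactly generated. -/
structure PreFlow : Type (u + 1) where
  /-- the `0`-skeleton -/
  states : Type u
  /-- the path space -/
  paths : Type u
  [topPaths : TopologicalSpace paths]
  /-- the source map -/
  src : paths → states
  /-- the target map -/
  tgt : paths → states
  locallyConstant_src : IsLocallyConstant src
  locallyConstant_tgt : IsLocallyConstant tgt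
  /-- the concatenation of composable paths -/
  concat : ∀ x y : paths, tgt x = src y → paths
  continuous_concat : ∀ (K : CompHaus.{u}) (a b : C(K, paths)) (h : ∀ k, tgt (a k) = src (b k)),
    Continuous fun k => concat (a k) (b k) (h k)
  kHausdorff : KHausdorff paths
  src_concat : ∀ x y h, src (concat x y h) = src x
  tgt_concat : ∀ x y h, tgt (concat x y h) = tgt y
  concat_assoc : ∀ (x y z : paths) (hxy : tgt x = src y) (hyz : tgt y = src z),
    concat (concat x y hxy) z ((tgt_concat x y hxy).trans hyz) =
      concat x (concat y z hyz) (hxy.trans (src_concat y z hyz).symm)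

attribute [instance] PreFlow.topPaths

/-- The flow obtained by Kelleyfication of the path space. -/
def PreFlow.toFlow (X : PreFlow.{u}) : DirectedFlow.{u} :=
  letI : TopologicalSpace X.states := ⊥
  haveI : DiscreteTopology X.states := ⟨rfl⟩
  haveI := Kify.weakHausdorffSpace X.kHausdorff
  { states := X.states
    paths := Kify X.paths
    src x := X.src x.val
    tgt x := X.tgt x.val
    continuous_src := X.locallyConstant_src.continuous.comp Kify.continuous_val
    continuous_tgt := X.locallyConstant_tgt.continuous.comp Kify.continuous_val
    concat x y h := Kify.of (X.concat x.val y.val h)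
    continuous_concat := continuous_from_compactlyGenerated _ fun K g =>
      Kify.continuous_of_comp_of_compHaus K (X.continuous_concat K
        ⟨fun k => (g k).1.1.val, Kify.continuous_val.comp (by fun_prop)⟩
        ⟨fun k => (g k).1.2.val, Kify.continuous_val.comp (by fun_prop)⟩ fun k => (g k).2)
    src_concat _ _ _ := X.src_concat _ _ _
    tgt_concat _ _ _ := X.tgt_concat _ _ _
    concat_assoc _ _ _ _ _ := Kify.ext (X.concat_assoc _ _ _ _ _) }

/-! ### Path flows -/

section PathFlow

variable (Y : DirectedFlow.{u})

/-- Pointwise concatenation of paths of paths. -/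
def pathConcat (γ δ : C(unitInterval, Y.paths)) (h : Y.tgt (γ 0) = Y.src (δ 0)) :
    C(unitInterval, Y.paths) where
  toFun t := Y.concat (γ t) (δ t) (((Y.tgt_eq_of_preconnected (map_continuous γ) t 0).trans h).trans
    (Y.src_eq_of_preconnected (map_continuous δ) 0 t))
  continuous_toFun := Y.continuous_concat_of_compact (map_continuous γ) (map_continuous δ) _

/-- The flow of the paths of paths of `Y` that satisfy `P`, before Kelleyfication. -/
def pathPreFlow (P : C(unitInterval, Y.paths) → Prop)
    (hP : ∀ γ δ h, P γ → P δ → P (pathConcat Y γ δ h)) : PreFlow.{u} where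
  states := Y.states
  paths := {γ : C(unitInterval, Y.paths) // P γ}
  src γ := Y.src (γ.1 0)
  tgt γ := Y.tgt (γ.1 0)
  locallyConstant_src := (IsLocallyConstant.iff_continuous _).2
    (Y.continuous_src.comp (by fun_prop))
  locallyConstant_tgt := (IsLocallyConstant.iff_continuous _).2
    (Y.continuous_tgt.comp (by fun_prop))
  concat γ δ h := ⟨pathConcat Y γ.1 δ.1 h, hP _ _ h γ.2 δ.2⟩
  continuous_concat K a b h := by
    refine Continuous.subtype_mk (ContinuousMap.continuous_of_continuous_uncurry _ ?_) _
    exact Y.continuous_concat_comp (K := K × unitInterval) (a := fun x => (a x.1).1 x.2)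
      (b := fun x => (b x.1).1 x.2) (by fun_prop) (by fun_prop) _
  kHausdorff K a b := by
    have : {k | a k = b k} = ⋂ t : unitInterval, {k | (a k).1 t = (b k).1 t} := by
      ext k
      simp [Subtype.ext_iff, ContinuousMap.ext_iff]
    rw [this]
    exact isClosed_iInter fun t => WeakHausdorffSpace.isClosed_eq (by fun_prop) (by fun_prop)
  src_concat γ δ h := Y.src_concat _ _ _
  tgt_concat γ δ h := Y.tgt_concat _ _ _
  concat_assoc x y z _ _ := Subtype.ext (ContinuousMap.ext fun t => Y.concat_assoc _ _ _ _ _)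

variable {Y}
variable {P : C(unitInterval, Y.paths) → Prop} {hP : ∀ γ δ h, P γ → P δ → P (pathConcat Y γ δ h)}

/-- Evaluation of paths of paths. -/
def pathEval (t : unitInterval) : (pathPreFlow Y P hP).toFlow ⟶ Y where
  onStates := id
  onPaths := ⟨fun γ => (γ.val).1 t, by
    have : Continuous fun γ : {γ : C(unitInterval, Y.paths) // P γ} => γ.1 t := by fun_prop
    exact this.comp Kify.continuous_val⟩
  src_onPaths γ := Y.src_eq_of_preconnected (map_continuous (γ.val).1) t 0
  tgt_onPaths γ := Y.tgt_eq_of_preconnected (map_continuous (γ.val).1) t 0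
  map_concat _ _ _ := rfl

/-- Evaluation is jointly continuous in the path and the time because `[0,1]` is locally compact. -/
theorem sHomotopic_of_pathFlow {X : DirectedFlow.{u}} (h : X ⟶ (pathPreFlow Y P hP).toFlow) :
    SHomotopic (h ≫ pathEval 0) (h ≫ pathEval 1) := by
  refine ⟨⟨fun x => toMap (h ≫ pathEval x.1) x.2, ?_⟩, fun t => ⟨h ≫ pathEval t, fun x => rfl⟩,
    fun _ => rfl, fun _ => rfl⟩
  have h₁ : Continuous fun x : unitInterval × X.states =>
      (Sum.inl (h.onStates x.2) : Y.states ⊕ Y.paths) :=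
    continuous_inl.comp (continuous_of_discreteTopology.comp continuous_snd)
  have h₂ : Continuous fun x : unitInterval × X.paths =>
      (Sum.inr ((h.onPaths x.2).val.1 x.1) : Y.states ⊕ Y.paths) := by
    have : Continuous fun x : unitInterval × X.paths =>
        ((h.onPaths x.2).val : {γ : C(unitInterval, Y.paths) // P γ}) :=
      Kify.continuous_val.comp ((map_continuous h.onPaths).comp continuous_snd)
    exact continuous_inr.comp (continuous_eval.comp ((continuous_subtype_val.comp this).prodMk continuous_fst))
  have h₃ : Continuous fun x : (unitInterval × X.states) ⊕ (unitInterval × X.paths) =>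
      Sum.elim (fun x => (Sum.inl (h.onStates x.2) : Y.states ⊕ Y.paths))
        (fun x => Sum.inr ((h.onPaths x.2).val.1 x.1)) x := h₁.sumElim h₂
  refine (h₃.comp (Homeomorph.prodSumDistrib (X := unitInterval) (Y := X.states)
    (Z := X.paths)).continuous).congr ?_
  rintro ⟨t, x | x⟩ <;> rfl

/-- The flow of all paths of paths. -/
abbrev pathFlow (Y : DirectedFlow.{u}) : DirectedFlow.{u} :=
  (pathPreFlow Y (fun _ => True) fun _ _ _ _ _ => trivial).toFlow

/-- The morphism to the path flow given by a continuous family of morphisms. -/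
theorem SHomotopic.exists_pathFlow {X : DirectedFlow.{u}} {f g : X ⟶ Y} (h : SHomotopic f g) :
    ∃ k : X ⟶ pathFlow Y, k ≫ pathEval 0 = f ∧ k ≫ pathEval 1 = g := by
  obtain ⟨H, hH, h₀, h₁⟩ := h
  choose m hm using hH
  -- A state moves continuously in a discrete space along the connected interval, so it does not
  -- move.
  have hst : ∀ t x, (m t).onStates x = f.onStates x := fun t x => by
    have hc : Continuous fun s : unitInterval => (Sum.inl ((m s).onStates x) : Y.states ⊕ Y.paths) :=
      ((map_continuous H).comp (by fun_prop : Continuous fun s : unitInterval =>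
        (s, (Sum.inl x : X.Space)))).congr fun s => hm s (Sum.inl x)
    have hc' : Continuous fun s : unitInterval => (m s).onStates x :=
      (Topology.IsEmbedding.inl (X := Y.states) (Y := Y.paths)).continuous_iff.2 hc
    refine (PreconnectedSpace.constant inferInstance hc' (x := t) (y := 0)).trans ?_
    exact Sum.inl_injective ((hm 0 (Sum.inl x)).symm.trans (h₀ (Sum.inl x)))
  have hp : Continuous fun x : X.paths × unitInterval => (m x.2).onPaths x.1 := by
    refine (Topology.IsEmbedding.inr (X := Y.states) (Y := Y.paths)).continuous_iff.2 ?_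
    exact ((map_continuous H).comp (by fun_prop : Continuous fun x : X.paths × unitInterval =>
      (x.2, (Sum.inr x.1 : X.Space)))).congr fun x => hm x.2 (Sum.inr x.1)
  let c : X.paths → {γ : C(unitInterval, Y.paths) // True} := fun x =>
    ⟨⟨fun t => (m t).onPaths x, hp.comp (continuous_const.prodMk continuous_id)⟩, trivial⟩
  have hc : Continuous c :=
    Continuous.subtype_mk (ContinuousMap.continuous_of_continuous_uncurry _ hp) _
  have hc' := Kify.continuous_of_comp hc
  refine ⟨⟨f.onStates, ⟨_, hc'⟩, fun x => ?_,
    fun x => ?_, fun x y h => ?_⟩, ?_, ?_⟩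
  · exact ((m 0).src_onPaths x).trans (hst 0 _)
  · exact ((m 0).tgt_onPaths x).trans (hst 0 _)
  · exact Kify.ext (Subtype.ext (ContinuousMap.ext fun t => (m t).map_concat x y h))
  · refine hom_ext (fun x => rfl) fun x => ?_
    exact Sum.inr_injective ((hm 0 (Sum.inr x)).symm.trans (h₀ (Sum.inr x)))
  · refine hom_ext (fun x => ?_) fun x => ?_
    · rw [← Sum.inl_injective ((hm 1 (Sum.inl x)).symm.trans (h₁ (Sum.inl x)))]
      exact (hst 1 x).symm
    · exact Sum.inr_injective ((hm 1 (Sum.inr x)).symm.trans (h₁ (Sum.inr x)))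

/-- A sphere of paths together with a disk of starting points is a map on the box of `[0,1] × D`.
The box is a retract of the cylinder, so the map extends. -/
theorem isTrivialFibration_pathEval :
    IsTrivialFibration (pathEval 0 : pathFlow Y ⟶ Y) := by
  refine ⟨Function.bijective_id, fun n f g hf hg hfg => ?_⟩
  set V := EuclideanSpace ℝ (Fin n)
  let φ : Disk.bdry V → {γ : C(unitInterval, Y.paths) // True} := fun y => (f y).val
  have hφ : Continuous φ := Kify.continuous_val.comp hf
  let Q₁ : Set (Disk.box V) := {x | x.1.1 = 0}
  let Q₂ : Set (Disk.box V) := {x | x.1.2 ∈ Disk.bdry V}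
  have hQ₁ : IsClosed Q₁ := isClosed_eq (by fun_prop) continuous_const
  have hQ₂ : IsClosed Q₂ := Disk.isClosed_bdry.preimage (by fun_prop)
  have hφ' : Continuous fun x : Q₂ => (φ ⟨x.1.1.2, x.2⟩).1 x.1.1.1 := by
    have : Continuous fun x : Q₂ => φ ⟨x.1.1.2, x.2⟩ :=
      hφ.comp (Continuous.subtype_mk (by fun_prop) _)
    fun_prop
  obtain ⟨F, hF, hF₁, hF₂⟩ := exists_continuous_glue hQ₁ hQ₂ (fun x => x.2)
    (f := fun x => g x.1.1.2) (g := fun x => (φ ⟨x.1.1.2, x.2⟩).1 x.1.1.1) (by fun_prop) hφ'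
    (fun x hx hx' => by
      obtain ⟨⟨t, y⟩, hty⟩ := x
      obtain rfl : t = 0 := hx
      exact (hfg ⟨y, hx'⟩).symm)
  let R : unitInterval × Disk V → Disk.box V := fun x => ⟨Disk.boxFlow 0 x, Disk.boxFlow_zero_mem x⟩
  have hR : Continuous R := (Disk.continuous_boxFlow.comp
    (continuous_const.prodMk continuous_id)).subtype_mk _
  have hR' : ∀ x : Disk.box V, R x.1 = x := fun x => Subtype.ext (Disk.boxFlow_zero_of_mem x.2)
  let l : Disk V → {γ : C(unitInterval, Y.paths) // True} := fun y =>
    ⟨⟨fun t => F (R (t, y)), by fun_prop⟩, trivial⟩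
  have hl₀ : Continuous fun x : Disk V × unitInterval => F (R (x.2, x.1)) := by fun_prop
  have hl : Continuous l := Continuous.subtype_mk
    (ContinuousMap.continuous_of_continuous_uncurry _ hl₀) _
  have hl' := Kify.continuous_of_comp_of_compact hl
  refine ⟨_, hl', fun y => ?_, fun y => ?_⟩
  · refine Kify.ext (Subtype.ext (ContinuousMap.ext fun t => ?_))
    change F (R (t, y)) = (φ y).1 t
    rw [hR' ⟨(t, y), Or.inr y.2⟩]
    exact hF₂ ⟨⟨(t, y), Or.inr y.2⟩, y.2⟩
  · change F (R (0, y)) = g y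
    rw [hR' ⟨(0, y), Or.inl rfl⟩]
    exact hF₁ ⟨⟨(0, y), Or.inl rfl⟩, rfl⟩

end PathFlow

end DirectedFlow

namespace DirectedFlow

/-! ### From left homotopy to S-homotopy -/

section Fiber

variable {E X : DirectedFlow.{u}} (π : E ⟶ X)

/-- The fiber square of a morphism over the diagonal of the states. -/
def fiberPreFlow : PreFlow.{u} where
  states := E.states
  paths := {x : E.paths × E.paths //
    π.onPaths x.1 = π.onPaths x.2 ∧ E.src x.1 = E.src x.2 ∧ E.tgt x.1 = E.tgt x.2}
  src x := E.src x.1.1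
  tgt x := E.tgt x.1.1
  locallyConstant_src := (IsLocallyConstant.iff_continuous _).2
    (E.continuous_src.comp (by fun_prop))
  locallyConstant_tgt := (IsLocallyConstant.iff_continuous _).2
    (E.continuous_tgt.comp (by fun_prop))
  concat x y h := ⟨(E.concat x.1.1 y.1.1 h,
      E.concat x.1.2 y.1.2 (x.2.2.2.symm.trans (h.trans y.2.2.1))), by
    refine ⟨?_, ?_, ?_⟩
    · rw [π.map_concat, π.map_concat]
      exact X.concat_congr x.2.1 y.2.1 _
    · rw [E.src_concat, E.src_concat, x.2.2.1]
    · rw [E.tgt_concat, E.tgt_concat, y.2.2.2]⟩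
  continuous_concat K a b h := by
    refine Continuous.subtype_mk (Continuous.prodMk ?_ ?_) _
    · exact E.continuous_concat_comp (K := K) (a := fun k => (a k).1.1) (b := fun k => (b k).1.1)
        (by fun_prop) (by fun_prop) _
    · exact E.continuous_concat_comp (K := K) (a := fun k => (a k).1.2) (b := fun k => (b k).1.2)
        (by fun_prop) (by fun_prop) _
  kHausdorff K a b := by
    have : {k | a k = b k} = {k | (a k).1.1 = (b k).1.1} ∩ {k | (a k).1.2 = (b k).1.2} := by
      ext k
      exact Subtype.ext_iff.trans Prod.ext_iff
    rw [this]
    exact (WeakHausdorffSpace.isClosed_eq (by fun_prop) (by fun_prop)).inter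
      (WeakHausdorffSpace.isClosed_eq (by fun_prop) (by fun_prop))
  src_concat _ _ _ := E.src_concat _ _ _
  tgt_concat _ _ _ := E.tgt_concat _ _ _
  concat_assoc _ _ _ _ _ := Subtype.ext (Prod.ext (E.concat_assoc _ _ _ _ _)
    (E.concat_assoc _ _ _ _ _))

/-- The flow of the paths in the fibers of `π`, before Kelleyfication. -/
def fiberPathPreFlow : PreFlow.{u} :=
  pathPreFlow E (fun γ => ∀ t, π.onPaths (γ t) = π.onPaths (γ 0)) fun γ δ h hγ hδ t => by
    have hc : ∀ s, π.onPaths (pathConcat E γ δ h s) =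
        X.concat (π.onPaths (γ 0)) (π.onPaths (δ 0)) (by
          rw [π.tgt_onPaths, π.src_onPaths, h]) := fun s =>
      (π.map_concat _ _ _).trans (X.concat_congr (hγ s) (hδ s) _)
    rw [hc t, hc 0]

/-- The endpoints of a path in a fiber. -/
def fiberEndpoints : (fiberPathPreFlow π).toFlow ⟶ (fiberPreFlow π).toFlow where
  onStates := id
  onPaths := ⟨fun γ => Kify.of ⟨(γ.val.1 0, γ.val.1 1), (γ.val.2 1).symm,
      E.src_eq_of_preconnected (map_continuous γ.val.1) _ _,
      E.tgt_eq_of_preconnected (map_continuous γ.val.1) _ _⟩, by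
    have h : Continuous fun γ : {γ : C(unitInterval, E.paths) //
        ∀ t, π.onPaths (γ t) = π.onPaths (γ 0)} => (γ.1 0, γ.1 1) := by fun_prop
    exact Kify.continuous_of_comp ((h.comp Kify.continuous_val).subtype_mk _)⟩
  src_onPaths _ := rfl
  tgt_onPaths _ := rfl
  map_concat _ _ _ := rfl

variable {π}

/-- A disk of endpoint pairs and a sphere of paths in fibres amount to a map on the boundary of
`[0,1] × D`. Extending it so that each path stays in its fibre is a lifting problem for `π`, whose
base map does not depend on the time coordinate. -/
theorem isTrivialFibration_fiberEndpoints (hπ : IsTrivialFibration π) :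
    IsTrivialFibration (fiberEndpoints π) := by
  refine ⟨Function.bijective_id, fun n f g hf hg hfg => ?_⟩
  set V := EuclideanSpace ℝ (Fin n)
  let φ : Disk.bdry V → {γ : C(unitInterval, E.paths) //
        ∀ t, π.onPaths (γ t) = π.onPaths (γ 0)} := fun y => (f y).val
  have hφ : Continuous φ := Kify.continuous_val.comp hf
  let ψ : Disk V → {x : E.paths × E.paths //
      π.onPaths x.1 = π.onPaths x.2 ∧ E.src x.1 = E.src x.2 ∧ E.tgt x.1 = E.tgt x.2} :=
    fun y => (g y).val
  have hψ : Continuous ψ := Kify.continuous_val.comp hg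
  have hφψ : ∀ y : Disk.bdry V, ((φ y).1 0, (φ y).1 1) = (ψ y).1 := fun y =>
    congrArg (fun x => (Kify.val x).1) (hfg y)
  let Q₁ : Set (Disk.cylBdry V) := {x | x.1.1 = 0 ∨ x.1.1 = 1}
  let Q₂ : Set (Disk.cylBdry V) := {x | x.1.2 ∈ Disk.bdry V}
  have hQ₁ : IsClosed Q₁ := (isClosed_eq (by fun_prop) continuous_const).union
    (isClosed_eq (by fun_prop) continuous_const)
  have hQ₂ : IsClosed Q₂ := Disk.isClosed_bdry.preimage (by fun_prop)
  let Q₃ : Set Q₁ := {x | x.1.1.1 = 0}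
  let Q₄ : Set Q₁ := {x | x.1.1.1 = 1}
  have hQ₃ : IsClosed Q₃ := isClosed_eq (by fun_prop) continuous_const
  have hQ₄ : IsClosed Q₄ := isClosed_eq (by fun_prop) continuous_const
  obtain ⟨F₁, hF₁, hF₁₀, hF₁₁⟩ := exists_continuous_glue hQ₃ hQ₄ (fun x => x.2)
    (f := fun x => (ψ x.1.1.1.2).1.1) (g := fun x => (ψ x.1.1.1.2).1.2) (by fun_prop)
    (by fun_prop) (fun x hx hx' => absurd (hx.symm.trans hx') zero_ne_one)
  have hφ' : Continuous fun x : Q₂ => (φ ⟨x.1.1.2, x.2⟩).1 x.1.1.1 := by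
    have : Continuous fun x : Q₂ => φ ⟨x.1.1.2, x.2⟩ :=
      hφ.comp (Continuous.subtype_mk (by fun_prop) _)
    fun_prop
  obtain ⟨F, hF, hF₂, hF₃⟩ := exists_continuous_glue hQ₁ hQ₂
    (fun x => (or_assoc.2 x.2))
    (f := F₁) (g := fun x => (φ ⟨x.1.1.2, x.2⟩).1 x.1.1.1) hF₁ hφ'
    (fun x hx hx' => by
      obtain ⟨⟨t, y⟩, hty⟩ := x
      rcases hx with h | h
      · obtain rfl : t = 0 := h
        rw [hF₁₀ ⟨_, rfl⟩]
        exact (congrArg Prod.fst (hφψ ⟨y, hx'⟩)).symm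
      · obtain rfl : t = 1 := h
        rw [hF₁₁ ⟨_, rfl⟩]
        exact (congrArg Prod.snd (hφψ ⟨y, hx'⟩)).symm)
  have hF0 : ∀ y, F ⟨(0, y), Or.inl rfl⟩ = (ψ y).1.1 := fun y =>
    (hF₂ ⟨⟨(0, y), Or.inl rfl⟩, Or.inl rfl⟩).trans
      (hF₁₀ ⟨⟨⟨(0, y), Or.inl rfl⟩, Or.inl rfl⟩, rfl⟩)
  have hF1 : ∀ y, F ⟨(1, y), Or.inr (Or.inl rfl)⟩ = (ψ y).1.2 := fun y =>
    (hF₂ ⟨⟨(1, y), Or.inr (Or.inl rfl)⟩, Or.inr rfl⟩).trans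
      (hF₁₁ ⟨⟨⟨(1, y), Or.inr (Or.inl rfl)⟩, Or.inr rfl⟩, rfl⟩)
  have hFb : ∀ t (y : Disk.bdry V), F ⟨(t, y), Or.inr (Or.inr y.2)⟩ = (φ y).1 t := fun t y =>
    hF₃ ⟨⟨(t, y), Or.inr (Or.inr y.2)⟩, y.2⟩
  obtain ⟨L, hL, hL₁, hL₂⟩ := hπ.2.cyl V F (fun x => π.onPaths (ψ x.2).1.1) hF (by fun_prop)
    (fun x => by
      obtain ⟨⟨t, y⟩, h | h | h⟩ := x
      · obtain rfl : t = 0 := h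
        rw [hF0]
      · obtain rfl : t = 1 := h
        rw [hF1]
        exact (ψ y).2.1.symm
      · rw [hFb t ⟨y, h⟩, (φ ⟨y, h⟩).2 t]
        exact congrArg (fun z : E.paths × E.paths => π.onPaths z.1) (hφψ ⟨y, h⟩))
  have hLc : Continuous fun x : Disk V × unitInterval => L (x.2, x.1) := by fun_prop
  let l : Disk V → {γ : C(unitInterval, E.paths) //
        ∀ t, π.onPaths (γ t) = π.onPaths (γ 0)} := fun y =>
    ⟨⟨fun t => L (t, y), by fun_prop⟩, fun t => (hL₂ (t, y)).trans (hL₂ (0, y)).symm⟩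
  have hl : Continuous l := Continuous.subtype_mk
    (ContinuousMap.continuous_of_continuous_uncurry _ hLc) _
  have hl' := Kify.continuous_of_comp_of_compact hl
  refine ⟨_, hl', fun y => ?_, fun y => ?_⟩
  · refine Kify.ext (Subtype.ext (ContinuousMap.ext fun t => ?_))
    change L (t, y) = (φ y).1 t
    exact (hL₁ ⟨(t, y), Or.inr (Or.inr y.2)⟩).trans (hFb t y)
  · refine Kify.ext (Subtype.ext ?_)
    change (L (0, y), L (1, y)) = (ψ y).1
    exact Prod.ext ((hL₁ ⟨(0, y), Or.inl rfl⟩).trans (hF0 y))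
      ((hL₁ ⟨(1, y), Or.inr (Or.inl rfl)⟩).trans (hF1 y))

/-- Two sections of a trivial fibration over a cofibrant flow are S-homotopic. -/
theorem IsTrivialFibration.sHomotopic_of_sections (hπ : IsTrivialFibration π) (hX : IsCofibrant X)
    {i₀ i₁ : X ⟶ E} (h₀ : i₀ ≫ π = 𝟙 X) (h₁ : i₁ ≫ π = 𝟙 X) : SHomotopic i₀ i₁ := by
  have hst : ∀ x, i₀.onStates x = i₁.onStates x := fun x =>
    hπ.1.1 ((onStates_congr h₀ x).trans (onStates_congr h₁ x).symm)
  let k : X ⟶ (fiberPreFlow π).toFlow :=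
    { onStates := i₀.onStates
      onPaths := ⟨fun x => Kify.of ⟨(i₀.onPaths x, i₁.onPaths x),
          (onPaths_congr h₀ x).trans (onPaths_congr h₁ x).symm,
          by rw [i₀.src_onPaths, i₁.src_onPaths, hst], by
          rw [i₀.tgt_onPaths, i₁.tgt_onPaths, hst]⟩, by
        have h : Continuous fun x => (i₀.onPaths x, i₁.onPaths x) := by fun_prop
        exact Kify.continuous_of_comp (h.subtype_mk _)⟩
      src_onPaths := i₀.src_onPaths
      tgt_onPaths := i₀.tgt_onPaths
      map_concat := fun x y h => Kify.ext (Subtype.ext (Prod.ext (i₀.map_concat x y h)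
        (i₁.map_concat x y h))) }
  have hc : generatingCofibrations.rlp.llp (Limits.initial.to X) :=
    (cofibration_iff (Limits.initial.to X)).1 hX
  -- The sections form a morphism `k` to the fibre square, and cofibrancy lifts it to paths in the
  -- fibres that join `i₀` to `i₁`.
  have := hc _ (isTrivialFibration_fiberEndpoints hπ).rlp
  have sq : CommSq (Limits.initial.to (fiberPathPreFlow π).toFlow) (Limits.initial.to X)
      (fiberEndpoints π) k := ⟨Subsingleton.elim _ _⟩
  have hs := sHomotopic_of_pathFlow (Y := E) sq.lift
  have hlift := sq.fac_right
  convert! hs using 1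
  · refine hom_ext (fun x => ?_) fun x => ?_
    · exact (onStates_congr hlift x).symm
    · exact (congrArg (fun z => (Kify.val z).1.1) (onPaths_congr hlift x)).symm
  · refine hom_ext (fun x => ?_) fun x => ?_
    · exact (hst x).symm.trans (onStates_congr hlift x).symm
    · exact (congrArg (fun z => (Kify.val z).1.2) (onPaths_congr hlift x)).symm

end Fiber

theorem continuous_toMap {X Y : DirectedFlow.{u}} (f : X ⟶ Y) : Continuous (toMap f) :=
  continuous_of_discreteTopology.sumMap (map_continuous f.onPaths)

theorem SHomotopic.comp {X Y Z : DirectedFlow.{u}} {f g : X ⟶ Y} (h : SHomotopic f g)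
    (k : Y ⟶ Z) : SHomotopic (f ≫ k) (g ≫ k) := by
  obtain ⟨H, hH, h₀, h₁⟩ := h
  have hk : ∀ (m : X ⟶ Y) x, toMap (m ≫ k) x = toMap k (toMap m x) := by
    rintro m (x | x) <;> rfl
  refine ⟨⟨fun x => toMap k (H x), (continuous_toMap k).comp (map_continuous H)⟩, fun t => ?_,
    fun x => ?_, fun x => ?_⟩
  · obtain ⟨m, hm⟩ := hH t
    exact ⟨m ≫ k, fun x => (congrArg (toMap k) (hm x)).trans (hk m x).symm⟩
  · exact (congrArg (toMap k) (h₀ x)).trans (hk f x).symm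
  · exact (congrArg (toMap k) (h₁ x)).trans (hk g x).symm

/-- The legs of the cylinder are sections of its trivial fibration, hence S-homotopic. Composition
with the left homotopy transports this to `f` and `g`. -/
theorem LeftHomotopic.sHomotopic {X Y : DirectedFlow.{u}} (hX : IsCofibrant X) {f g : X ⟶ Y}
    (h : LeftHomotopic f g) : SHomotopic f g := by
  obtain ⟨P, hP, ⟨H⟩⟩ := h
  have hw : IsWeakSHomotopyEquivalence P.π := (weakEquivalence_iff P.π).1 P.weakEquivalence_π
  have hf : generatingTrivialCofibrations.rlp P.π := (fibration_iff P.π).1 hP.fibration_π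
  have := (isTrivialFibration_of_bijective_of_fibration hw.1 hw.2 hf).sHomotopic_of_sections hX
    P.i₀_π P.i₁_π
  have h' := this.comp H.h
  rwa [H.h₀, H.h₁] at h'

/-- A factorization of the codiagonal of `X` as a morphism with the left lifting property with
respect to trivial fibrations followed by a trivial fibration. -/
structure CodiagonalFactorization (X : DirectedFlow.{u}) where
  /-- the middle object -/
  E : DirectedFlow.{u}
  /-- the first inclusion -/
  i₀ : X ⟶ E
  /-- the second inclusion -/
  i₁ : X ⟶ E
  /-- the projection -/
  π : E ⟶ X
  i₀_π : i₀ ≫ π = 𝟙 X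
  i₁_π : i₁ ≫ π = 𝟙 X
  isTrivialFibration_π : IsTrivialFibration π
  exists_lift : ∀ {U V : DirectedFlow.{u}} (q : U ⟶ V), IsTrivialFibration q →
    ∀ (f₀ f₁ : X ⟶ U) (g : E ⟶ V), f₀ ≫ q = i₀ ≫ g → f₁ ≫ q = i₁ ≫ g →
      ∃ l : E ⟶ U, i₀ ≫ l = f₀ ∧ i₁ ≫ l = f₁ ∧ l ≫ q = g

/-- The factorization gives a very good cylinder. Lifting against evaluation at `0` extends the
constant homotopy on `i₀` and the given homotopy on `i₁` to all of `E`; evaluation at `1` then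
restricts to `f` and `g`. -/
theorem CodiagonalFactorization.leftHomotopic {X Y : DirectedFlow.{u}}
    (F : CodiagonalFactorization X) {f g : X ⟶ Y} (h : SHomotopic f g) : LeftHomotopic f g := by
  obtain ⟨k, hk₀, hk₁⟩ := h.exists_pathFlow
  have hπ := F.isTrivialFibration_π
  have hw : WeakEquivalence F.π :=
    (weakEquivalence_iff F.π).2 ⟨hπ.1, hπ.2.isWeakHomotopyEquivalence⟩
  let P : Cylinder X :=
    { I := F.E
      i₀ := F.i₀
      i₁ := F.i₁
      π := F.π
      i₀_π := F.i₀_π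
      i₁_π := F.i₁_π
      weakEquivalence_π := hw }
  have hc : generatingCofibrations.rlp.llp P.i := by
    intro U V q hq
    constructor
    intro t b sq
    obtain ⟨l, hl₀, hl₁, hl⟩ := F.exists_lift q (isTrivialFibration_of_rlp hq)
      (Limits.coprod.inl ≫ t) (Limits.coprod.inr ≫ t) b
      (by rw [Category.assoc, sq.w]; exact P.inl_i_assoc b)
      (by rw [Category.assoc, sq.w]; exact P.inr_i_assoc b)
    refine ⟨⟨⟨l, Limits.coprod.hom_ext ?_ ?_, hl⟩⟩⟩
    · exact (P.inl_i_assoc l).trans hl₀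
    · exact (P.inr_i_assoc l).trans hl₁
  have hP : P.IsVeryGood :=
    { cofibration_i := (cofibration_iff P.i).2 hc
      fibration_π := (fibration_iff P.π).2 hπ.fibration }
  obtain ⟨c, hc₀, hc₁⟩ : ∃ c : X ⟶ pathFlow Y, c ≫ pathEval 0 = f ∧ c ≫ pathEval 1 = f :=
    SHomotopic.exists_pathFlow ⟨⟨fun x => toMap f x.2, (continuous_toMap f).comp continuous_snd⟩,
      fun _ => ⟨f, fun _ => rfl⟩, fun _ => rfl, fun _ => rfl⟩
  obtain ⟨l, hl₀, hl₁, -⟩ := F.exists_lift (pathEval 0) isTrivialFibration_pathEval c k (F.π ≫ f)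
    (by rw [hc₀, ← Category.assoc, F.i₀_π, Category.id_comp])
    (by rw [hk₀, ← Category.assoc, F.i₁_π, Category.id_comp])
  refine ⟨P, hP, ⟨{ h := l ≫ pathEval 1, h₀ := ?_, h₁ := ?_ }⟩⟩
  · rw [← hc₁, ← hl₀, Category.assoc]
  · rw [← hk₁, ← hl₁, Category.assoc]

end DirectedFlow

namespace DirectedFlow

/-! ### Flows given by generators and relations -/

/-- Generators and relations for a flow. -/
structure Presentation : Type (u + 1) where
  /-- the `0`-skeleton -/
  states : Type u
  /-- the space of generators -/
  gens : Type u
  [topGens : TopologicalSpace gens]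
  [compactlyGeneratedGens : CompactlyGeneratedSpace gens]
  /-- the source map -/
  src : gens → states
  /-- the target map -/
  tgt : gens → states
  locallyConstant_src : IsLocallyConstant src
  locallyConstant_tgt : IsLocallyConstant tgt
  /-- `mulRel x y z` imposes that `z` is the concatenation of `x` and `y` -/
  mulRel : gens → gens → gens → Prop
  /-- `eqRel x y` imposes that `x` and `y` are equal -/
  eqRel : gens → gens → Prop
  mulRel_tgt_eq_src : ∀ {x y z}, mulRel x y z → tgt x = src y
  mulRel_src : ∀ {x y z}, mulRel x y z → src z = src x
  mulRel_tgt : ∀ {x y z}, mulRel x y z → tgt z = tgt y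
  eqRel_src : ∀ {x y}, eqRel x y → src x = src y
  eqRel_tgt : ∀ {x y}, eqRel x y → tgt x = tgt y

namespace Presentation

attribute [instance] topGens compactlyGeneratedGens

variable (P : Presentation.{u})

/-- A realization of the generators in a flow that satisfies the relations. -/
structure Model : Type (u + 1) where
  /-- the target flow -/
  flow : DirectedFlow.{u}
  /-- the map on states -/
  onStates : P.states → flow.states
  /-- the map on generators -/
  onGens : C(P.gens, flow.paths)
  src_onGens : ∀ x, flow.src (onGens x) = onStates (P.src x)
  tgt_onGens : ∀ x, flow.tgt (onGens x) = onStates (P.tgt x)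
  onGens_mul : ∀ {x y z} (_ : P.mulRel x y z) (h' : flow.tgt (onGens x) = flow.src (onGens y)),
    onGens z = flow.concat (onGens x) (onGens y) h'
  onGens_eq : ∀ {x y}, P.eqRel x y → onGens x = onGens y

/-- The formal concatenations of generators. -/
inductive Word : P.states → P.states → Type u
  | of (x : P.gens) : Word (P.src x) (P.tgt x)
  | mul {a b c : P.states} (v : Word a b) (w : Word b c) : Word a c

variable {P}

/-- The value of a formal concatenation in a model. -/
def Word.eval (M : P.Model) : ∀ {a b : P.states}, P.Word a b →
    {x : M.flow.paths // M.flow.src x = M.onStates a ∧ M.flow.tgt x = M.onStates b}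
  | _, _, .of x => ⟨M.onGens x, M.src_onGens x, M.tgt_onGens x⟩
  | _, _, .mul v w => ⟨M.flow.concat (v.eval M).1 (w.eval M).1
      ((v.eval M).2.2.trans (w.eval M).2.1.symm),
      (M.flow.src_concat _ _ _).trans (v.eval M).2.1,
      (M.flow.tgt_concat _ _ _).trans (w.eval M).2.2⟩

variable (P)

/-- Words with their endpoints. -/
abbrev FreePath : Type u := Σ a b : P.states, P.Word a b

/-- Two words are identified if they have the same value in all models. -/
def pathSetoid : Setoid P.FreePath where
  r v w := v.1 = w.1 ∧ v.2.1 = w.2.1 ∧ ∀ M : P.Model, (v.2.2.eval M).1 = (w.2.2.eval M).1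
  iseqv :=
    { refl := fun _ => ⟨rfl, rfl, fun _ => rfl⟩
      symm := fun h => ⟨h.1.symm, h.2.1.symm, fun M => (h.2.2 M).symm⟩
      trans := fun h h' => ⟨h.1.trans h'.1, h.2.1.trans h'.2.1,
        fun M => (h.2.2 M).trans (h'.2.2 M)⟩ }

/-- The paths of the presented flow. -/
def Path : Type u := Quotient P.pathSetoid

variable {P}

namespace Path

/-- The path of a word. -/
def mk {a b : P.states} (w : P.Word a b) : P.Path := Quotient.mk P.pathSetoid ⟨a, b, w⟩

/-- The source of a path. -/
def src : P.Path → P.states := Quotient.lift (fun w => w.1) fun _ _ h => h.1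

/-- The target of a path. -/
def tgt : P.Path → P.states := Quotient.lift (fun w => w.2.1) fun _ _ h => h.2.1

/-- The value of a path in a model. -/
def eval (M : P.Model) : P.Path → M.flow.paths :=
  Quotient.lift (fun w => (w.2.2.eval M).1) fun _ _ h => h.2.2 M

theorem exists_eq_mk (x : P.Path) : ∃ w : P.Word x.src x.tgt, x = mk w := by
  obtain ⟨⟨a, b, w⟩⟩ := x
  exact ⟨w, rfl⟩

theorem ext {x y : P.Path} (h₀ : x.src = y.src) (h₁ : x.tgt = y.tgt)
    (h : ∀ M : P.Model, x.eval M = y.eval M) : x = y := by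
  obtain ⟨v⟩ := x
  obtain ⟨w⟩ := y
  exact Quotient.sound ⟨h₀, h₁, h⟩

theorem src_eval (M : P.Model) (x : P.Path) : M.flow.src (x.eval M) = M.onStates x.src := by
  obtain ⟨⟨a, b, w⟩⟩ := x
  exact (w.eval M).2.1

theorem tgt_eval (M : P.Model) (x : P.Path) : M.flow.tgt (x.eval M) = M.onStates x.tgt := by
  obtain ⟨⟨a, b, w⟩⟩ := x
  exact (w.eval M).2.2

/-- Concatenation of paths. -/
noncomputable def concat (x y : P.Path) (h : x.tgt = y.src) : P.Path :=
  mk (Word.mul (Classical.choose (exists_eq_mk x)) (h ▸ Classical.choose (exists_eq_mk y)))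

theorem src_concat (x y : P.Path) (h : x.tgt = y.src) : (concat x y h).src = x.src := rfl

theorem tgt_concat (x y : P.Path) (h : x.tgt = y.src) : (concat x y h).tgt = y.tgt := rfl

theorem eval_concat (M : P.Model) (x y : P.Path) (h : x.tgt = y.src) :
    (concat x y h).eval M = M.flow.concat (x.eval M) (y.eval M)
      (by rw [tgt_eval, src_eval, h]) := by
  have hx : ((Classical.choose (exists_eq_mk x)).eval M).1 = x.eval M :=
    congrArg (eval M) (Classical.choose_spec (exists_eq_mk x)).symm
  have hy : ((Classical.choose (exists_eq_mk y)).eval M).1 = y.eval M :=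
    congrArg (eval M) (Classical.choose_spec (exists_eq_mk y)).symm
  have hc : ∀ {a b c : P.states} (e : a = b) (w : P.Word b c),
      (Word.eval M (e ▸ w : P.Word a c)).1 = (w.eval M).1 := by
    rintro a _ c rfl w; rfl
  exact M.flow.concat_congr hx ((hc h _).trans hy) _

theorem mk_mul {a b c : P.states} (v : P.Word a b) (w : P.Word b c) :
    mk (v.mul w) = concat (mk v) (mk w) rfl :=
  ext rfl rfl fun M => (eval_concat M (mk v) (mk w) rfl).symm

/-- With the initial topology, continuity into the presented flow is tested in models, and the
universal morphisms are continuous by construction. Since models also separate parallel paths, no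
further Hausdorff quotient is needed. -/
instance : TopologicalSpace P.Path :=
  TopologicalSpace.induced src ⊥ ⊓ (TopologicalSpace.induced tgt ⊥ ⊓
    ⨅ M : P.Model, TopologicalSpace.induced (eval M) inferInstance)

theorem locallyConstant_src : IsLocallyConstant (src (P := P)) := by
  let _ : TopologicalSpace P.states := ⊥
  have : DiscreteTopology P.states := ⟨rfl⟩
  exact (IsLocallyConstant.iff_continuous _).2 (continuous_iff_le_induced.2 inf_le_left)

theorem locallyConstant_tgt : IsLocallyConstant (tgt (P := P)) := by
  let _ : TopologicalSpace P.states := ⊥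
  have : DiscreteTopology P.states := ⟨rfl⟩
  exact (IsLocallyConstant.iff_continuous _).2
    (continuous_iff_le_induced.2 (inf_le_right.trans inf_le_left))

theorem continuous_eval (M : P.Model) : Continuous (eval M) :=
  continuous_iff_le_induced.2 (inf_le_right.trans (inf_le_right.trans (iInf_le _ M)))

theorem continuous_of_eval {Z : Type*} [TopologicalSpace Z] {f : Z → P.Path}
    (h₀ : IsLocallyConstant fun z => (f z).src) (h₁ : IsLocallyConstant fun z => (f z).tgt)
    (h : ∀ M : P.Model, Continuous fun z => (f z).eval M) : Continuous f := by
  let _ : TopologicalSpace P.states := ⊥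
  have : DiscreteTopology P.states := ⟨rfl⟩
  have hM : Continuous[_, ⨅ M : P.Model, TopologicalSpace.induced (eval M) inferInstance] f :=
    continuous_iInf_rng.2 fun M => continuous_induced_rng.2 (h M)
  exact continuous_inf_rng.2 ⟨continuous_induced_rng.2 h₀.continuous,
    continuous_inf_rng.2 ⟨continuous_induced_rng.2 h₁.continuous,
      hM⟩⟩

theorem _root_.IsLocallyConstant.isClosed_eq {Z S : Type*} [TopologicalSpace Z] {f g : Z → S}
    (hf : IsLocallyConstant f) (hg : IsLocallyConstant g) : IsClosed {z | f z = g z} :=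
  ⟨(hf.prodMk hg) {x | x.1 ≠ x.2}⟩

end Path

variable (P)

/-- The presented flow, before Kelleyfication. -/
noncomputable def preFlow : PreFlow.{u} where
  states := P.states
  paths := P.Path
  src := Path.src
  tgt := Path.tgt
  locallyConstant_src := Path.locallyConstant_src
  locallyConstant_tgt := Path.locallyConstant_tgt
  concat := Path.concat
  continuous_concat K a b h := by
    refine Path.continuous_of_eval ?_ ?_ fun M => ?_
    · have := Path.locallyConstant_src.comp_continuous (map_continuous a)
      exact this
    · have := Path.locallyConstant_tgt.comp_continuous (map_continuous b)
      exact this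
    · refine (M.flow.continuous_concat_comp (K := K)
        ((Path.continuous_eval M).comp (map_continuous a))
        ((Path.continuous_eval M).comp (map_continuous b)) fun k => ?_).congr fun k =>
          (Path.eval_concat M _ _ _).symm
      exact (Path.tgt_eval M _).trans ((congrArg M.onStates (h k)).trans (Path.src_eval M _).symm)
  kHausdorff K a b := by
    -- Endpoints and values in models separate paths, so the coincidence set is an intersection of
    -- coincidence sets of maps to discrete or weak Hausdorff spaces.
    have : {k | a k = b k} = {k | (a k).src = (b k).src} ∩ ({k | (a k).tgt = (b k).tgt} ∩
        ⋂ M : P.Model, {k | (a k).eval M = (b k).eval M}) := by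
      ext k
      refine ⟨fun h => ?_, fun h => Path.ext h.1 h.2.1 fun M => Set.mem_iInter.1 h.2.2 M⟩
      have h : a k = b k := h
      exact ⟨congrArg Path.src h, congrArg Path.tgt h,
        Set.mem_iInter.2 fun M => congrArg (Path.eval M) h⟩
    rw [this]
    refine IsClosed.inter ?_ (IsClosed.inter ?_ (isClosed_iInter fun M => ?_))
    · exact (Path.locallyConstant_src.comp_continuous (map_continuous a)).isClosed_eq
        (Path.locallyConstant_src.comp_continuous (map_continuous b))
    · exact (Path.locallyConstant_tgt.comp_continuous (map_continuous a)).isClosed_eq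
        (Path.locallyConstant_tgt.comp_continuous (map_continuous b))
    · exact WeakHausdorffSpace.isClosed_eq ((Path.continuous_eval M).comp (map_continuous a))
        ((Path.continuous_eval M).comp (map_continuous b))
  src_concat := Path.src_concat
  tgt_concat := Path.tgt_concat
  concat_assoc x y z hxy hyz := Path.ext rfl rfl fun M => by
    simp only [Path.eval_concat]
    exact M.flow.concat_assoc _ _ _ _ _

/-- The presented flow. -/
noncomputable def flow : DirectedFlow.{u} := P.preFlow.toFlow

/-- The generators as paths of the presented flow. -/
noncomputable def gen : C(P.gens, P.flow.paths) where
  toFun x := Kify.of (Path.mk (Word.of x))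
  continuous_toFun := Kify.continuous_of_comp (Path.continuous_of_eval P.locallyConstant_src
    P.locallyConstant_tgt fun M => map_continuous M.onGens)

variable {P}

theorem gen_mul {x y z : P.gens} (h : P.mulRel x y z)
    (h' : P.flow.tgt (P.gen x) = P.flow.src (P.gen y)) :
    P.gen z = P.flow.concat (P.gen x) (P.gen y) h' :=
  Kify.ext (Path.ext (P.mulRel_src h) (P.mulRel_tgt h) fun M =>
    (M.onGens_mul h _).trans (Path.eval_concat M (Path.mk (Word.of x)) (Path.mk (Word.of y))
      (P.mulRel_tgt_eq_src h)).symm)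

theorem gen_eq {x y : P.gens} (h : P.eqRel x y) : P.gen x = P.gen y :=
  Kify.ext (Path.ext (P.eqRel_src h) (P.eqRel_tgt h) fun M => M.onGens_eq h)

/-- The morphism to a model. -/
noncomputable def desc (M : P.Model) : P.flow ⟶ M.flow where
  onStates := M.onStates
  onPaths := ⟨fun x => Path.eval M x.val, (Path.continuous_eval M).comp Kify.continuous_val⟩
  src_onPaths x := Path.src_eval M x.val
  tgt_onPaths x := Path.tgt_eval M x.val
  map_concat x y h := Path.eval_concat M x.val y.val h

/-- Induction on the paths of a presented flow. -/
theorem flow_path_induction {motive : P.flow.paths → Prop} (hg : ∀ x, motive (P.gen x))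
    (hm : ∀ x y h, motive x → motive y → motive (P.flow.concat x y h)) (x : P.flow.paths) :
    motive x := by
  obtain ⟨⟨⟨a, b, w⟩⟩⟩ := x
  change motive (Kify.of (Path.mk w))
  induction w with
  | of x => exact hg x
  | mul v w hv hw =>
    rw [Path.mk_mul]
    exact hm (Kify.of (Path.mk v)) (Kify.of (Path.mk w)) rfl hv hw

theorem flow_hom_ext {T : DirectedFlow.{u}} {f g : P.flow ⟶ T}
    (h₀ : ∀ x : P.states, f.onStates x = g.onStates x)
    (h : ∀ x, f.onPaths (P.gen x) = g.onPaths (P.gen x)) : f = g := by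
  refine hom_ext h₀ fun x => ?_
  induction x using flow_path_induction with
  | hg x => exact h x
  | hm x y hxy hx hy =>
    rw [f.map_concat, g.map_concat]
    exact T.concat_congr hx hy _

end Presentation

end DirectedFlow

/-! ### Cancelling closed embeddings, and adjoining an apex -/

theorem WeakHausdorffSpace.isClosed_eq_of_compactlyGenerated {X Z : Type u} [TopologicalSpace X]
    [WeakHausdorffSpace X] [TopologicalSpace Z] [CompactlyGeneratedSpace Z] {f g : Z → X}
    (hf : Continuous f) (hg : Continuous g) : IsClosed {z | f z = g z} :=
  CompactlyGeneratedSpace.isClosed' fun K _ _ _ _ hk =>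
    WeakHausdorffSpace.isClosed_eq (K := K) (hf.comp hk) (hg.comp hk)

/-- Test `j '' D` along `g : K ⟶ B`. On the closed set where `m ∘ g` meets the image of `D`, the
embedding `m ∘ j` yields a continuous `a` with `m (j (a k)) = m (g k)`; then `g k` lies in `j '' D`
exactly when `j (a k) = g k`, a closed condition. -/
theorem isClosedEmbedding_of_comp {A B C : Type u} [TopologicalSpace A] [TopologicalSpace B]
    [TopologicalSpace C] [CompactlyGeneratedSpace B] [WeakHausdorffSpace B] {j : A → B} {m : B → C}
    (hj : Continuous j) (hm : Continuous m) (h : IsClosedEmbedding (m ∘ j)) :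
    IsClosedEmbedding j := by
  refine IsClosedEmbedding.of_continuous_injective_isClosedMap hj
    (h.injective.of_comp) fun D hD => ?_
  refine CompactlyGeneratedSpace.isClosed' fun K _ _ _ g hg => ?_
  let K' : Set K := {k | m (g k) ∈ (m ∘ j) '' D}
  have hK' : IsClosed K' := (h.isClosedMap D hD).preimage (hm.comp hg)
  have : CompactSpace K' := isCompact_iff_compactSpace.1 hK'.isCompact
  choose a haD ha using fun k : K' => k.2
  have hac : Continuous a := h.isInducing.continuous_iff.2
    ((hm.comp (hg.comp continuous_subtype_val)).congr fun k => (ha k).symm)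
  have hc : IsClosed {k : K' | j (a k) = g k} :=
    WeakHausdorffSpace.isClosed_eq (hj.comp hac) (hg.comp continuous_subtype_val)
  convert! hK'.isClosedMap_subtype_val _ hc
  ext k
  constructor
  · rintro ⟨d, hd, hdk⟩
    have hk : k ∈ K' := ⟨d, hd, congrArg m hdk⟩
    refine ⟨⟨k, hk⟩, ?_, rfl⟩
    have : a ⟨k, hk⟩ = d := h.injective ((ha ⟨k, hk⟩).trans (congrArg m hdk).symm)
    change j (a ⟨k, hk⟩) = g k
    rw [this, hdk]
  · rintro ⟨k', hk', rfl⟩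
    exact ⟨a k', haD k', hk'⟩

/-- A space with an added point all of whose neighbourhoods are everything. -/
inductive Apexed (X : Type u) : Type u
  | pt (x : X)
  | apex

namespace Apexed

variable {X : Type u}

theorem pt_injective : Function.Injective (pt : X → Apexed X) := fun _ _ h => by
  injection h

theorem exists_eq_pt {x : Apexed X} (h : x ≠ apex) : ∃ y, x = pt y := by
  cases x with
  | pt x => exact ⟨x, rfl⟩
  | apex => exact absurd rfl h

variable [TopologicalSpace X]

instance : TopologicalSpace (Apexed X) where
  IsOpen s := IsOpen (pt ⁻¹' s) ∧ (apex ∈ s → s = Set.univ)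
  isOpen_univ := ⟨isOpen_univ, fun _ => rfl⟩
  isOpen_inter s t hs ht := ⟨hs.1.inter ht.1, fun h => by rw [hs.2 h.1, ht.2 h.2, Set.inter_univ]⟩
  isOpen_sUnion S hS := by
    refine ⟨?_, fun ⟨t, ht, h⟩ => Set.eq_univ_of_univ_subset ?_⟩
    · rw [Set.preimage_sUnion]
      exact isOpen_biUnion fun t ht => (hS t ht).1
    · rw [← (hS t ht).2 h]
      exact Set.subset_sUnion_of_mem ht

theorem isOpen_image_pt {U : Set X} (hU : IsOpen U) : IsOpen (pt '' U) :=
  ⟨by rwa [Set.preimage_image_eq _ pt_injective], fun ⟨_, _, h⟩ => nomatch h⟩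

theorem isInducing_pt : IsInducing (pt : X → Apexed X) := by
  refine ⟨le_antisymm (continuous_iff_le_induced.1 ⟨fun s hs => hs.1⟩) fun U hU => ?_⟩
  exact ⟨pt '' U, isOpen_image_pt hU, Set.preimage_image_eq _ pt_injective⟩

/-- The only neighbourhood of the apex is the whole space, so nothing has to be checked where `b`
takes that value. `Apexed` thus encodes partial maps with open domain. -/
theorem continuous_of_isOpen {Z : Type*} [TopologicalSpace Z] {U : Set Z} (hU : IsOpen U)
    {b : Z → Apexed X} {g : U → X} (hg : Continuous g) (h₁ : ∀ z : U, b z = pt (g z))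
    (h₂ : ∀ z, z ∉ U → b z = apex) : Continuous b := by
  refine ⟨fun s hs => ?_⟩
  by_cases h : apex ∈ s
  · rw [hs.2 h]
    exact isOpen_univ
  · convert! hU.isOpenMap_subtype_val _ (hs.1.preimage hg)
    ext z
    constructor
    · intro hz
      have hzU : z ∈ U := by
        by_contra hc
        exact h (h₂ z hc ▸ hz)
      exact ⟨⟨z, hzU⟩, by simpa [← h₁] using hz, rfl⟩
    · rintro ⟨z, hz, rfl⟩
      simpa [h₁] using hz

end Apexed

namespace DirectedFlow

/-! ### Codiscrete flows and cones -/

/-- The flow with exactly one path between any two states. -/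
def codiscrete (S : Type u) [TopologicalSpace S] [DiscreteTopology S] : DirectedFlow.{u} where
  states := S
  paths := S × S
  src := Prod.fst
  tgt := Prod.snd
  continuous_src := continuous_fst
  continuous_tgt := continuous_snd
  concat x y _ := (x.1, y.2)
  continuous_concat := continuous_from_compactlyGenerated _ fun _ g => by
    have h : Continuous fun p : (S × S) × (S × S) => (p.1.1, p.2.2) := by fun_prop
    exact h.comp (continuous_subtype_val.comp (map_continuous g))
  src_concat _ _ _ := rfl
  tgt_concat _ _ _ := rfl
  concat_assoc _ _ _ _ _ := rfl

/-- The morphism to a codiscrete flow given by a map on states. -/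
def toCodiscrete {X : DirectedFlow.{u}} {S : Type u} [TopologicalSpace S] [DiscreteTopology S]
    (f : X.states → S) : X ⟶ codiscrete S where
  onStates := f
  onPaths := ⟨fun x => (f (X.src x), f (X.tgt x)), (continuous_of_discreteTopology.comp
    X.continuous_src).prodMk (continuous_of_discreteTopology.comp X.continuous_tgt)⟩
  src_onPaths _ := rfl
  tgt_onPaths _ := rfl
  map_concat x y h := Prod.ext (congrArg f (X.src_concat x y h)) (congrArg f (X.tgt_concat x y h))

variable (E : DirectedFlow.{u})

/-- The points of the cones on the spaces of paths between two states. -/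
@[ext]
structure ConePath : Type u where
  /-- the source -/
  src : E.states
  /-- the target -/
  tgt : E.states
  /-- the height in the cone -/
  height : unitInterval
  /-- the path, if the point is not the apex -/
  body : Apexed E.paths
  body_eq_apex_iff : body = .apex ↔ height = 1
  src_body : ∀ e, body = .pt e → E.src e = src
  tgt_body : ∀ e, body = .pt e → E.tgt e = tgt

variable {E}

namespace ConePath

/-- The body gives no condition at the apex, so continuity there is controlled by endpoints and
height alone. This is the coarse cone topology, for which maps into the cone are easy to build. -/
instance : TopologicalSpace (ConePath E) :=
  .induced (fun x => (x.src, x.tgt, x.height, x.body)) inferInstance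

theorem continuous_iff {Z : Type*} [TopologicalSpace Z] {f : Z → ConePath E} :
    Continuous f ↔ (Continuous fun z => (f z).src) ∧ (Continuous fun z => (f z).tgt) ∧
      (Continuous fun z => (f z).height) ∧ Continuous fun z => (f z).body := by
  rw [continuous_induced_rng]
  refine (continuous_prodMk (f := fun z => (f z).src)
    (g := fun z => ((f z).tgt, (f z).height, (f z).body))).trans (and_congr_right fun _ => ?_)
  refine (continuous_prodMk (f := fun z => (f z).tgt)
    (g := fun z => ((f z).height, (f z).body))).trans (and_congr_right fun _ => ?_)
  exact continuous_prodMk (f := fun z => (f z).height) (g := fun z => (f z).body)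

theorem exists_body {x : ConePath E} (h : x.height ≠ 1) : ∃ e, x.body = .pt e :=
  Apexed.exists_eq_pt fun h' => h (x.body_eq_apex_iff.1 h')

/-- The body of a point that is not the apex. -/
noncomputable def getBody (x : ConePath E) (h : x.height ≠ 1) : E.paths :=
  Classical.choose (exists_body h)

theorem body_eq (x : ConePath E) (h : x.height ≠ 1) : x.body = .pt (x.getBody h) :=
  Classical.choose_spec (exists_body h)

theorem src_getBody (x : ConePath E) (h : x.height ≠ 1) : E.src (x.getBody h) = x.src :=
  x.src_body _ (x.body_eq h)

theorem tgt_getBody (x : ConePath E) (h : x.height ≠ 1) : E.tgt (x.getBody h) = x.tgt :=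
  x.tgt_body _ (x.body_eq h)

theorem continuous_getBody {Z : Type*} [TopologicalSpace Z] {f : Z → ConePath E}
    (hf : Continuous f) (h : ∀ z, (f z).height ≠ 1) : Continuous fun z => (f z).getBody (h z) :=
  Apexed.isInducing_pt.continuous_iff.2
    ((continuous_iff.1 hf).2.2.2.congr fun z => (f z).body_eq (h z))

theorem continuous_height : Continuous (height : ConePath E → unitInterval) :=
  (continuous_iff.1 continuous_id).2.2.1

open Classical in
/-- A point of a cone, given by a height and a path that is defined below the apex. -/
noncomputable def ofBody (a b : E.states) (t : unitInterval) (e : t ≠ 1 → E.paths)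
    (ha : ∀ h, E.src (e h) = a) (hb : ∀ h, E.tgt (e h) = b) : ConePath E where
  src := a
  tgt := b
  height := t
  body := if h : t = 1 then .apex else .pt (e h)
  body_eq_apex_iff := by
    by_cases h : t = 1
    · simp [h]
    · simp [h]
  src_body := by
    intro e' he'
    by_cases h : t = 1
    · simp [h] at he'
    · rw [dif_neg h] at he'
      rw [← Apexed.pt_injective he', ha]
  tgt_body := by
    intro e' he'
    by_cases h : t = 1
    · simp [h] at he'
    · rw [dif_neg h] at he'
      rw [← Apexed.pt_injective he', hb]

theorem ofBody_body (a b : E.states) (t : unitInterval) (e : t ≠ 1 → E.paths)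
    (ha : ∀ h, E.src (e h) = a) (hb : ∀ h, E.tgt (e h) = b) (h : t ≠ 1) :
    (ofBody a b t e ha hb).body = .pt (e h) := dif_neg h

theorem ofBody_getBody (a b : E.states) (t : unitInterval) (e : t ≠ 1 → E.paths)
    (ha : ∀ h, E.src (e h) = a) (hb : ∀ h, E.tgt (e h) = b) (h : t ≠ 1) :
    (ofBody a b t e ha hb).getBody h = e h :=
  Apexed.pt_injective ((body_eq _ h).symm.trans (ofBody_body _ _ _ _ _ _ h))

theorem continuous_ofBody {Z : Type*} [TopologicalSpace Z] {a b : Z → E.states}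
    {t : Z → unitInterval} {e : ∀ z, t z ≠ 1 → E.paths} {ha : ∀ z h, E.src (e z h) = a z}
    {hb : ∀ z h, E.tgt (e z h) = b z} (hac : Continuous a) (hbc : Continuous b)
    (ht : Continuous t) (he : Continuous fun z : {z | t z ≠ 1} => e z.1 z.2) :
    Continuous fun z => ofBody (a z) (b z) (t z) (e z) (ha z) (hb z) := by
  refine continuous_iff.2 ⟨hac, hbc, ht, ?_⟩
  exact Apexed.continuous_of_isOpen (isOpen_ne_fun ht continuous_const) he
    (fun z => ofBody_body _ _ _ _ _ _ z.2) fun z hz => dif_pos (not_not.1 hz)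

theorem ext' {x y : ConePath E} (h₀ : x.src = y.src) (h₁ : x.tgt = y.tgt)
    (h : x.height = y.height) (hb : ∀ hx hy, x.getBody hx = y.getBody hy) : x = y := by
  refine ConePath.ext h₀ h₁ h ?_
  by_cases hx : x.height = 1
  · rw [x.body_eq_apex_iff.2 hx, y.body_eq_apex_iff.2 (h ▸ hx)]
  · rw [x.body_eq hx, y.body_eq (h ▸ hx), hb]

theorem _root_.unitInterval.max_ne_one {s t : unitInterval} (h : max s t ≠ 1) : s ≠ 1 ∧ t ≠ 1 :=
  ⟨fun hs => h (by rw [hs]; exact max_eq_left unitInterval.le_one'),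
    fun ht => h (by rw [ht]; exact max_eq_right unitInterval.le_one')⟩

/-- Concatenation in the cone. -/
noncomputable def concat (x y : ConePath E) (h : x.tgt = y.src) : ConePath E :=
  ofBody x.src y.tgt (max x.height y.height)
    (fun hm => E.concat (x.getBody (unitInterval.max_ne_one hm).1)
      (y.getBody (unitInterval.max_ne_one hm).2) (by rw [tgt_getBody, src_getBody, h]))
    (fun _ => by rw [E.src_concat, src_getBody]) (fun _ => by rw [E.tgt_concat, tgt_getBody])

theorem concat_getBody (x y : ConePath E) (h : x.tgt = y.src)
    (hm : (concat x y h).height ≠ 1) : (concat x y h).getBody hm =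
      E.concat (x.getBody (unitInterval.max_ne_one hm).1)
        (y.getBody (unitInterval.max_ne_one hm).2) (by rw [tgt_getBody, src_getBody, h]) :=
  ofBody_getBody x.src y.tgt (max x.height y.height) _ _ _ hm

/-- A path as a point of the base of the cone. -/
noncomputable def base (e : E.paths) : ConePath E :=
  ofBody (E.src e) (E.tgt e) 0 (fun _ => e) (fun _ => rfl) fun _ => rfl

theorem base_height (e : E.paths) : (base e).height ≠ 1 := zero_ne_one (α := unitInterval)

theorem base_getBody (e : E.paths) (h : (base e).height ≠ 1) : (base e).getBody h = e :=
  ofBody_getBody (E.src e) (E.tgt e) 0 (fun _ => e) (fun _ => rfl) (fun _ => rfl) h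

theorem base_injective : Function.Injective (base (E := E)) := fun e e' h => by
  have : (base e).body = (base e').body := by rw [h]
  rw [body_eq _ (base_height e), body_eq _ (base_height e'), base_getBody, base_getBody] at this
  exact Apexed.pt_injective this

theorem base_concat (x y : E.paths) (h : E.tgt x = E.src y) :
    base (E.concat x y h) = concat (base x) (base y) h := by
  refine ext' (E.src_concat _ _ _) (E.tgt_concat _ _ _) (max_self _).symm fun h₁ h₂ => ?_
  refine (base_getBody _ _).trans (Eq.trans ?_ (concat_getBody _ _ h h₂).symm)
  exact E.concat_congr (base_getBody _ _).symm (base_getBody _ _).symm _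

/-- Raising a point of the cone to a height at least `s`. -/
noncomputable def raise (s : unitInterval) (x : ConePath E) : ConePath E :=
  ofBody x.src x.tgt (max s x.height) (fun hm => x.getBody (unitInterval.max_ne_one hm).2)
    (fun _ => src_getBody _ _) (fun _ => tgt_getBody _ _)

theorem raise_getBody (s : unitInterval) (x : ConePath E) (hm : (raise s x).height ≠ 1) :
    (raise s x).getBody hm = x.getBody (unitInterval.max_ne_one hm).2 :=
  ofBody_getBody x.src x.tgt (max s x.height) _ _ _ hm

theorem continuous_raise : Continuous fun x : unitInterval × ConePath E => raise x.1 x.2 := by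
  have h := continuous_iff.1 (continuous_snd : Continuous (Prod.snd : unitInterval × ConePath E → _))
  refine continuous_ofBody h.1 h.2.1 (continuous_fst.max h.2.2.1) ?_
  exact continuous_getBody (f := fun z : {z : unitInterval × ConePath E |
    max z.1 z.2.height ≠ 1} => z.1.2) (by fun_prop) _

section Compact

variable {K : Type u} [TopologicalSpace K] [CompactSpace K] [T2Space K] {a b : K → ConePath E}

/-- Below the apex both bodies are genuine paths, defined on an open subset of a compact Hausdorff
space. That subset is locally compact, hence compactly generated, so concatenation in `E` is
continuous on it. -/
theorem continuous_concat (ha : Continuous a) (hb : Continuous b)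
    (h : ∀ k, (a k).tgt = (b k).src) : Continuous fun k => concat (a k) (b k) (h k) := by
  have ha' := continuous_iff.1 ha
  have hb' := continuous_iff.1 hb
  have ht := ha'.2.2.1.max hb'.2.2.1
  refine continuous_ofBody ha'.1 hb'.2.1 ht ?_
  have : LocallyCompactSpace {k : K | max (a k).height (b k).height ≠ 1} :=
    (isOpen_ne_fun ht continuous_const).locallyCompactSpace
  exact E.continuous_concat_of_compactlyGenerated
    (continuous_getBody (ha.comp continuous_subtype_val) _)
    (continuous_getBody (hb.comp continuous_subtype_val) _) _

/-- Points differ in an endpoint, in height, or in their bodies while both are below the apex. Each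
case is open; the last one uses weak Hausdorffness of the paths of `E` on a locally compact open
subset. -/
theorem isClosed_eq (ha : Continuous a) (hb : Continuous b) : IsClosed {k | a k = b k} := by
  have ha' := continuous_iff.1 ha
  have hb' := continuous_iff.1 hb
  let U : Set K := {k | (a k).height ≠ 1} ∩ {k | (b k).height ≠ 1}
  have hU : IsOpen U := (isOpen_ne_fun ha'.2.2.1 continuous_const).inter
    (isOpen_ne_fun hb'.2.2.1 continuous_const)
  have : LocallyCompactSpace U := hU.locallyCompactSpace
  have hc : IsClosed {k : U | (a k).getBody k.2.1 = (b k).getBody k.2.2} :=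
    WeakHausdorffSpace.isClosed_eq_of_compactlyGenerated
      (continuous_getBody (ha.comp continuous_subtype_val) _)
      (continuous_getBody (hb.comp continuous_subtype_val) _)
  have ho := hU.isOpenMap_subtype_val _ hc.isOpen_compl
  have h₁ : IsOpen {k | (a k).src ≠ (b k).src} := isOpen_ne_fun ha'.1 hb'.1
  have h₂ : IsOpen {k | (a k).tgt ≠ (b k).tgt} := isOpen_ne_fun ha'.2.1 hb'.2.1
  have h₃ : IsOpen {k | (a k).height ≠ (b k).height} := isOpen_ne_fun ha'.2.2.1 hb'.2.2.1
  rw [← isOpen_compl_iff]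
  suffices he : {k | (a k).src ≠ (b k).src} ∪ {k | (a k).tgt ≠ (b k).tgt} ∪
      ({k | (a k).height ≠ (b k).height} ∪ Subtype.val '' {k : U | (a k).getBody k.2.1 =
        (b k).getBody k.2.2}ᶜ) = {k | a k = b k}ᶜ by
    rw [← he]
    exact (h₁.union h₂).union (h₃.union ho)
  ext k
  constructor
  · rintro ((hk | hk) | (hk | ⟨k, hk, rfl⟩)) (hab : a _ = b _)
    · exact hk (congrArg ConePath.src hab)
    · exact hk (congrArg ConePath.tgt hab)
    · exact hk (congrArg ConePath.height hab)
    · refine hk (Apexed.pt_injective ?_)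
      rw [← body_eq, ← body_eq, hab]
  · intro hk
    by_contra hn
    simp only [Set.mem_union, not_or] at hn
    refine hk (ext' (not_not.1 hn.1.1) (not_not.1 hn.1.2) (not_not.1 hn.2.1) fun hx hy => ?_)
    by_contra hne
    exact hn.2.2 ⟨⟨k, hx, hy⟩, hne, rfl⟩

end Compact

end ConePath

variable (E)

/-- The cone on a flow, before Kelleyfication. The apices are absorbing. -/
noncomputable def conePreFlow : PreFlow.{u} where
  states := E.states
  paths := ConePath E
  src := ConePath.src
  tgt := ConePath.tgt
  locallyConstant_src := (IsLocallyConstant.iff_continuous _).2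
    (ConePath.continuous_iff.1 continuous_id).1
  locallyConstant_tgt := (IsLocallyConstant.iff_continuous _).2
    (ConePath.continuous_iff.1 continuous_id).2.1
  concat := ConePath.concat
  continuous_concat _ a b h :=
    ConePath.continuous_concat (map_continuous a) (map_continuous b) h
  kHausdorff _ a b := ConePath.isClosed_eq (map_continuous a) (map_continuous b)
  src_concat _ _ _ := rfl
  tgt_concat _ _ _ := rfl
  concat_assoc x y z hxy hyz := by
    refine ConePath.ext' rfl rfl (max_assoc _ _ _) fun h₁ h₂ => ?_
    refine (ConePath.concat_getBody _ _ _ h₁).trans ?_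
    refine Eq.trans ?_ (ConePath.concat_getBody _ _ _ h₂).symm
    refine (E.concat_congr (ConePath.concat_getBody _ _ _ _) rfl _).trans ?_
    refine (E.concat_assoc _ _ _ _ (by rw [ConePath.tgt_getBody, ConePath.src_getBody, hyz])).trans ?_
    exact E.concat_congr rfl (ConePath.concat_getBody _ _ _ _).symm _

/-- The cone on a flow. -/
noncomputable abbrev cone : DirectedFlow.{u} := (conePreFlow E).toFlow

/-- The inclusion of the base of the cone. -/
noncomputable def coneBase : E ⟶ cone E where
  onStates := id
  onPaths := ⟨fun e => Kify.of (ConePath.base e), by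
    exact Kify.continuous_of_comp (ConePath.continuous_ofBody E.continuous_src E.continuous_tgt
      continuous_const continuous_subtype_val)⟩
  src_onPaths _ := rfl
  tgt_onPaths _ := rfl
  map_concat x y h := Kify.ext (ConePath.base_concat x y h)

/-- The base is the closed set of height `0`, and `getBody` is a continuous inverse on it. -/
theorem isClosedEmbedding_coneBase : IsClosedEmbedding (coneBase E).onPaths := by
  have h01 : (0 : unitInterval) ≠ 1 := zero_ne_one
  refine IsClosedEmbedding.of_continuous_injective_isClosedMap (map_continuous _)
    (fun e e' h => ConePath.base_injective (congrArg Kify.val h)) fun C hC => ?_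
  · let Z : Set (cone E).paths := {x | ConePath.height x.val = 0}
    have hZ : IsClosed Z := isClosed_eq
      (ConePath.continuous_height.comp Kify.continuous_val) continuous_const
    have hz : ∀ z : Z, ConePath.height z.1.val ≠ 1 := fun z => by
      have h : ConePath.height z.1.val = 0 := z.2
      rw [h]
      exact h01
    have hg : Continuous fun z : Z => ConePath.getBody z.1.val (hz z) :=
      ConePath.continuous_getBody (Kify.continuous_val.comp continuous_subtype_val) _
    convert! hZ.isClosedMap_subtype_val _ (hC.preimage hg)
    ext x
    constructor
    · rintro ⟨e, he, rfl⟩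
      exact ⟨⟨_, rfl⟩, by
        rwa [← ConePath.base_getBody e (ConePath.base_height e)] at he, rfl⟩
    · rintro ⟨z, hz', rfl⟩
      refine ⟨_, hz', Kify.ext (ConePath.ext' ?_ ?_ z.2.symm fun h₁ h₂ => ?_)⟩
      · exact ConePath.src_getBody _ _
      · exact ConePath.tgt_getBody _ _
      · exact ConePath.base_getBody _ _

/-- The disk is connected, so the endpoints are constant. Going inward along each ray the sphere
data is raised until it meets the apex at radius `1/2`, and the inner disk is sent to that apex. In
dimension `0` this just picks the apex. -/
theorem isTrivialFibration_cone :
    IsTrivialFibration (toCodiscrete (X := cone E) (S := E.states) id) := by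
  refine ⟨Function.bijective_id, fun n f g hf hg hfg => ?_⟩
  set V := EuclideanSpace ℝ (Fin n)
  let φ : Disk.bdry V → ConePath E := fun y => (f y).val
  have hφ : Continuous φ := Kify.continuous_val.comp hf
  let ψ : Disk V → E.states × E.states := g
  have hψ : Continuous ψ := hg
  have hφψ : ∀ y : Disk.bdry V, ((φ y).src, (φ y).tgt) = ψ y := hfg
  have hconst : ∀ y y', ψ y = ψ y' := fun y y' => PreconnectedSpace.constant inferInstance hψ
  let P : Set (Disk V) := {y | ‖(y : V)‖ ≤ 1 / 2}
  let Q : Set (Disk V) := {y | 1 / 2 ≤ ‖(y : V)‖}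
  have hP : IsClosed P := isClosed_le (by fun_prop) continuous_const
  have hQ : IsClosed Q := isClosed_le continuous_const (by fun_prop)
  let s : Disk V → unitInterval := fun y => Set.projIcc 0 1 zero_le_one (2 - 2 * ‖(y : V)‖)
  have hs : Continuous s := continuous_projIcc.comp (by fun_prop)
  let a : P → ConePath E := fun y => ConePath.ofBody (ψ y).1 (ψ y).2 1 (fun h => absurd rfl h)
    (fun h => absurd rfl h) (fun h => absurd rfl h)
  have ha : Continuous a := by
    refine ConePath.continuous_ofBody (by fun_prop) (by fun_prop) continuous_const ?_
    exact continuous_of_const fun y => absurd rfl y.2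
  let b : Q → ConePath E := fun y => ConePath.raise (s y)
    (φ ⟨Disk.expand y, Disk.norm_expand_of_ge y.2⟩)
  have hb : Continuous b := ConePath.continuous_raise.comp ((hs.comp continuous_subtype_val).prodMk
    (hφ.comp ((Disk.continuous_expand.comp continuous_subtype_val).subtype_mk _)))
  obtain ⟨l, hl, hl₁, hl₂⟩ := exists_continuous_glue hP hQ
    (fun y => le_total ‖(y : V)‖ (1 / 2)) ha hb (fun y hy hy' => by
      have hy₁ : ‖(y : V)‖ = 1 / 2 := le_antisymm hy hy'
      have hs₁ : s y = 1 := by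
        simp only [s, hy₁]
        norm_num
      have hψ' := (hconst y (Disk.expand y)).trans
        (hφψ ⟨Disk.expand y, Disk.norm_expand_of_ge hy'⟩).symm
      refine ConePath.ext' (congrArg Prod.fst hψ') (congrArg Prod.snd hψ') ?_
        fun h => absurd rfl h
      change 1 = max (s y) _
      rw [hs₁]
      exact (max_eq_left unitInterval.le_one').symm)
  have hl' := Kify.continuous_of_comp_of_compact hl
  refine ⟨_, hl', fun y => Kify.ext ?_, fun y => ?_⟩
  · have hy : ‖(y.1 : V)‖ = 1 := y.2
    have hyQ : y.1 ∈ Q := by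
      change 1 / 2 ≤ ‖(y.1 : V)‖
      rw [hy]; norm_num
    have he : (⟨Disk.expand y, Disk.norm_expand_of_ge hyQ⟩ : Disk.bdry V) = y :=
      Subtype.ext (Disk.expand_of_bdry y.2)
    have hs₀ : s y = 0 := by
      simp only [s, hy]
      norm_num
    change l y = φ y
    refine (hl₂ ⟨y, hyQ⟩).trans ?_
    simp only [b]
    rw [he, hs₀]
    refine ConePath.ext' rfl rfl (max_eq_right unitInterval.nonneg') fun h₁ h₂ => ?_
    exact ConePath.raise_getBody _ _ h₁
  · change ((l y).src, (l y).tgt) = ψ y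
    rcases le_total ‖(y : V)‖ (1 / 2) with hy | hy
    · rw [hl₁ ⟨y, hy⟩]
      rfl
    · rw [hl₂ ⟨y, hy⟩]
      exact (hφψ ⟨Disk.expand y, Disk.norm_expand_of_ge hy⟩).trans (hconst _ _)

end DirectedFlow

namespace DirectedFlow

/-! ### Two copies of a flow with common states -/

/-- The presentation of the flow made of two copies of `X` with the same states. -/
def doublePresentation (X : DirectedFlow.{u}) : Presentation.{u} where
  states := X.states
  gens := X.paths ⊕ X.paths
  src := Sum.elim X.src X.src
  tgt := Sum.elim X.tgt X.tgt
  locallyConstant_src := (IsLocallyConstant.iff_continuous _).2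
    (X.continuous_src.sumElim X.continuous_src)
  locallyConstant_tgt := (IsLocallyConstant.iff_continuous _).2
    (X.continuous_tgt.sumElim X.continuous_tgt)
  mulRel a b c := ∃ x y h, a = .inl x ∧ b = .inl y ∧ c = .inl (X.concat x y h) ∨
    a = .inr x ∧ b = .inr y ∧ c = .inr (X.concat x y h)
  eqRel _ _ := False
  mulRel_tgt_eq_src := by
    rintro _ _ _ ⟨x, y, h, ⟨rfl, rfl, rfl⟩ | ⟨rfl, rfl, rfl⟩⟩ <;> exact h
  mulRel_src := by
    rintro _ _ _ ⟨x, y, h, ⟨rfl, rfl, rfl⟩ | ⟨rfl, rfl, rfl⟩⟩ <;> exact X.src_concat x y h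
  mulRel_tgt := by
    rintro _ _ _ ⟨x, y, h, ⟨rfl, rfl, rfl⟩ | ⟨rfl, rfl, rfl⟩⟩ <;> exact X.tgt_concat x y h
  eqRel_src := False.elim
  eqRel_tgt := False.elim

/-- Two copies of `X` with the same states. -/
noncomputable abbrev double (X : DirectedFlow.{u}) : DirectedFlow.{u} := X.doublePresentation.flow

variable (X : DirectedFlow.{u})

/-- The first copy. -/
noncomputable def doubleInl : X ⟶ double X where
  onStates := id
  onPaths := ⟨fun x => X.doublePresentation.gen (.inl x),
    (map_continuous X.doublePresentation.gen).comp continuous_inl⟩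
  src_onPaths _ := rfl
  tgt_onPaths _ := rfl
  map_concat x y h := Presentation.gen_mul (P := X.doublePresentation)
    ⟨x, y, h, .inl ⟨rfl, rfl, rfl⟩⟩ h

/-- The second copy. -/
noncomputable def doubleInr : X ⟶ double X where
  onStates := id
  onPaths := ⟨fun x => X.doublePresentation.gen (.inr x),
    (map_continuous X.doublePresentation.gen).comp continuous_inr⟩
  src_onPaths _ := rfl
  tgt_onPaths _ := rfl
  map_concat x y h := Presentation.gen_mul (P := X.doublePresentation)
    ⟨x, y, h, .inr ⟨rfl, rfl, rfl⟩⟩ h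

variable {X}

/-- The model given by two morphisms that agree on states. -/
def doubleModel {U : DirectedFlow.{u}} (f₀ f₁ : X ⟶ U)
    (h : ∀ a, f₀.onStates a = f₁.onStates a) : X.doublePresentation.Model where
  flow := U
  onStates := f₀.onStates
  onGens := ⟨Sum.elim f₀.onPaths f₁.onPaths,
    (map_continuous f₀.onPaths).sumElim (map_continuous f₁.onPaths)⟩
  src_onGens := by
    rintro (x | x)
    · exact f₀.src_onPaths x
    · exact (f₁.src_onPaths x).trans (h _).symm
  tgt_onGens := by
    rintro (x | x)
    · exact f₀.tgt_onPaths x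
    · exact (f₁.tgt_onPaths x).trans (h _).symm
  onGens_mul := by
    rintro _ _ _ ⟨x, y, h, ⟨rfl, rfl, rfl⟩ | ⟨rfl, rfl, rfl⟩⟩ h'
    · exact f₀.map_concat x y h
    · exact f₁.map_concat x y h
  onGens_eq := False.elim

/-- The morphism out of the double given by two morphisms that agree on states. -/
noncomputable def doubleDesc {U : DirectedFlow.{u}} (f₀ f₁ : X ⟶ U)
    (h : ∀ a, f₀.onStates a = f₁.onStates a) : double X ⟶ U :=
  Presentation.desc (doubleModel f₀ f₁ h)

theorem doubleInl_desc {U : DirectedFlow.{u}} (f₀ f₁ : X ⟶ U)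
    (h : ∀ a, f₀.onStates a = f₁.onStates a) : doubleInl X ≫ doubleDesc f₀ f₁ h = f₀ := rfl

theorem doubleInr_desc {U : DirectedFlow.{u}} (f₀ f₁ : X ⟶ U)
    (h : ∀ a, f₀.onStates a = f₁.onStates a) : doubleInr X ≫ doubleDesc f₀ f₁ h = f₁ :=
  hom_ext h fun _ => rfl

theorem double_hom_ext {U : DirectedFlow.{u}} {f g : double X ⟶ U}
    (h₀ : doubleInl X ≫ f = doubleInl X ≫ g) (h₁ : doubleInr X ≫ f = doubleInr X ≫ g) :
    f = g := by
  refine Presentation.flow_hom_ext (onStates_congr h₀) ?_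
  rintro (x | x)
  · exact onPaths_congr h₀ x
  · exact onPaths_congr h₁ x

/-- Two morphisms with compatible images under `q` agree on states because `q` is injective there.
This is why the states of the two copies may be identified from the start, leaving only globes to
attach. -/
theorem double_exists_lift {U V : DirectedFlow.{u}} {q : U ⟶ V} (hq : IsTrivialFibration q)
    {f₀ f₁ : X ⟶ U} {g : double X ⟶ V} (h₀ : f₀ ≫ q = doubleInl X ≫ g)
    (h₁ : f₁ ≫ q = doubleInr X ≫ g) :
    ∃ l : double X ⟶ U, doubleInl X ≫ l = f₀ ∧ doubleInr X ≫ l = f₁ ∧ l ≫ q = g := by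
  have h : ∀ a, f₀.onStates a = f₁.onStates a := fun a =>
    hq.1.1 ((onStates_congr h₀ a).trans (onStates_congr h₁ a).symm)
  refine ⟨doubleDesc f₀ f₁ h, doubleInl_desc _ _ h, doubleInr_desc _ _ h, double_hom_ext ?_ ?_⟩
  · rw [← Category.assoc, doubleInl_desc, h₀]
  · rw [← Category.assoc, doubleInr_desc, h₁]

/-! ### Attaching cells -/

variable {E B : DirectedFlow.{u}} (p : E ⟶ B)

/-- A lifting problem of a disk along a morphism of flows. -/
structure Cell : Type u where
  /-- the dimension -/
  dim : ℕ
  /-- the attaching map -/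
  attach : C(Disk.bdry (EuclideanSpace ℝ (Fin dim)), E.paths)
  /-- the disk in the base -/
  base : C(Disk (EuclideanSpace ℝ (Fin dim)), B.paths)
  comm : ∀ y, p.onPaths (attach y) = base y

variable {p} (hp : Function.Bijective p.onStates)

/-- The presentation of the flow obtained by attaching all cells. -/
noncomputable def attachPresentation : Presentation.{u} where
  states := E.states
  gens := E.paths ⊕ Σ c : Cell p, ULift.{u} (Disk (EuclideanSpace ℝ (Fin c.dim)))
  -- Points of an attached disk have endpoints only in `B`; the bijection on states brings them back
  -- to `E`.
  src := Sum.elim E.src fun y => (Equiv.ofBijective _ hp).symm (B.src (y.1.base y.2.down))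
  tgt := Sum.elim E.tgt fun y => (Equiv.ofBijective _ hp).symm (B.tgt (y.1.base y.2.down))
  locallyConstant_src := (IsLocallyConstant.iff_continuous _).2
    (E.continuous_src.sumElim (continuous_of_discreteTopology.comp (B.continuous_src.comp
      (continuous_sigma fun c => (map_continuous c.base).comp continuous_uliftDown))))
  locallyConstant_tgt := (IsLocallyConstant.iff_continuous _).2
    (E.continuous_tgt.sumElim (continuous_of_discreteTopology.comp (B.continuous_tgt.comp
      (continuous_sigma fun c => (map_continuous c.base).comp continuous_uliftDown))))
  mulRel a b c := ∃ x y h, a = .inl x ∧ b = .inl y ∧ c = .inl (E.concat x y h)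
  eqRel a b := ∃ (c : Cell p) (y : Disk.bdry (EuclideanSpace ℝ (Fin c.dim))),
    a = .inl (c.attach y) ∧ b = .inr ⟨c, ⟨y.1⟩⟩
  mulRel_tgt_eq_src := by
    rintro _ _ _ ⟨x, y, h, rfl, rfl, rfl⟩
    exact h
  mulRel_src := by
    rintro _ _ _ ⟨x, y, h, rfl, rfl, rfl⟩
    exact E.src_concat x y h
  mulRel_tgt := by
    rintro _ _ _ ⟨x, y, h, rfl, rfl, rfl⟩
    exact E.tgt_concat x y h
  eqRel_src := by
    rintro _ _ ⟨c, y, rfl, rfl⟩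
    refine (Equiv.eq_symm_apply _).2 ?_
    exact (p.src_onPaths _).symm.trans (congrArg B.src (c.comm y))
  eqRel_tgt := by
    rintro _ _ ⟨c, y, rfl, rfl⟩
    refine (Equiv.eq_symm_apply _).2 ?_
    exact (p.tgt_onPaths _).symm.trans (congrArg B.tgt (c.comm y))

/-- The flow obtained by attaching all cells. -/
noncomputable abbrev attached : DirectedFlow.{u} := (attachPresentation hp).flow

/-- The inclusion in the flow obtained by attaching all cells. -/
noncomputable def attachInl : E ⟶ attached hp where
  onStates := id
  onPaths := ⟨fun x => (attachPresentation hp).gen (.inl x),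
    (map_continuous (attachPresentation hp).gen).comp continuous_inl⟩
  src_onPaths _ := rfl
  tgt_onPaths _ := rfl
  map_concat x y h := Presentation.gen_mul (P := attachPresentation hp)
    ⟨x, y, h, rfl, rfl, rfl⟩ h

/-- The attached disks. -/
noncomputable def attachCell (c : Cell p) :
    C(Disk (EuclideanSpace ℝ (Fin c.dim)), (attached hp).paths) where
  toFun y := (attachPresentation hp).gen (.inr ⟨c, ⟨y⟩⟩)
  continuous_toFun := (map_continuous (attachPresentation hp).gen).comp
    (continuous_inr.comp (continuous_sigmaMk.comp continuous_uliftUp))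

theorem attachCell_bdry (c : Cell p) (y : Disk.bdry (EuclideanSpace ℝ (Fin c.dim))) :
    attachCell hp c y = (attachInl hp).onPaths (c.attach y) :=
  (Presentation.gen_eq (P := attachPresentation hp) ⟨c, y, rfl, rfl⟩).symm

theorem src_attachCell (c : Cell p) (y : Disk (EuclideanSpace ℝ (Fin c.dim))) :
    p.onStates ((attached hp).src (attachCell hp c y)) = B.src (c.base y) :=
  (Equiv.ofBijective _ hp).apply_symm_apply _

theorem tgt_attachCell (c : Cell p) (y : Disk (EuclideanSpace ℝ (Fin c.dim))) :
    p.onStates ((attached hp).tgt (attachCell hp c y)) = B.tgt (c.base y) :=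
  (Equiv.ofBijective _ hp).apply_symm_apply _

variable {hp} in
theorem attached_hom_ext {U : DirectedFlow.{u}} {f g : attached hp ⟶ U}
    (h : attachInl hp ≫ f = attachInl hp ≫ g)
    (hc : ∀ c y, f.onPaths (attachCell hp c y) = g.onPaths (attachCell hp c y)) : f = g := by
  refine Presentation.flow_hom_ext (onStates_congr h) ?_
  rintro (x | ⟨c, ⟨y⟩⟩)
  · exact onPaths_congr h x
  · exact hc c y

theorem attached_exists_desc {U : DirectedFlow.{u}} (f : E ⟶ U)
    (d : ∀ c : Cell p, C(Disk (EuclideanSpace ℝ (Fin c.dim)), U.paths))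
    (hs : ∀ c y, U.src (d c y) = f.onStates ((attached hp).src (attachCell hp c y)))
    (ht : ∀ c y, U.tgt (d c y) = f.onStates ((attached hp).tgt (attachCell hp c y)))
    (hd : ∀ c (y : Disk.bdry (EuclideanSpace ℝ (Fin c.dim))),
      d c y = f.onPaths (c.attach y)) :
    ∃ g : attached hp ⟶ U, attachInl hp ≫ g = f ∧
      ∀ c y, g.onPaths (attachCell hp c y) = d c y := by
  let M : (attachPresentation hp).Model :=
    { flow := U
      onStates := f.onStates
      onGens := ⟨Sum.elim f.onPaths fun y => d y.1 y.2.down,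
        (map_continuous f.onPaths).sumElim
          (continuous_sigma fun c => (map_continuous (d c)).comp continuous_uliftDown)⟩
      src_onGens := by
        rintro (x | ⟨c, ⟨y⟩⟩)
        · exact f.src_onPaths x
        · exact hs c y
      tgt_onGens := by
        rintro (x | ⟨c, ⟨y⟩⟩)
        · exact f.tgt_onPaths x
        · exact ht c y
      onGens_mul := by
        rintro _ _ _ ⟨x, y, h, rfl, rfl, rfl⟩ h'
        exact f.map_concat x y h
      onGens_eq := by
        rintro _ _ ⟨c, y, rfl, rfl⟩
        exact (hd c y).symm }
  exact ⟨Presentation.desc M, rfl, fun _ _ => rfl⟩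

theorem exists_attachDesc : ∃ g : attached hp ⟶ B, attachInl hp ≫ g = p ∧
    ∀ c y, g.onPaths (attachCell hp c y) = c.base y :=
  attached_exists_desc hp p (fun c => c.base) (fun c y => (src_attachCell hp c y).symm)
    (fun c y => (tgt_attachCell hp c y).symm) fun c y => (c.comm y).symm

/-- The extension of `p` to the attached cells. -/
noncomputable def attachDesc : attached hp ⟶ B := Classical.choose (exists_attachDesc hp)

theorem attachInl_desc : attachInl hp ≫ attachDesc hp = p :=
  (Classical.choose_spec (exists_attachDesc hp)).1

theorem attachDesc_cell (c : Cell p) (y) :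
    (attachDesc hp).onPaths (attachCell hp c y) = c.base y :=
  (Classical.choose_spec (exists_attachDesc hp)).2 c y

theorem attachDesc_bijective : Function.Bijective (attachDesc hp).onStates := by
  have : (attachDesc hp).onStates = p.onStates :=
    funext fun a => onStates_congr (attachInl_desc hp) a
  rw [this]
  exact hp

-- Each cell is lifted separately by the disk lifting property of `q`. The endpoints of the lifts
-- are forced, since `q` is injective on states.
variable {hp} in
theorem attached_exists_lift {U V : DirectedFlow.{u}} {q : U ⟶ V} (hq : IsTrivialFibration q)
    {f : E ⟶ U} {g : attached hp ⟶ V} (h : f ≫ q = attachInl hp ≫ g) :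
    ∃ l : attached hp ⟶ U, attachInl hp ≫ l = f ∧ l ≫ q = g := by
  have hd : ∀ c : Cell p, ∃ d : C(Disk (EuclideanSpace ℝ (Fin c.dim)), U.paths),
      (∀ y : Disk.bdry (EuclideanSpace ℝ (Fin c.dim)), d y = f.onPaths (c.attach y)) ∧
      ∀ y, q.onPaths (d y) = g.onPaths (attachCell hp c y) := fun c => by
    obtain ⟨l, hl, hl₁, hl₂⟩ := hq.2 c.dim (fun y => f.onPaths (c.attach y))
      (fun y => g.onPaths (attachCell hp c y)) (by fun_prop) (by fun_prop) fun y => by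
        rw [attachCell_bdry]
        exact onPaths_congr h _
    exact ⟨⟨l, hl⟩, hl₁, hl₂⟩
  choose d hd₁ hd₂ using hd
  obtain ⟨l, hl, hlc⟩ := attached_exists_desc hp f d
    (fun c y => hq.1.1 (by
      rw [← q.src_onPaths, hd₂, g.src_onPaths]
      exact (onStates_congr h _).symm))
    (fun c y => hq.1.1 (by
      rw [← q.tgt_onPaths, hd₂, g.tgt_onPaths]
      exact (onStates_congr h _).symm)) hd₁
  refine ⟨l, hl, attached_hom_ext ?_ fun c y => ?_⟩
  · rw [← Category.assoc, hl, h]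
  · rw [comp_onPaths, hlc, hd₂]

/-- The base inclusion of the cone on `E` extends over the cells, because the cone is trivially
fibred over the codiscrete flow. So `attachInl` is the first factor of a closed embedding. -/
theorem isClosedEmbedding_attachInl : IsClosedEmbedding (attachInl hp).onPaths := by
  obtain ⟨l, hl, -⟩ := attached_exists_lift (hp := hp) (isTrivialFibration_cone E)
    (f := coneBase E) (g := toCodiscrete (X := attached hp) (S := E.states) id) rfl
  refine isClosedEmbedding_of_comp (m := l.onPaths) (map_continuous _) (map_continuous _) ?_
  have : (l.onPaths ∘ (attachInl hp).onPaths : E.paths → _) = (coneBase E).onPaths :=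
    funext (onPaths_congr hl)
  rw [this]
  exact isClosedEmbedding_coneBase E

end DirectedFlow

/-! ### Sequential colimits of closed embeddings -/

namespace DirectLimit

variable {A : ℕ → Type u} [∀ n, TopologicalSpace (A n)] {f : ∀ m n, m ≤ n → C(A m, A n)}
  [DirectedSystem A (f · · ·)]

theorem continuous_mk (n : ℕ) : Continuous fun x : A n => (⟦⟨n, x⟩⟧ : DirectLimit A f) :=
  continuous_quotient_mk'.comp continuous_sigmaMk

theorem continuous_iff {Z : Type*} [TopologicalSpace Z] {g : DirectLimit A f → Z} :
    Continuous g ↔ ∀ n, Continuous fun x : A n => g ⟦⟨n, x⟩⟧ :=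
  isQuotientMap_quotient_mk'.continuous_iff.trans continuous_sigma_iff

theorem isClosed_iff {s : Set (DirectLimit A f)} :
    IsClosed s ↔ ∀ n, IsClosed {x : A n | (⟦⟨n, x⟩⟧ : DirectLimit A f) ∈ s} :=
  isQuotientMap_quotient_mk'.isClosed_preimage.symm.trans isClosed_sigma_iff

theorem mk_eq_mk_iff (hf : ∀ m n h, IsClosedEmbedding (f m n h)) {m n : ℕ} (h : m ≤ n) {x : A m}
    {y : A n} : (⟦⟨m, x⟩⟧ : DirectLimit A f) = ⟦⟨n, y⟩⟧ ↔ f m n h x = y := by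
  rw [← mk_apply m n x h]
  exact (mk_injective f (fun m n h => (hf m n h).injective) n).eq_iff

theorem isClosedEmbedding_mk (hf : ∀ m n h, IsClosedEmbedding (f m n h)) (n : ℕ) :
    IsClosedEmbedding fun x : A n => (⟦⟨n, x⟩⟧ : DirectLimit A f) := by
  refine IsClosedEmbedding.of_continuous_injective_isClosedMap (continuous_mk n)
    (mk_injective f (fun m n h => (hf m n h).injective) n) fun s hs => ?_
  refine isClosed_iff.2 fun m => ?_
  rcases le_total m n with h | h
  · have : {x : A m | (⟦⟨m, x⟩⟧ : DirectLimit A f) ∈ (fun x : A n => ⟦⟨n, x⟩⟧) '' s} =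
        f m n h ⁻¹' s := by
      ext x
      constructor
      · rintro ⟨y, hy, hxy⟩
        rwa [Set.mem_preimage, (mk_eq_mk_iff hf h).1 hxy.symm]
      · exact fun hx => ⟨_, hx, mk_apply m n x h⟩
    rw [this]
    exact hs.preimage (map_continuous _)
  · have : {x : A m | (⟦⟨m, x⟩⟧ : DirectLimit A f) ∈ (fun x : A n => ⟦⟨n, x⟩⟧) '' s} =
        f n m h '' s := by
      ext x
      constructor
      · rintro ⟨y, hy, hxy⟩
        exact ⟨y, hy, (mk_eq_mk_iff hf h).1 hxy⟩
      · rintro ⟨y, hy, rfl⟩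
        exact ⟨y, hy, (mk_apply n m y h).symm⟩
    rw [this]
    exact (hf n m h).isClosedMap s hs

/-- Otherwise choose `k n` with `g (k n)` outside stage `n`. A stage meets only finitely many of
these values, so the tails `C n` are closed; by compactness their preimages have a common point,
whose image lies in some stage `n` and yet equals `g (k m)` with `m ≥ n`. -/
theorem exists_factor [∀ n, T1Space (A n)] (hf : ∀ m n h, IsClosedEmbedding (f m n h))
    {K : Type*} [TopologicalSpace K] [CompactSpace K] {g : K → DirectLimit A f}
    (hg : Continuous g) :
    ∃ n, ∃ g' : K → A n, Continuous g' ∧ ∀ k, g k = ⟦⟨n, g' k⟩⟧ := by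
  suffices h : ∃ n, ∀ k, ∃ x : A n, g k = ⟦⟨n, x⟩⟧ by
    obtain ⟨n, h⟩ := h
    choose g' hg' using h
    exact ⟨n, g', (isClosedEmbedding_mk hf n).isInducing.continuous_iff.2 (hg.congr hg'), hg'⟩
  by_contra! h
  choose k hk using h
  let C : ℕ → Set (DirectLimit A f) := fun n => {x | ∃ m, n ≤ m ∧ x = g (k m)}
  have hC : ∀ n, IsClosed (C n) := fun n => by
    -- Only indices `m < l` can contribute to stage `l`, since stage `l` is contained in stage `m`
    -- when `l ≤ m`.
    refine isClosed_iff.2 fun l => Set.Finite.isClosed ?_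
    refine Set.Finite.of_finite_image (f := fun x : A l => (⟦⟨l, x⟩⟧ : DirectLimit A f)) ?_
      (mk_injective f (fun m n h => (hf m n h).injective) l).injOn
    refine ((Set.finite_lt_nat l).image fun m => g (k m)).subset ?_
    rintro _ ⟨x, ⟨m, -, hm⟩, rfl⟩
    refine ⟨m, ?_, hm.symm⟩
    by_contra hlm
    refine hk m (f l m (not_lt.1 hlm) x) (hm.symm.trans ?_)
    exact (mk_apply l m x _).symm
  obtain ⟨x, hx⟩ := IsCompact.nonempty_iInter_of_sequence_nonempty_isCompact_isClosed
    (fun n => g ⁻¹' C n) (fun n y ⟨m, hm, hy⟩ => ⟨m, (Nat.le_succ n).trans hm, hy⟩)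
    (fun n => ⟨k n, n, le_rfl, rfl⟩) ((hC 0).preimage hg).isCompact fun n => (hC n).preimage hg
  obtain ⟨n, y, hy⟩ := exists_eq_mk f (g x)
  obtain ⟨m, hm, hxm⟩ := Set.mem_iInter.1 hx n
  refine hk m (f n m hm y) (hxm.symm.trans (hy.trans ?_))
  exact (mk_apply n m y _).symm

theorem exists_factor₂ [∀ n, T1Space (A n)] (hf : ∀ m n h, IsClosedEmbedding (f m n h))
    {K : Type*} [TopologicalSpace K] [CompactSpace K] {g₁ g₂ : K → DirectLimit A f}
    (hg₁ : Continuous g₁) (hg₂ : Continuous g₂) :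
    ∃ n, ∃ g₁' g₂' : K → A n, Continuous g₁' ∧ Continuous g₂' ∧ (∀ k, g₁ k = ⟦⟨n, g₁' k⟩⟧) ∧
      ∀ k, g₂ k = ⟦⟨n, g₂' k⟩⟧ := by
  obtain ⟨m, a, ha, hga⟩ := exists_factor hf hg₁
  obtain ⟨n, b, hb, hgb⟩ := exists_factor hf hg₂
  refine ⟨max m n, fun k => f _ _ (le_max_left _ _) (a k), fun k => f _ _ (le_max_right _ _) (b k),
    by fun_prop, by fun_prop, fun k => ?_, fun k => ?_⟩
  · rw [hga, mk_apply]
  · rw [hgb, mk_apply]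

end DirectLimit

/-! ### Towers of flows and their colimits -/

namespace DirectedFlow

instance (X : DirectedFlow.{u}) : T1Space X.paths := ⟨WeakHausdorffSpace.isClosed_singleton⟩

/-- A sequence of flows over `X` with the states of `X`, with closed embeddings as transition
maps. -/
structure Tower (X : DirectedFlow.{u}) : Type (u + 1) where
  /-- the stages -/
  stage : ℕ → DirectedFlow.{u}
  /-- the projections -/
  proj n : stage n ⟶ X
  /-- the transition maps -/
  incl n : stage n ⟶ stage (n + 1)
  incl_proj n : incl n ≫ proj (n + 1) = proj n
  bijective_proj n : Function.Bijective (proj n).onStates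
  isClosedEmbedding_incl n : IsClosedEmbedding (incl n).onPaths

namespace Tower

variable {X : DirectedFlow.{u}} (T : Tower X)

/-- The transition maps between all stages. -/
def trans {m n : ℕ} (h : m ≤ n) : T.stage m ⟶ T.stage n :=
  (Functor.ofSequence T.incl).map (homOfLE h)

theorem trans_self (n : ℕ) : T.trans (le_refl n) = 𝟙 _ := (Functor.ofSequence T.incl).map_id n

theorem trans_trans {l m n : ℕ} (h : l ≤ m) (h' : m ≤ n) :
    T.trans h ≫ T.trans h' = T.trans (h.trans h') :=
  ((Functor.ofSequence T.incl).map_comp (homOfLE h) (homOfLE h')).symm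

theorem trans_succ (n : ℕ) : T.trans n.le_succ = T.incl n :=
  Functor.ofSequence_map_homOfLE_succ T.incl n

theorem trans_induction {motive : ∀ {m n}, (T.stage m ⟶ T.stage n) → Prop}
    (h₀ : ∀ n, motive (𝟙 (T.stage n)))
    (h₁ : ∀ {m n} (f : T.stage m ⟶ T.stage n), motive f → motive (f ≫ T.incl n))
    {m n : ℕ} (h : m ≤ n) : motive (T.trans h) := by
  induction n, h using Nat.le_induction with
  | base => rw [trans_self]; exact h₀ m
  | succ n h ih =>
    rw [← T.trans_trans h n.le_succ, trans_succ]
    exact h₁ _ ih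

theorem trans_proj {m n : ℕ} (h : m ≤ n) : T.trans h ≫ T.proj n = T.proj m := by
  refine T.trans_induction (motive := fun {m n} f => f ≫ T.proj n = T.proj m)
    (fun n => Category.id_comp _) (fun f hf => ?_) h
  rw [Category.assoc, incl_proj, hf]

theorem isClosedEmbedding_trans {m n : ℕ} (h : m ≤ n) :
    IsClosedEmbedding (T.trans h).onPaths :=
  T.trans_induction (motive := fun f => IsClosedEmbedding f.onPaths)
    (fun _ => IsClosedEmbedding.id) (fun _ hf => (T.isClosedEmbedding_incl _).comp hf) h

/-- The maps on path spaces. -/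
def transPaths (m n : ℕ) (h : m ≤ n) : C((T.stage m).paths, (T.stage n).paths) :=
  (T.trans h).onPaths

instance : DirectedSystem (fun n => (T.stage n).paths) (T.transPaths · · ·) where
  map_self n x := onPaths_congr (T.trans_self n) x
  map_map _ _ _ h h' x := onPaths_congr (T.trans_trans h h') x

/-- The colimit of the path spaces. -/
abbrev Paths : Type u := DirectLimit (fun n => (T.stage n).paths) T.transPaths

/-- The inclusion of the paths of a stage. -/
def ofStage (n : ℕ) (x : (T.stage n).paths) : T.Paths := ⟦⟨n, x⟩⟧

variable {T}

theorem continuous_ofStage (n : ℕ) : Continuous (T.ofStage n) :=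
  DirectLimit.continuous_mk (f := T.transPaths) n

theorem ofStage_trans {m n : ℕ} (h : m ≤ n) (x : (T.stage m).paths) :
    T.ofStage n ((T.trans h).onPaths x) = T.ofStage m x :=
  DirectLimit.mk_apply (F := fun n => (T.stage n).paths) (f := T.transPaths) m n x h

theorem ofStage_injective (n : ℕ) : Function.Injective (T.ofStage n) :=
  DirectLimit.mk_injective T.transPaths
    (fun _ _ h => (T.isClosedEmbedding_trans h).injective) n

theorem exists_factor {K : Type*} [TopologicalSpace K] [CompactSpace K] {g : K → T.Paths}
    (hg : Continuous g) :
    ∃ n, ∃ g' : K → (T.stage n).paths, Continuous g' ∧ ∀ k, g k = T.ofStage n (g' k) :=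
  DirectLimit.exists_factor (f := T.transPaths) (fun _ _ h => T.isClosedEmbedding_trans h) hg

theorem exists_factor₂ {K : Type*} [TopologicalSpace K] [CompactSpace K] {g₁ g₂ : K → T.Paths}
    (hg₁ : Continuous g₁) (hg₂ : Continuous g₂) :
    ∃ n, ∃ g₁' g₂' : K → (T.stage n).paths, Continuous g₁' ∧ Continuous g₂' ∧
      (∀ k, g₁ k = T.ofStage n (g₁' k)) ∧ ∀ k, g₂ k = T.ofStage n (g₂' k) :=
  DirectLimit.exists_factor₂ (f := T.transPaths) (fun _ _ h => T.isClosedEmbedding_trans h) hg₁ hg₂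

variable (T)

/-- The projection of the colimit of the path spaces. -/
def projPaths : T.Paths → X.paths :=
  DirectLimit.lift T.transPaths (fun n => (T.proj n).onPaths) fun _ _ h x =>
    (onPaths_congr (T.trans_proj h) x).symm

theorem continuous_projPaths : Continuous T.projPaths :=
  (DirectLimit.continuous_iff (f := T.transPaths)).2 fun n => map_continuous (T.proj n).onPaths

variable {T}

theorem tgt_eq_src {n : ℕ} {x y : (T.stage n).paths}
    (h : X.tgt (T.projPaths (T.ofStage n x)) = X.src (T.projPaths (T.ofStage n y))) :
    (T.stage n).tgt x = (T.stage n).src y :=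
  (T.bijective_proj n).1 (((T.proj n).tgt_onPaths x).symm.trans
    (h.trans ((T.proj n).src_onPaths y)))

/-- Representatives from different stages can be compared at a later stage, where the transition
maps preserve concatenation and the inclusion in the colimit is injective. -/
theorem exists_concat (x y : T.Paths) (h : X.tgt (T.projPaths x) = X.src (T.projPaths y)) :
    ∃ z : T.Paths, ∀ n a b (ha : T.ofStage n a = x) (hb : T.ofStage n b = y),
      z = T.ofStage n ((T.stage n).concat a b (tgt_eq_src (by rw [ha, hb, h]))) := by
  obtain ⟨n, a, b, rfl, rfl⟩ := DirectLimit.exists_eq_mk₂ T.transPaths x y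
  refine ⟨T.ofStage n ((T.stage n).concat a b (tgt_eq_src h)), fun m a' b' ha hb => ?_⟩
  rw [← ofStage_trans (le_max_left n m), ← ofStage_trans (le_max_right n m), Hom.map_concat, Hom.map_concat]
  refine congrArg _ (concat_congr _ (ofStage_injective _ ?_) (ofStage_injective _ ?_) _)
  · rw [ofStage_trans, ofStage_trans, ha]; rfl
  · rw [ofStage_trans, ofStage_trans, hb]; rfl

/-- Concatenation in the colimit. -/
noncomputable def concat (x y : T.Paths) (h : X.tgt (T.projPaths x) = X.src (T.projPaths y)) :
    T.Paths :=
  Classical.choose (exists_concat x y h)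

theorem concat_eq {x y : T.Paths} (h : X.tgt (T.projPaths x) = X.src (T.projPaths y)) {n : ℕ}
    {a b : (T.stage n).paths} (ha : T.ofStage n a = x) (hb : T.ofStage n b = y) :
    concat x y h = T.ofStage n ((T.stage n).concat a b (tgt_eq_src (by rw [ha, hb, h]))) :=
  Classical.choose_spec (exists_concat x y h) n a b ha hb

theorem projPaths_concat (x y : T.Paths) (h : X.tgt (T.projPaths x) = X.src (T.projPaths y)) :
    T.projPaths (concat x y h) = X.concat (T.projPaths x) (T.projPaths y) h := by
  obtain ⟨n, a, b, rfl, rfl⟩ := DirectLimit.exists_eq_mk₂ T.transPaths x y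
  rw [concat_eq (n := n) (a := a) (b := b) h rfl rfl]
  exact (T.proj n).map_concat a b _

/-- Both maps factor through a single stage by compactness, so continuity is inherited from that
stage. -/
theorem continuous_concat {K : Type u} [TopologicalSpace K] [CompactSpace K] [T2Space K]
    {a b : K → T.Paths} (ha : Continuous a) (hb : Continuous b)
    (h : ∀ k, X.tgt (T.projPaths (a k)) = X.src (T.projPaths (b k))) :
    Continuous fun k => concat (a k) (b k) (h k) := by
  obtain ⟨n, a', b', ha', hb', haa, hbb⟩ := exists_factor₂ ha hb
  refine ((continuous_ofStage n).comp ((T.stage n).continuous_concat_comp ha' hb' fun k => ?_)).congr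
    fun k => (concat_eq (h k) (haa k).symm (hbb k).symm).symm
  exact tgt_eq_src (by rw [← haa, ← hbb, h])

theorem kHausdorff (T : Tower X) : KHausdorff T.Paths := fun K a b => by
  obtain ⟨n, a', b', ha', hb', haa, hbb⟩ := exists_factor₂ (map_continuous a) (map_continuous b)
  have : {k | a k = b k} = {k | a' k = b' k} := by
    ext k
    change a k = b k ↔ a' k = b' k
    rw [haa, hbb, (ofStage_injective n).eq_iff]
  rw [this]
  exact WeakHausdorffSpace.isClosed_eq ha' hb'

variable (T)

/-- The colimit of a tower, before Kelleyfication. -/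
noncomputable def colimPreFlow : PreFlow.{u} where
  states := X.states
  paths := T.Paths
  src x := X.src (T.projPaths x)
  tgt x := X.tgt (T.projPaths x)
  locallyConstant_src := (IsLocallyConstant.iff_continuous _).2
    (X.continuous_src.comp T.continuous_projPaths)
  locallyConstant_tgt := (IsLocallyConstant.iff_continuous _).2
    (X.continuous_tgt.comp T.continuous_projPaths)
  concat := concat
  continuous_concat _ a b h := continuous_concat (map_continuous a) (map_continuous b) h
  kHausdorff := T.kHausdorff
  src_concat x y h := by rw [projPaths_concat, X.src_concat]
  tgt_concat x y h := by rw [projPaths_concat, X.tgt_concat]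
  concat_assoc x y z hxy hyz := by
    obtain ⟨n, a, b, c, hx, hy, hz⟩ := DirectLimit.exists_eq_mk₃ T.transPaths x y z
    obtain rfl : T.ofStage n a = x := hx.symm
    obtain rfl : T.ofStage n b = y := hy.symm
    obtain rfl : T.ofStage n c = z := hz.symm
    rw [concat_eq (n := n) (b := c) _ (concat_eq (n := n) (a := a) (b := b) hxy rfl rfl).symm rfl,
      concat_eq (n := n) (a := a) _ rfl (concat_eq (n := n) (a := b) (b := c) hyz rfl rfl).symm,
      (T.stage n).concat_assoc]

/-- The colimit of a tower. -/
noncomputable abbrev colim : DirectedFlow.{u} := T.colimPreFlow.toFlow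

/-- The projection of the colimit. -/
noncomputable def colimProj : T.colim ⟶ X where
  onStates := id
  onPaths := ⟨fun x => T.projPaths x.val, T.continuous_projPaths.comp Kify.continuous_val⟩
  src_onPaths _ := rfl
  tgt_onPaths _ := rfl
  map_concat _ _ _ := projPaths_concat _ _ _

/-- The inclusions of the stages. -/
noncomputable def colimIncl (n : ℕ) : T.stage n ⟶ T.colim where
  onStates := (T.proj n).onStates
  onPaths := ⟨fun x => Kify.of (T.ofStage n x), Kify.continuous_of_comp (continuous_ofStage n)⟩
  src_onPaths x := (T.proj n).src_onPaths x
  tgt_onPaths x := (T.proj n).tgt_onPaths x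
  map_concat x y h := Kify.ext (concat_eq (n := n) (a := x) (b := y)
    (((T.proj n).tgt_onPaths x).trans ((congrArg _ h).trans ((T.proj n).src_onPaths y).symm))
    rfl rfl).symm

theorem incl_colimIncl (n : ℕ) : T.incl n ≫ T.colimIncl (n + 1) = T.colimIncl n := by
  refine hom_ext (fun a => onStates_congr (T.incl_proj n) a) fun x => Kify.ext ?_
  have h := ofStage_trans n.le_succ x
  rw [trans_succ] at h
  exact h

variable {T}

theorem colim_hom_ext {U : DirectedFlow.{u}} {f g : T.colim ⟶ U}
    (h : ∀ n, T.colimIncl n ≫ f = T.colimIncl n ≫ g) : f = g := by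
  refine hom_ext (fun a => ?_) fun x => ?_
  · obtain ⟨b, rfl⟩ := (T.bijective_proj 0).2 a
    exact onStates_congr (h 0) b
  · obtain ⟨x⟩ := x
    obtain ⟨n, y, rfl⟩ := DirectLimit.exists_eq_mk T.transPaths x
    exact onPaths_congr (h n) y

theorem colim_exists_desc {U : DirectedFlow.{u}} (f : ∀ n, T.stage n ⟶ U)
    (hf : ∀ n, T.incl n ≫ f (n + 1) = f n) :
    ∃ g : T.colim ⟶ U, ∀ n, T.colimIncl n ≫ g = f n := by
  have hf' : ∀ {m n} (h : m ≤ n), T.trans h ≫ f n = f m := fun h =>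
    T.trans_induction (motive := fun {m n} t => t ≫ f n = f m) (fun n => Category.id_comp _)
      (fun t ht => by rw [Category.assoc, hf, ht]) h
  -- All stages have the states of `X`, so the map on states is determined by stage `0`.
  let s : X.states → U.states := fun a => (f 0).onStates
    ((Equiv.ofBijective _ (T.bijective_proj 0)).symm a)
  have hs : ∀ n a, s ((T.proj n).onStates a) = (f n).onStates a := fun n a => by
    obtain ⟨b, hb⟩ := (T.bijective_proj 0).2 ((T.proj n).onStates a)
    have hba : (T.trans (Nat.zero_le n)).onStates b = a := (T.bijective_proj n).1
      ((onStates_congr (T.trans_proj (Nat.zero_le n)) b).trans hb)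
    rw [← hb, ← hba]
    refine (congrArg _ ((Equiv.ofBijective _ (T.bijective_proj 0)).symm_apply_apply b)).trans ?_
    exact (onStates_congr (hf' (Nat.zero_le n)) b).symm
  let l : T.Paths → U.paths := DirectLimit.lift T.transPaths (fun n => (f n).onPaths)
    fun _ _ h x => (onPaths_congr (hf' h) x).symm
  have hl : Continuous l :=
    (DirectLimit.continuous_iff (f := T.transPaths)).2 fun n => map_continuous (f n).onPaths
  refine ⟨⟨s, ⟨fun x => l x.val, hl.comp Kify.continuous_val⟩, ?_, ?_, ?_⟩, fun n => ?_⟩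
  · rintro ⟨x⟩
    obtain ⟨n, y, rfl⟩ := DirectLimit.exists_eq_mk T.transPaths x
    refine ((f n).src_onPaths y).trans ((hs n _).symm.trans (congrArg s ?_))
    exact ((T.proj n).src_onPaths y).symm
  · rintro ⟨x⟩
    obtain ⟨n, y, rfl⟩ := DirectLimit.exists_eq_mk T.transPaths x
    refine ((f n).tgt_onPaths y).trans ((hs n _).symm.trans (congrArg s ?_))
    exact ((T.proj n).tgt_onPaths y).symm
  · rintro ⟨x⟩ ⟨y⟩ h
    obtain ⟨n, a, b, rfl, rfl⟩ := DirectLimit.exists_eq_mk₂ T.transPaths x y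
    refine (congrArg l (concat_eq (n := n) (a := a) (b := b) h rfl rfl)).trans ?_
    exact (f n).map_concat a b _
  · exact hom_ext (hs n) fun _ => rfl

end Tower

end DirectedFlow

namespace DirectedFlow

/-! ### The small object argument -/

/-- A flow over `X` with the states of `X`. -/
structure FlowOver (X : DirectedFlow.{u}) : Type (u + 1) where
  /-- the flow -/
  flow : DirectedFlow.{u}
  /-- the projection -/
  proj : flow ⟶ X
  bijective_proj : Function.Bijective proj.onStates

namespace FlowOver

variable {X : DirectedFlow.{u}} (S : FlowOver X)

/-- Attaching all cells. -/
noncomputable def next : FlowOver X where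
  flow := attached S.bijective_proj
  proj := attachDesc S.bijective_proj
  bijective_proj := attachDesc_bijective S.bijective_proj

/-- Attaching all cells `n` times. -/
noncomputable def iterate : ℕ → FlowOver X
  | 0 => S
  | n + 1 => (iterate n).next

/-- The tower obtained by attaching all cells again and again. -/
noncomputable def tower : Tower X where
  stage n := (S.iterate n).flow
  proj n := (S.iterate n).proj
  incl n := attachInl (S.iterate n).bijective_proj
  incl_proj n := attachInl_desc (S.iterate n).bijective_proj
  bijective_proj n := (S.iterate n).bijective_proj
  isClosedEmbedding_incl n := isClosedEmbedding_attachInl (S.iterate n).bijective_proj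

/-- A sphere is compact, so its map to the colimit comes from some stage `m`. The lifting problem is
then one of the cells attached to form stage `m + 1`, and that cell solves it. -/
theorem isTrivialFibration_colimProj : IsTrivialFibration S.tower.colimProj := by
  refine ⟨Function.bijective_id, fun n f g hf hg hfg => ?_⟩
  have hf' : Continuous fun y => ((f y).val : S.tower.Paths) := Kify.continuous_val.comp hf
  have : CompactSpace (Disk.bdry (EuclideanSpace ℝ (Fin n))) :=
    isCompact_iff_compactSpace.1 Disk.isClosed_bdry.isCompact
  obtain ⟨m, φ, hφ, hfφ⟩ := Tower.exists_factor hf'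
  have hfφ' : ∀ y, f y = (S.tower.colimIncl m).onPaths (φ y) := fun y => Kify.ext (hfφ y)
  let c : Cell (S.iterate m).proj := ⟨n, ⟨φ, hφ⟩, ⟨g, hg⟩, fun y =>
    (congrArg S.tower.colimProj.onPaths (hfφ' y)).symm.trans (hfg y)⟩
  refine ⟨fun y => (S.tower.colimIncl (m + 1)).onPaths
    (attachCell (S.iterate m).bijective_proj c y), ?_, fun y => ?_, fun y => ?_⟩
  · exact (map_continuous (S.tower.colimIncl (m + 1)).onPaths).comp
      (map_continuous (attachCell (S.iterate m).bijective_proj c))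
  · refine (congrArg (S.tower.colimIncl (m + 1)).onPaths
      (attachCell_bdry (S.iterate m).bijective_proj c y)).trans ?_
    exact (onPaths_congr (S.tower.incl_colimIncl m) (φ y)).trans (hfφ' y).symm
  · exact attachDesc_cell (S.iterate m).bijective_proj c y

/-- Lifts are extended one stage at a time, each over `g`, and glued by the universal property of
the colimit. -/
theorem colim_exists_lift {U V : DirectedFlow.{u}} {q : U ⟶ V} (hq : IsTrivialFibration q)
    {f : S.flow ⟶ U} {g : S.tower.colim ⟶ V} (h : f ≫ q = S.tower.colimIncl 0 ≫ g) :
    ∃ l : S.tower.colim ⟶ U, S.tower.colimIncl 0 ≫ l = f ∧ l ≫ q = g := by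
  have step : ∀ n (l : {l : S.tower.stage n ⟶ U // l ≫ q = S.tower.colimIncl n ≫ g}),
      ∃ l' : {l : S.tower.stage (n + 1) ⟶ U // l ≫ q = S.tower.colimIncl (n + 1) ≫ g},
        S.tower.incl n ≫ l'.1 = l.1 := fun n l => by
    obtain ⟨l', h₁, h₂⟩ := attached_exists_lift (hp := (S.iterate n).bijective_proj) hq
      (f := l.1) (g := S.tower.colimIncl (n + 1) ≫ g)
      (l.2.trans (by rw [← S.tower.incl_colimIncl n, Category.assoc]; rfl))
    exact ⟨⟨l', h₂⟩, h₁⟩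
  choose next hnext using step
  let l : ∀ n, {l : S.tower.stage n ⟶ U // l ≫ q = S.tower.colimIncl n ≫ g} :=
    fun n => Nat.rec ⟨f, h⟩ next n
  obtain ⟨k, hk⟩ := Tower.colim_exists_desc (fun n => (l n).1) fun n => hnext n (l n)
  refine ⟨k, hk 0, Tower.colim_hom_ext fun n => ?_⟩
  rw [← Category.assoc, hk, (l n).2]

end FlowOver

/-- The double of `X` over `X`. -/
noncomputable def doubleOver (X : DirectedFlow.{u}) : FlowOver X where
  flow := double X
  proj := doubleDesc (𝟙 X) (𝟙 X) fun _ => rfl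
  bijective_proj := Function.bijective_id

/-- Lifting out of the colimit splits into lifting out of the double, where `f₀` and `f₁` enter, and
extending along the tower. -/
theorem nonempty_codiagonalFactorization (X : DirectedFlow.{u}) :
    Nonempty (CodiagonalFactorization X) :=
  ⟨{ E := X.doubleOver.tower.colim
     i₀ := doubleInl X ≫ X.doubleOver.tower.colimIncl 0
     i₁ := doubleInr X ≫ X.doubleOver.tower.colimIncl 0
     π := X.doubleOver.tower.colimProj
     i₀_π := rfl
     i₁_π := rfl
     isTrivialFibration_π := X.doubleOver.isTrivialFibration_colimProj
     exists_lift := by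
      intro U V q hq f₀ f₁ g h₀ h₁
      obtain ⟨k, hk₀, hk₁, hk⟩ := double_exists_lift hq (h₀.trans (Category.assoc _ _ _))
        (h₁.trans (Category.assoc _ _ _))
      obtain ⟨l, hl, hlq⟩ := X.doubleOver.colim_exists_lift hq hk
      refine ⟨l, ?_, ?_, hlq⟩
      · rw [← hk₀, ← hl]; rfl
      · rw [← hk₁, ← hl]; rfl }⟩

end DirectedFlow

/-- The same pair `f`, `g` serves in both directions: only the homotopies from `g ≫ f` and `f ≫ g`
to the identities are converted. -/
theorem mainTheorem2 (X Y : DirectedFlow.{u}) (hX : IsCofibrant X) (hY : IsCofibrant Y) :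
    DirectedFlow.LeftHomotopyEquivalent X Y ↔ DirectedFlow.SHomotopyEquivalent X Y := by
  obtain ⟨F⟩ := X.nonempty_codiagonalFactorization
  obtain ⟨G⟩ := Y.nonempty_codiagonalFactorization
  constructor
  · rintro ⟨f, g, h₁, h₂⟩
    exact ⟨f, g, h₁.sHomotopic hY, h₂.sHomotopic hX⟩
  · rintro ⟨f, g, h₁, h₂⟩
    exact ⟨f, g, G.leftHomotopic h₁, F.leftHomotopic h₂⟩
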